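/- **Setting.** Let $\sigma(s)=\max\{0,s\}$ act entrywise. An implicit ReLU network of width $m$ with parameter $\theta=\mathrm{vec}(A,W,u,v)$, $A\in\mathbb R^{m\times m}$, $W\in\mathbb R^{m\times d}$, $u,v\in\mathbb R^m$, and scaling $\gamma>0$ has features $\phi(x)=\frac1{\sqrt m}\sigma(Wx)$, layers $z^0=0$, $z^{\ell+1}=\sigma(\frac{\gamma}{\sqrt m}Az^{\ell}+\phi(x))$, and prediction $\hat y=u^Tz^*+v^T\phi(x)$, where $z^*$ is the solution of $z=\sigma(\frac{\gamma}{\sqrt m}Az+\phi(x))$. The network is *well posed* at $\theta$ if for every $x\in\mathbb R^d$ this equation has exactly one solution and $z^\ell$ converges to it. For data $(x_i,y_i)_{i=1}^n$, $n\ge1$, the loss is $L(\theta)=\frac12\|\hat y-y\|^2$. At initialization all entries are independent, those of $A,W$ standard Gaussian and those of $u,v$ uniform on $\{1,-1\}$. A *gradient-flow trajectory* from $\theta(0)$ is an absolutely continuous curve with $-\theta'(t)\in\partial L(\theta(t))$ for almost every $t$, where $\partial L(\theta)$ is the Clarke subdifferential, the convex hull of the limits of $\nabla L(\theta_k)$ over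 sequences $\theta_k\to\theta$ of points of differentiability. Let $G^\infty=\mathbb E_{w\sim N(0,I_d)}[\sigma(Xw)\sigma(Xw)^T]\in\mathbb R^{n\times n}$, where $X$ has rows $x_i^T$, and $\lambda_0=\lambda_{\min}(G^\infty)$. Call $c>0$ *admissible* if $\|A(0)\|\le c\sqrt m$ (operator norm) holds with probability at least $1-2e^{-m}$ for every $m$. **Theorem (Convergence Rate of Gradient Flow).** Admissible constants exist. For every admissible $c$ and every $B>0$ there is a constant $C>0$, depending only on $c$ and $B$, such that the following holds. Let $\|x_i\|=1$ for all $i$, and let no two of the $x_i$ be parallel. Then $\lambda_0>0$. If moreover $|y_i|\le B$ for all $i$, $\delta\in(0,1)$, $$m\ \ge\ C\,\frac{n^2}{\lambda_0^2}\log\frac n\delta,\qquad 0<\gamma\le\min\Big\{\frac12,\frac1{4c}\Big\},$$ then with probability at least $1-\delta$ over the initialization: a gradient-flow trajectory from $\theta(0)$ exists on $[0,\infty)$, and along every gradient-flow trajectory from $\theta(0)$ (on $[0,\infty)$ or on a bounded interval $[0,T]$) the network is well posed at $\theta(t)$ and $$\|\hat y(t)-y\|^2\le e^{-\lambda_0t}\,\|\hat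 y(0)-y\|^2$$ for all times $t$ of the trajectory. -/

import Mathlib

open MeasureTheory ProbabilityTheory Filter Topology Set

noncomputable section

namespace ImplicitNet

/-- Index set of the vectorised parameter `θ = vec(A, W, u, v)` of a network of width `m` with
inputs in `ℝ^d`: the entries of `A`, then of `W`, then of `u`, then of `v`. -/
abbrev ParamIdx (m d : ℕ) : Type :=
  (Fin m × Fin m) ⊕ (Fin m × Fin d) ⊕ Fin m ⊕ Fin m

/-- The parameter space with its Euclidean structure. -/
abbrev Param (m d : ℕ) : Type := EuclideanSpace ℝ (ParamIdx m d)

/-- The weight matrix `A ∈ ℝ^{m × m}` of the equilibrium equation. -/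
def matA {m d : ℕ} (θ : Param m d) : Matrix (Fin m) (Fin m) ℝ :=
  Matrix.of fun r s => θ (Sum.inl (r, s))

/-- The weight matrix `W ∈ ℝ^{m × d}` of the feature map. -/
def matW {m d : ℕ} (θ : Param m d) : Matrix (Fin m) (Fin d) ℝ :=
  Matrix.of fun r k => θ (Sum.inr (Sum.inl (r, k)))

/-- The output weights `u` of the equilibrium point. -/
def vecU {m d : ℕ} (θ : Param m d) : Fin m → ℝ :=
  fun r => θ (Sum.inr (Sum.inr (Sum.inl r)))

/-- The output weights `v` of the feature vector. -/
def vecV {m d : ℕ} (θ : Param m d) : Fin m → ℝ :=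
  fun r => θ (Sum.inr (Sum.inr (Sum.inr r)))

/-- The ReLU activation. -/
def relu (s : ℝ) : ℝ := max 0 s

/-- The feature vector `φ(x) = σ(W x) / √m`. -/
def feature {m d : ℕ} (θ : Param m d) (x : EuclideanSpace ℝ (Fin d)) : Fin m → ℝ :=
  fun r => (1 / √(m : ℝ)) * relu ((matW θ).mulVec x.ofLp r)

/-- The transition `z ↦ σ((γ / √m) A z + φ(x))` from one layer to the next. -/
def transition {m d : ℕ} (γ : ℝ) (θ : Param m d) (x : EuclideanSpace ℝ (Fin d))
    (z : Fin m → ℝ) : Fin m → ℝ :=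
  fun r => relu ((γ / √(m : ℝ)) * (matA θ).mulVec z r + feature θ x r)

/-- The output of the `ℓ`-th layer, started from `z⁰ = 0`. -/
def layer {m d : ℕ} (γ : ℝ) (θ : Param m d) (x : EuclideanSpace ℝ (Fin d)) (l : ℕ) :
    Fin m → ℝ :=
  (transition γ θ x)^[l] 0

/-- `z` solves the equilibrium equation `z = σ((γ / √m) A z + φ(x))`. -/
def IsEquilibrium {m d : ℕ} (γ : ℝ) (θ : Param m d) (x : EuclideanSpace ℝ (Fin d))
    (z : Fin m → ℝ) : Prop :=
  z = transition γ θ x z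

/-- The network is well posed at the parameter `θ`: for every input the equilibrium equation has
exactly one solution, and the layers converge to it. -/
def WellPosed {m d : ℕ} (γ : ℝ) (θ : Param m d) : Prop :=
  ∀ x : EuclideanSpace ℝ (Fin d), ∃ z : Fin m → ℝ, IsEquilibrium γ θ x z ∧
    (∀ z' : Fin m → ℝ, IsEquilibrium γ θ x z' → z' = z) ∧
    Tendsto (layer γ θ x) atTop (𝓝 z)

open Classical in
/-- The equilibrium point `z*` (by convention `0` where it does not exist or is not unique). -/
def equilibrium {m d : ℕ} (γ : ℝ) (θ : Param m d) (x : EuclideanSpace ℝ (Fin d)) :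
    Fin m → ℝ :=
  if h : ∃! z : Fin m → ℝ, IsEquilibrium γ θ x z then h.choose else 0

/-- The vector `ŷ` of the predictions `ŷ_i = uᵀ z_i* + vᵀ φ_i` on the inputs `x_1, …, x_n`. -/
def prediction {m d n : ℕ} (γ : ℝ) (x : Fin n → EuclideanSpace ℝ (Fin d)) (θ : Param m d) :
    EuclideanSpace ℝ (Fin n) :=
  WithLp.toLp 2 fun i =>
    dotProduct (vecU θ) (equilibrium γ θ (x i)) + dotProduct (vecV θ) (feature θ (x i))

/-- The square loss `L(θ) = ½ ‖ŷ - y‖²`. -/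
def loss {m d n : ℕ} (γ : ℝ) (x : Fin n → EuclideanSpace ℝ (Fin d))
    (y : EuclideanSpace ℝ (Fin n)) (θ : Param m d) : ℝ :=
  (1 / 2) * ‖prediction γ x θ - y‖ ^ 2

/-- The Clarke subdifferential of `L` at `p`: the convex hull of all limits of gradients `∇L(p_k)`
at points of differentiability `p_k → p`. -/
def clarkeSubdifferential {E : Type*} [NormedAddCommGroup E] [InnerProductSpace ℝ E]
    [CompleteSpace E] (L : E → ℝ) (p : E) : Set E :=
  convexHull ℝ {g : E | ∃ s : ℕ → E, Tendsto s atTop (𝓝 p) ∧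
    (∀ k, DifferentiableAt ℝ L (s k)) ∧ Tendsto (fun k => gradient L (s k)) atTop (𝓝 g)}

/-- `θ` is a gradient-flow trajectory of `L` on `[0, T]` from `p₀`: an absolutely continuous curve
with `-θ'(t) ∈ ∂L(θ(t))` for almost every `t`. -/
def IsGradientFlowOn {E : Type*} [NormedAddCommGroup E] [InnerProductSpace ℝ E]
    [CompleteSpace E] (L : E → ℝ) (p₀ : E) (T : ℝ) (θ : ℝ → E) : Prop :=
  θ 0 = p₀ ∧ AbsolutelyContinuousOnInterval θ 0 T ∧
    ∀ᵐ t ∂(volume.restrict (Icc 0 T)), ∃ g ∈ clarkeSubdifferential L (θ t), HasDerivAt θ (-g) t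

/-- The symmetric Bernoulli (Rademacher) distribution on `{1, -1}`. -/
def rademacher : Measure ℝ :=
  (2⁻¹ : ENNReal) • Measure.dirac 1 + (2⁻¹ : ENNReal) • Measure.dirac (-1)

/-- Law of each coordinate at initialisation: standard Gaussian for the entries of `A` and `W`,
Rademacher for those of `u` and `v`. -/
def initLaw (m d : ℕ) : ParamIdx m d → Measure ℝ
  | Sum.inl _ => gaussianReal 0 1
  | Sum.inr (Sum.inl _) => gaussianReal 0 1
  | Sum.inr (Sum.inr _) => rademacher

/-- The random initialisation: all coordinates are independent. -/
def initMeasure (m d : ℕ) : Measure (Param m d) :=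
  (Measure.pi (initLaw m d)).map (WithLp.toLp 2)

/-- `c` bounds the random matrix `A(0)`: `‖A(0)‖ ≤ c √m` (operator norm) holds with probability at
least `1 - 2 e^{-m}`, for every width `m`. -/
def IsOpNormConstant (c : ℝ) : Prop :=
  0 < c ∧ ∀ m d : ℕ,
    initMeasure m d {θ | c * √(m : ℝ) < ‖Matrix.toEuclideanCLM (n := Fin m) (𝕜 := ℝ) (matA θ)‖} ≤
      ENNReal.ofReal (2 * Real.exp (-(m : ℝ)))

/-- The matrix `G^∞ = 𝔼_{w ∼ N(0, I_d)} [σ(X w) σ(X w)ᵀ]`. -/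
def gramInf {n d : ℕ} (x : Fin n → EuclideanSpace ℝ (Fin d)) : Matrix (Fin n) (Fin n) ℝ :=
  Matrix.of fun i j =>
    ∫ w, relu (inner ℝ (x i) w) * relu (inner ℝ (x j) w) ∂(stdGaussian (EuclideanSpace ℝ (Fin d)))

/-- `λ₀ = λ_min(G^∞)`, the smallest eigenvalue (the spectrum of a nonempty real symmetric matrix is
a nonempty finite set of reals, so the infimum is attained). -/
def lambdaZero {n d : ℕ} (x : Fin n → EuclideanSpace ℝ (Fin d)) : ℝ :=
  sInf (spectrum ℝ (gramInf x))

/-- Training data: unit vectors, no two of which are parallel. -/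
def DataAssumption {n d : ℕ} (x : Fin n → EuclideanSpace ℝ (Fin d)) : Prop :=
  (∀ i, ‖x i‖ = 1) ∧ ∀ i j, i ≠ j → LinearIndependent ℝ ![x i, x j]

/-- The training succeeds from the initial parameter `θ₀`: the gradient flow has a trajectory on
`[0, ∞)`, and along every trajectory (on `[0, ∞)`, or on any bounded interval `[0, T]`) the network
stays well posed and `‖ŷ(t) - y‖² ≤ e^{-λ₀ t} ‖ŷ(0) - y‖²`. -/
def FlowConverges {m d n : ℕ} (γ : ℝ) (x : Fin n → EuclideanSpace ℝ (Fin d))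
    (y : EuclideanSpace ℝ (Fin n)) (θ₀ : Param m d) : Prop :=
  (∃ θ : ℝ → Param m d, ∀ T : ℝ, 0 < T → IsGradientFlowOn (loss γ x y) θ₀ T θ) ∧
  ∀ (T : ℝ) (θ : ℝ → Param m d), 0 < T → IsGradientFlowOn (loss γ x y) θ₀ T θ →
    ∀ t ∈ Icc 0 T, WellPosed γ (θ t) ∧
      ‖prediction γ x (θ t) - y‖ ^ 2 ≤
        Real.exp (-(lambdaZero x) * t) * ‖prediction γ x (θ 0) - y‖ ^ 2

end ImplicitNet

end

/-! The loss obeys a Polyak-Łojasiewicz (PL) inequality through the output weights `v` alone. Moving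
`v` changes neither the features nor the equilibria, so the `v`-part of every Clarke subgradient is
the sum of the features weighted by the residuals. Its norm is at least the least singular value of
the feature matrix times `‖ŷ - y‖`. Features are `1/√m`-Lipschitz in the parameter, so a lower bound
`κ` on that singular value survives on a ball of radius of order `√(λ₀ m / n)`. On that ball the
transition also stays a contraction with constant `1/2`, which gives well-posedness. Under PL the
loss decays at rate `2κ²`, slightly above `λ₀`, and the displacement is at most `‖ŷ(0) - y‖ / κ`. If
that is less than the radius, the flow never leaves the ball (`IsPathPL.gradientFlow`,
`flowConverges_of_initial`).

The loss is not differentiable, so the chain rule along the flow needs an argument. At almost every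
time, any ReLU argument that sits at its kink has zero velocity. The loss then has a strict
directional derivative along the velocity, and all Clarke subgradients pair with the velocity to
this one value (`inner_eq_of_mem_clarke`, `ae_exists_hasStrictDirDeriv_loss`). Existence of the flow
comes from Euler polygons (`exists_lipschitz_flow`).

Three events at initialization suffice. `‖A‖ ≤ c√m` holds by admissibility, and `c = 10` is
admissible by `isOpNormConstant_ten`. The empirical Gram matrix is entrywise within `λ₀/(4n)` of
`G^∞`, by a Bernstein bound. The predictions are `O(√log(n/δ))`, by Hoeffding's bound for the signs
`u, v` with `A, W` fixed. Positivity of `λ₀` is the linear independence of the functions `w ↦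
σ(⟨x_i, w⟩)`.

If `n/δ < 2` then `n = 1`, and `log(n/δ)` may be arbitrarily small, so the width hypothesis gives no
concentration. There only finitely many widths escape the general bound. For each of them training
succeeds with some fixed positive probability, and `C` is enlarged until `1 - δ` lies below it. -/

open MeasureTheory ProbabilityTheory Filter Topology Set

noncomputable section

namespace ImplicitNet

/-! ### Absolutely continuous curves, and the ReLU along them. -/

section AbsolutelyContinuous

/-- A Lipschitz function of an absolutely continuous curve is absolutely continuous. -/
theorem LipschitzOnWith.comp_absolutelyContinuousOnInterval {X Y : Type*} [PseudoMetricSpace X]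
    [PseudoMetricSpace Y] {K : NNReal} {g : X → Y} {s : Set X} (hg : LipschitzOnWith K g s)
    {f : ℝ → X} {a b : ℝ} (hf : AbsolutelyContinuousOnInterval f a b)
    (hfs : ∀ t ∈ uIcc a b, f t ∈ s) : AbsolutelyContinuousOnInterval (fun t => g (f t)) a b := by
  rw [absolutelyContinuousOnInterval_iff] at hf ⊢
  intro ε hε
  -- `K + 1` instead of `K`, since `K` may be zero and the final inequality has to be strict.
  obtain ⟨δ, hδ, h⟩ := hf (ε / (K + 1)) (by positivity)
  refine ⟨δ, hδ, fun E hE hlt => ?_⟩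
  calc
    _ ≤ ∑ i ∈ Finset.range E.1, K * dist (f (E.2 i).1) (f (E.2 i).2) :=
      Finset.sum_le_sum fun i hi =>
        hg.dist_le_mul _ (hfs _ (hE.1 i hi).1) _ (hfs _ (hE.1 i hi).2)
    _ = K * ∑ i ∈ Finset.range E.1, dist (f (E.2 i).1) (f (E.2 i).2) := by rw [Finset.mul_sum]
    _ ≤ K * (ε / (K + 1)) := by gcongr; exact (h E hE hlt).le
    _ < (K + 1) * (ε / (K + 1)) := by gcongr; linarith
    _ = ε := by field

/-- An absolutely continuous function whose derivative is nonpositive almost everywhere does not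
increase. -/
theorem AbsolutelyContinuousOnInterval.le_of_ae_hasDerivAt_nonpos {f : ℝ → ℝ} {T : ℝ}
    (hT : 0 ≤ T) (hf : AbsolutelyContinuousOnInterval f 0 T)
    (h : ∀ᵐ t ∂(volume.restrict (Icc 0 T)), ∃ l ≤ 0, HasDerivAt f l t) : f T ≤ f 0 := by
  have h1 := hf.integral_deriv_eq_sub
  have h2 : ∫ x in (0:ℝ)..T, deriv f x ≤ 0 := by
    rw [intervalIntegral.integral_of_le hT]
    refine integral_nonpos_of_ae ?_
    have h3 := ae_restrict_of_ae_restrict_of_subset (Ioc_subset_Icc_self (a := (0:ℝ)) (b := T)) h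
    filter_upwards [h3] with t ht
    obtain ⟨l, hl, hd⟩ := ht
    simpa [hd.deriv] using hl
  linarith

/-- The zeros of a function at which its derivative is nonzero form a countable set. -/
theorem countable_zero_deriv_ne_zero (f : ℝ → ℝ) :
    {t : ℝ | f t = 0 ∧ ∃ l, l ≠ 0 ∧ HasDerivAt f l t}.Countable := by
  set s := {t : ℝ | f t = 0 ∧ ∃ l, l ≠ 0 ∧ HasDerivAt f l t}
  -- A zero with nonzero derivative is isolated from the right among the zeros, and a set of reals
  -- has only countably many such points.
  refine (countable_setOfPred_isolated_right_within (s := s)).mono fun t ht => ?_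
  refine ⟨ht, ?_⟩
  obtain ⟨h0, l, hl, hd⟩ := ht
  have h2 : ∀ᶠ u in 𝓝[>] t, f u ≠ 0 :=
    (hd.eventually_ne hl (c := 0)).filter_mono (nhdsWithin_mono _ fun u hu => ne_of_gt hu)
  rw [← Filter.empty_mem_iff_bot, inter_comm, nhdsWithin_inter', Filter.mem_inf_principal]
  filter_upwards [h2] with u hu hus using hu hus.1

/-- Applied to the arguments of the ReLU along a curve: at almost every time the kink is met with
zero velocity or without a derivative, so the two branches of the ReLU agree to first order. -/
theorem ae_deriv_eq_zero_of_eq_zero (f : ℝ → ℝ) :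
    ∀ᵐ t : ℝ, ∀ l, f t = 0 → HasDerivAt f l t → l = 0 := by
  have h := (countable_zero_deriv_ne_zero f).ae_notMem volume
  filter_upwards [h] with t ht l h0 hd
  by_contra hl
  exact ht ⟨h0, l, hl, hd⟩

end AbsolutelyContinuous

theorem relu_lipschitz (s t : ℝ) : |relu s - relu t| ≤ |s - t| := by
  unfold relu
  rw [max_comm 0 s, max_comm 0 t]
  exact abs_max_sub_max_le_abs s t 0

theorem relu_nonneg (s : ℝ) : 0 ≤ relu s := le_max_left _ _

theorem relu_of_nonneg {s : ℝ} (h : 0 ≤ s) : relu s = s := max_eq_right h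

theorem relu_of_nonpos {s : ℝ} (h : s ≤ 0) : relu s = 0 := max_eq_left h

theorem abs_relu_le (s : ℝ) : |relu s| ≤ |s| := by
  simpa [relu] using relu_lipschitz s 0

theorem continuous_relu : Continuous relu := continuous_const.max continuous_id

/-- The derivative of the ReLU along a curve that has derivative `0` where it vanishes. -/
theorem hasDerivAt_relu_comp {s : ℝ → ℝ} {l t : ℝ} (hs : HasDerivAt s l t)
    (h0 : s t = 0 → l = 0) : HasDerivAt (fun u => relu (s u)) (if 0 < s t then l else 0) t := by
  rcases lt_trichotomy (s t) 0 with h | h | h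
  · rw [if_neg h.not_gt]
    refine (hasDerivAt_const t (0 : ℝ)).congr_of_eventuallyEq ?_
    filter_upwards [hs.continuousAt.eventually_lt_const h] with u hu using relu_of_nonpos hu.le
  · rw [if_neg h.not_gt]
    have hl := h0 h
    subst hl
    rw [hasDerivAt_iff_isLittleO] at hs ⊢
    refine Asymptotics.IsBigO.trans_isLittleO ?_ hs
    refine Asymptotics.IsBigO.of_bound 1 (Eventually.of_forall fun u => ?_)
    simpa using relu_lipschitz (s u) (s t)
  · rw [if_pos h]
    refine hs.congr_of_eventuallyEq ?_
    filter_upwards [hs.continuousAt.eventually_const_lt h] with u hu using relu_of_nonneg hu.le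

/-! ### Strict directional derivatives and Clarke subgradients. -/

section StrictDirDeriv

theorem eventually_snd_ne_zero {E : Type*} [TopologicalSpace E] (p : E) :
    ∀ᶠ q : E × ℝ in 𝓝 p ×ˢ 𝓝[≠] (0 : ℝ), q.2 ≠ 0 :=
  tendsto_snd.eventually self_mem_nhdsWithin

variable {E : Type*} [NormedAddCommGroup E] [InnerProductSpace ℝ E]

/-- `f` is continuous at `p` and has there the strict directional derivative `l` in direction `h`:
`(f (q + τ h) - f q) / τ → l` as `(q, τ) → (p, 0)`. -/
def HasStrictDirDeriv (f : E → ℝ) (p h : E) (l : ℝ) : Prop :=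
  ContinuousAt f p ∧
    Tendsto (fun q : E × ℝ => (f (q.1 + q.2 • h) - f q.1) / q.2) (𝓝 p ×ˢ 𝓝[≠] 0) (𝓝 l)

theorem tendsto_add_smul (p h : E) :
    Tendsto (fun q : E × ℝ => q.1 + q.2 • h) (𝓝 p ×ˢ 𝓝[≠] (0 : ℝ)) (𝓝 p) := by
  have h1 : Tendsto (fun q : E × ℝ => q.1 + q.2 • h) (𝓝 p ×ˢ 𝓝 (0 : ℝ)) (𝓝 (p + (0 : ℝ) • h)) :=
    tendsto_fst.add (tendsto_snd.smul_const h)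
  rw [zero_smul, add_zero] at h1
  exact h1.mono_left (prod_mono le_rfl nhdsWithin_le_nhds)

namespace HasStrictDirDeriv

variable {f g : E → ℝ} {p h : E} {l k : ℝ}

theorem const (c : ℝ) (p h : E) : HasStrictDirDeriv (fun _ => c) p h 0 :=
  ⟨continuousAt_const, by simp⟩

theorem add (hf : HasStrictDirDeriv f p h l) (hg : HasStrictDirDeriv g p h k) :
    HasStrictDirDeriv (fun q => f q + g q) p h (l + k) := by
  refine ⟨hf.1.add hg.1, (hf.2.add hg.2).congr fun q => ?_⟩
  ring

theorem mul (hf : HasStrictDirDeriv f p h l) (hg : HasStrictDirDeriv g p h k) :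
    HasStrictDirDeriv (fun q => f q * g q) p h (l * g p + f p * k) := by
  refine ⟨hf.1.mul hg.1, ?_⟩
  have h1 : Tendsto (fun q : E × ℝ => g (q.1 + q.2 • h)) (𝓝 p ×ˢ 𝓝[≠] (0 : ℝ)) (𝓝 (g p)) :=
    hg.1.tendsto.comp (tendsto_add_smul p h)
  have h2 : Tendsto (fun q : E × ℝ => f q.1) (𝓝 p ×ˢ 𝓝[≠] (0 : ℝ)) (𝓝 (f p)) :=
    hf.1.tendsto.comp tendsto_fst
  refine ((hf.2.mul h1).add (h2.mul hg.2)).congr fun q => ?_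
  ring

theorem const_mul (c : ℝ) (hf : HasStrictDirDeriv f p h l) :
    HasStrictDirDeriv (fun q => c * f q) p h (c * l) := by
  simpa using (const c p h).mul hf

theorem sum {ι : Type*} (s : Finset ι) {f : ι → E → ℝ} {l : ι → ℝ}
    (hf : ∀ i ∈ s, HasStrictDirDeriv (f i) p h (l i)) :
    HasStrictDirDeriv (fun q => ∑ i ∈ s, f i q) p h (∑ i ∈ s, l i) := by
  classical
  induction s using Finset.induction_on with
  | empty => simpa using const 0 p h
  | insert a s ha ih =>
    simp only [Finset.sum_insert ha]
    exact (hf a (by simp)).add (ih fun i hi => hf i (by simp [hi]))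

theorem clm (L : E →L[ℝ] ℝ) (p h : E) : HasStrictDirDeriv L p h (L h) := by
  refine ⟨L.continuous.continuousAt, tendsto_const_nhds.congr' ?_⟩
  filter_upwards [eventually_snd_ne_zero p] with q hq
  simp [hq]

/-- Away from the kink the ReLU is locally linear. At the kink the difference quotients of `f` tend
to `0`, and the ReLU, being 1-Lipschitz, does not enlarge them. -/
theorem relu (hf : HasStrictDirDeriv f p h l) (h0 : f p = 0 → l = 0) :
    HasStrictDirDeriv (fun q => relu (f q)) p h (if 0 < f p then l else 0) := by
  refine ⟨continuous_relu.continuousAt.comp hf.1, ?_⟩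
  have h1 : Tendsto (fun q : E × ℝ => f (q.1 + q.2 • h)) (𝓝 p ×ˢ 𝓝[≠] (0 : ℝ)) (𝓝 (f p)) :=
    hf.1.tendsto.comp (tendsto_add_smul p h)
  have h2 : Tendsto (fun q : E × ℝ => f q.1) (𝓝 p ×ˢ 𝓝[≠] (0 : ℝ)) (𝓝 (f p)) :=
    hf.1.tendsto.comp tendsto_fst
  rcases lt_trichotomy (f p) 0 with hp | hp | hp
  · rw [if_neg hp.not_gt]
    refine tendsto_const_nhds.congr' ?_
    filter_upwards [h1.eventually_lt_const hp, h2.eventually_lt_const hp] with q hq1 hq2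
    simp [relu_of_nonpos hq1.le, relu_of_nonpos hq2.le]
  · rw [if_neg hp.not_gt]
    have hl := h0 hp
    subst hl
    refine squeeze_zero_norm (fun q => ?_) (by simpa using hf.2.norm)
    simp only [norm_div, Real.norm_eq_abs]
    exact div_le_div_of_nonneg_right (relu_lipschitz _ _) (abs_nonneg _)
  · rw [if_pos hp]
    refine hf.2.congr' ?_
    filter_upwards [h1.eventually_const_lt hp, h2.eventually_const_lt hp] with q hq1 hq2
    simp [relu_of_nonneg hq1.le, relu_of_nonneg hq2.le]

/-- Every Clarke subgradient pairs with a direction of strict differentiability to the strict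
directional derivative. -/
theorem inner_eq_of_mem_clarke [CompleteSpace E] (hf : HasStrictDirDeriv f p h l) {g : E}
    (hg : g ∈ clarkeSubdifferential f p) : inner ℝ g h = l := by
  have hconv : Convex ℝ {g : E | inner ℝ g h = l} := by
    intro a ha b hb s t _ _ hst
    simp only [mem_ofPred_eq] at ha hb ⊢
    rw [inner_add_left, inner_smul_left, inner_smul_left, ha, hb]
    simp [← add_mul, hst]
  refine convexHull_min ?_ hconv hg
  rintro g ⟨s, hs, hd, hlim⟩
  have h1 : Tendsto (fun k => inner ℝ (gradient f (s k)) h) atTop (𝓝 (inner ℝ g h)) :=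
    hlim.inner tendsto_const_nhds
  refine tendsto_nhds_unique h1 ?_
  rw [Metric.tendsto_nhds]
  intro ε hε
  -- The joint limit controls the quotients at all base points near `p` simultaneously. At the fixed
  -- base point `s k` one may therefore let `τ → 0`, which produces the gradient; the ball is closed
  -- so that the bound passes to this limit.
  have h2 := (hf.2.eventually (Metric.closedBall_mem_nhds l (half_pos hε))).curry
  filter_upwards [hs.eventually h2] with k hk
  have h3 : HasDerivAt (fun τ : ℝ => f (s k + τ • h)) (inner ℝ (gradient f (s k)) h) 0 := by
    have h4 := ((hd k).hasGradientAt.hasFDerivAt).hasLineDerivAt h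
    simpa [HasLineDerivAt] using h4
  have h5 := h3.tendsto_slope
  have h6 : inner ℝ (gradient f (s k)) h ∈ Metric.closedBall l (ε / 2) := by
    refine Metric.isClosed_closedBall.mem_of_tendsto h5 ?_
    filter_upwards [hk] with τ hτ
    simpa [slope_def_field] using hτ
  exact lt_of_le_of_lt (Metric.mem_closedBall.1 h6) (by linarith)

/-- The chain rule along a curve whose velocity is a direction of strict differentiability. -/
theorem hasDerivAt_comp {θ : ℝ → E} {t : ℝ} {K : NNReal} {s : Set E}
    (hs : s ∈ 𝓝 (θ t)) (hK : LipschitzOnWith K f s) (hθ : HasDerivAt θ h t)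
    (hf : HasStrictDirDeriv f (θ t) h l) : HasDerivAt (fun u => f (θ u)) l t := by
  rw [hasDerivAt_iff_tendsto_slope_zero] at hθ ⊢
  have h1 : Tendsto (fun τ : ℝ => (θ t, τ)) (𝓝[≠] 0) (𝓝 (θ t) ×ˢ 𝓝[≠] (0 : ℝ)) :=
    tendsto_const_nhds.prodMk tendsto_id
  have h2 := hf.2.comp h1
  -- By the Lipschitz bound, replacing the curve by its tangent line changes the quotient by at most
  -- `K` times the error of the velocity.
  have h3 : Tendsto (fun τ : ℝ => τ⁻¹ • (f (θ (t + τ)) - f (θ t)) -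
      (f (θ t + τ • h) - f (θ t)) / τ) (𝓝[≠] 0) (𝓝 0) := by
    have h4 : Tendsto (fun τ : ℝ => K * ‖τ⁻¹ • (θ (t + τ) - θ t) - h‖) (𝓝[≠] 0) (𝓝 0) := by
      simpa using ((hθ.sub_const h).norm).const_mul (K : ℝ)
    refine squeeze_zero_norm' ?_ h4
    have h5 : ∀ᶠ τ : ℝ in 𝓝[≠] 0, θ t + τ • h ∈ s :=
      ((tendsto_add_smul (θ t) h).comp h1).eventually hs
    have h6 : ∀ᶠ τ : ℝ in 𝓝[≠] 0, θ (t + τ) ∈ s := by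
      have hc : Tendsto (fun τ : ℝ => θ t + τ • (τ⁻¹ • (θ (t + τ) - θ t))) (𝓝[≠] 0)
          (𝓝 (θ t + (0 : ℝ) • h)) :=
        tendsto_const_nhds.add (Tendsto.smul (tendsto_id.mono_left nhdsWithin_le_nhds) hθ)
      rw [zero_smul, add_zero] at hc
      filter_upwards [hc.eventually hs, self_mem_nhdsWithin] with τ hτ h0
      have h7 : θ t + τ • (τ⁻¹ • (θ (t + τ) - θ t)) ∈ s := hτ
      rwa [smul_smul, mul_inv_cancel₀ (show τ ≠ 0 from h0), one_smul, add_sub_cancel] at h7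
    filter_upwards [h5, h6, self_mem_nhdsWithin] with τ h5 h6 h0
    have h0' : τ ≠ 0 := h0
    have h7 := hK.norm_sub_le h6 h5
    have h8 : τ⁻¹ • (f (θ (t + τ)) - f (θ t)) - (f (θ t + τ • h) - f (θ t)) / τ
        = τ⁻¹ * (f (θ (t + τ)) - f (θ t + τ • h)) := by
      simp only [smul_eq_mul]; field_simp; ring
    have h9 : τ⁻¹ • (θ (t + τ) - θ t) - h = τ⁻¹ • (θ (t + τ) - (θ t + τ • h)) := by
      rw [← sub_sub, smul_sub _ _ (τ • h), smul_smul, inv_mul_cancel₀ h0', one_smul]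
    rw [h8, h9, norm_mul, norm_smul]
    calc ‖τ⁻¹‖ * _ ≤ ‖τ⁻¹‖ * (K * ‖θ (t + τ) - (θ t + τ • h)‖) := by gcongr
      _ = _ := by ring
  simpa using h3.add h2

end HasStrictDirDeriv

end StrictDirDeriv

/-! ### Decay and confinement of the flow under a PL inequality. -/

section GradientFlow

variable {E : Type*} [NormedAddCommGroup E] [InnerProductSpace ℝ E] [CompleteSpace E]

/-- `L` is nonnegative, and on the ball of radius `ρ` around `p₀` it is Lipschitz, strictly
differentiable along absolutely continuous curves at almost every time, and satisfies the
Polyak-Łojasiewicz inequality `2 κ² L ≤ ‖g‖²` for all Clarke subgradients `g`. -/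
structure IsPathPL (L : E → ℝ) (p₀ : E) (ρ κ : ℝ) : Prop where
  pos : 0 < κ
  nonneg : ∀ p, 0 ≤ L p
  lipschitz : ∃ K, LipschitzOnWith K L (Metric.ball p₀ ρ)
  path : ∀ (T : ℝ) (θ : ℝ → E), AbsolutelyContinuousOnInterval θ 0 T →
    (∀ t ∈ uIcc 0 T, θ t ∈ Metric.ball p₀ ρ) →
    ∀ᵐ t, t ∈ uIcc 0 T → ∀ h, HasDerivAt θ h t → ∃ l, HasStrictDirDeriv L (θ t) h l
  pl : ∀ p ∈ Metric.ball p₀ ρ, ∀ g ∈ clarkeSubdifferential L p, 2 * κ ^ 2 * L p ≤ ‖g‖ ^ 2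

theorem absolutelyContinuousOnInterval_exp (c a b : ℝ) :
    AbsolutelyContinuousOnInterval (fun t => Real.exp (c * t)) a b := by
  refine ContDiffOn.absolutelyContinuousOnInterval ?_
  fun_prop

namespace IsPathPL

variable {L : E → ℝ} {p₀ : E} {ρ κ : ℝ} {T : ℝ} {θ : ℝ → E}

/-- Along a curve of steepest descent the loss decreases at the rate `‖g‖²`. -/
theorem ae_hasDerivAt (hL : IsPathPL L p₀ ρ κ) (hT : 0 ≤ T)
    (hac : AbsolutelyContinuousOnInterval θ 0 T)
    (hball : ∀ t ∈ Icc 0 T, θ t ∈ Metric.ball p₀ ρ)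
    (hflow : ∀ᵐ t ∂(volume.restrict (Icc 0 T)),
      ∃ g ∈ clarkeSubdifferential L (θ t), HasDerivAt θ (-g) t) :
    ∀ᵐ t ∂(volume.restrict (Icc 0 T)), t ∈ Icc 0 T ∧ ∃ g, HasDerivAt θ (-g) t ∧
      HasDerivAt (fun u => L (θ u)) (-‖g‖ ^ 2) t ∧ 2 * κ ^ 2 * L (θ t) ≤ ‖g‖ ^ 2 := by
  have hball' := hball
  rw [← uIcc_of_le hT] at hball'
  obtain ⟨K, hK⟩ := hL.lipschitz
  have h1 := (ae_restrict_iff' (μ := volume) (measurableSet_Icc (a := (0:ℝ)) (b := T))).2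
    (by simpa only [uIcc_of_le hT] using hL.path T θ hac hball')
  filter_upwards [hflow, h1, ae_restrict_mem measurableSet_Icc] with t ht h1 hmem
  obtain ⟨g, hg, hd⟩ := ht
  obtain ⟨l, hl⟩ := h1 _ hd
  -- The subgradient is paired with the velocity `-g` that it generates, which identifies the strict
  -- derivative as `-‖g‖²`.
  have hin := hl.inner_eq_of_mem_clarke hg
  rw [inner_neg_right, real_inner_self_eq_norm_sq] at hin
  subst hin
  exact ⟨hmem, g, hd, hl.hasDerivAt_comp (Metric.isOpen_ball.mem_nhds (hball t hmem)) hK hd,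
    hL.pl _ (hball t hmem) g hg⟩

/-- Grönwall's argument: by PL, `exp(2κ²t) L(θ t)` has nonpositive derivative almost everywhere. -/
theorem loss_le (hL : IsPathPL L p₀ ρ κ) (hT : 0 ≤ T) (h0 : θ 0 = p₀)
    (hac : AbsolutelyContinuousOnInterval θ 0 T)
    (hball : ∀ t ∈ Icc 0 T, θ t ∈ Metric.ball p₀ ρ)
    (hflow : ∀ᵐ t ∂(volume.restrict (Icc 0 T)),
      ∃ g ∈ clarkeSubdifferential L (θ t), HasDerivAt θ (-g) t) :
    L (θ T) ≤ Real.exp (-(2 * κ ^ 2) * T) * L p₀ := by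
  obtain ⟨K, hK⟩ := hL.lipschitz
  have hLac : AbsolutelyContinuousOnInterval (fun t => L (θ t)) 0 T :=
    LipschitzOnWith.comp_absolutelyContinuousOnInterval hK hac (by rwa [uIcc_of_le hT])
  have h1 := AbsolutelyContinuousOnInterval.le_of_ae_hasDerivAt_nonpos hT
    ((absolutelyContinuousOnInterval_exp (2 * κ ^ 2) 0 T).mul hLac) (by
      filter_upwards [hL.ae_hasDerivAt hT hac hball hflow] with t ht
      obtain ⟨-, g, -, hd, hpl⟩ := ht
      have he : HasDerivAt (fun t => Real.exp (2 * κ ^ 2 * t))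
          (Real.exp (2 * κ ^ 2 * t) * (2 * κ ^ 2)) t := by
        simpa using ((hasDerivAt_id t).const_mul (2 * κ ^ 2)).exp
      refine ⟨_, ?_, he.mul hd⟩
      have := Real.exp_pos (2 * κ ^ 2 * t)
      nlinarith)
  simp only [Pi.mul_apply, h0, mul_zero, Real.exp_zero, one_mul] at h1
  rw [neg_mul, Real.exp_neg, inv_mul_eq_div, le_div_iff₀ (Real.exp_pos _), mul_comm]
  exact h1

/-- The usual proof differentiates `√L`, which is singular where the loss vanishes. Here a Lyapunov
function replaces it: for a fixed `e` in the unit ball, `κ⟨e, θ⟩ + exp(κ²t) L(θ) / (2R) + (3R/4)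
exp(-κ²t)` does not increase. Its last two terms are nonnegative and are together at most `R` at
time `0`. -/
theorem dist_le (hL : IsPathPL L p₀ ρ κ) (hT : 0 ≤ T) (h0 : θ 0 = p₀)
    (hac : AbsolutelyContinuousOnInterval θ 0 T)
    (hball : ∀ t ∈ Icc 0 T, θ t ∈ Metric.ball p₀ ρ)
    (hflow : ∀ᵐ t ∂(volume.restrict (Icc 0 T)),
      ∃ g ∈ clarkeSubdifferential L (θ t), HasDerivAt θ (-g) t)
    {R : ℝ} (hR : 0 < R) (hR0 : 2 * L p₀ ≤ R ^ 2) : κ * ‖θ T - p₀‖ ≤ R := by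
  obtain ⟨K, hK⟩ := hL.lipschitz
  have hκ := hL.pos
  have hLac : AbsolutelyContinuousOnInterval (fun t => L (θ t)) 0 T :=
    LipschitzOnWith.comp_absolutelyContinuousOnInterval hK hac (by rwa [uIcc_of_le hT])
  have key : ∀ e : E, ‖e‖ ≤ 1 → κ * inner ℝ e (θ T - p₀) ≤ R := by
    intro e he
    have hiac : AbsolutelyContinuousOnInterval (fun t => inner ℝ e (θ t)) 0 T :=
      LipschitzOnWith.comp_absolutelyContinuousOnInterval
        ((innerSL ℝ e).lipschitz.lipschitzOnWith (s := univ)) hac (fun _ _ => mem_univ _)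
    have hF : AbsolutelyContinuousOnInterval ((fun t => κ * inner ℝ e (θ t)) +
        ((fun t => (2 * R)⁻¹ * (((fun t => Real.exp (κ ^ 2 * t)) * fun t => L (θ t)) t)) +
        fun t => (3 / 4 * R) * Real.exp (-κ ^ 2 * t))) 0 T :=
      (hiac.const_mul κ).add ((((absolutelyContinuousOnInterval_exp (κ ^ 2) 0 T).mul
        hLac).const_mul _).add ((absolutelyContinuousOnInterval_exp (-κ ^ 2) 0 T).const_mul _))
    have h1 := AbsolutelyContinuousOnInterval.le_of_ae_hasDerivAt_nonpos hT hF (by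
      filter_upwards [hL.ae_hasDerivAt hT hac hball hflow] with t ht
      obtain ⟨hmem, g, hd, hdL, hpl⟩ := ht
      have he1 : HasDerivAt (fun t => Real.exp (κ ^ 2 * t))
          (Real.exp (κ ^ 2 * t) * (κ ^ 2)) t := by
        simpa using ((hasDerivAt_id t).const_mul (κ ^ 2)).exp
      have he2 : HasDerivAt (fun t => Real.exp (-κ ^ 2 * t))
          (Real.exp (-κ ^ 2 * t) * (-κ ^ 2)) t := by
        simpa using ((hasDerivAt_id t).const_mul (-κ ^ 2)).exp
      have hi : HasDerivAt (fun t => inner ℝ e (θ t)) (inner ℝ e (-g)) t :=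
        (innerSL ℝ e).hasFDerivAt.comp_hasDerivAt t hd
      refine ⟨_, ?_, (hi.const_mul κ).add (((he1.mul hdL).const_mul _).add
        (he2.const_mul (3 / 4 * R)))⟩
      have hLt : L (θ t) ≤ Real.exp (-(2 * κ ^ 2) * t) * L p₀ := by
        refine hL.loss_le hmem.1 h0 (hac.mono ?_)
          (fun s hs => hball s ⟨hs.1, hs.2.trans hmem.2⟩)
          (ae_restrict_of_ae_restrict_of_subset (Icc_subset_Icc_right hmem.2) hflow)
        rw [uIcc_of_le hmem.1, uIcc_of_le hT]
        exact Icc_subset_Icc_right hmem.2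
      set q := Real.exp (κ ^ 2 * t) with hq
      have hq0 : 0 < q := Real.exp_pos _
      have hq1 : Real.exp (-κ ^ 2 * t) = q⁻¹ := by rw [hq, ← Real.exp_neg]; ring_nf
      have hq2 : Real.exp (-(2 * κ ^ 2) * t) = q⁻¹ ^ 2 := by
        rw [← hq1, ← Real.exp_nat_mul]; ring_nf
      rw [hq1]
      rw [hq2] at hLt
      have hin : -inner ℝ e g ≤ ‖g‖ := by
        have := (abs_le.1 (abs_real_inner_le_norm e g)).1
        nlinarith [norm_nonneg g]
      have hbound : q * L (θ t) ≤ q⁻¹ * (R ^ 2 / 2) := by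
        calc q * L (θ t) ≤ q * (q⁻¹ ^ 2 * L p₀) := by gcongr
          _ = q⁻¹ * L p₀ := by field_simp
          _ ≤ q⁻¹ * (R ^ 2 / 2) := by gcongr; linarith
      -- After the decay bound on the loss is inserted, the weight `3/4` makes the derivative bound
      -- the negative of a complete square.
      have hfin : κ * ‖g‖ + (2 * R)⁻¹ * (κ ^ 2 * (q⁻¹ * (R ^ 2 / 2)) - q * ‖g‖ ^ 2)
          - 3 / 4 * R * (q⁻¹ * κ ^ 2) = -(2 * R * q)⁻¹ * (q * ‖g‖ - κ * R) ^ 2 := by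
        field_simp
        ring
      have hneg : -(2 * R * q)⁻¹ * (q * ‖g‖ - κ * R) ^ 2 ≤ 0 := by
        have : 0 ≤ (2 * R * q)⁻¹ * (q * ‖g‖ - κ * R) ^ 2 := by positivity
        linarith
      have hmid : (2 * R)⁻¹ * (κ ^ 2 * (q * L (θ t)) - q * ‖g‖ ^ 2) ≤
          (2 * R)⁻¹ * (κ ^ 2 * (q⁻¹ * (R ^ 2 / 2)) - q * ‖g‖ ^ 2) := by gcongr
      rw [inner_neg_right]
      have := mul_le_mul_of_nonneg_left hin hκ.le
      linarith)
    simp only [Pi.add_apply, Pi.mul_apply, h0, mul_zero, Real.exp_zero, one_mul, mul_one] at h1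
    have h2 : 0 ≤ (2 * R)⁻¹ * (Real.exp (κ ^ 2 * T) * L (θ T)) := by
      have := hL.nonneg (θ T); positivity
    have h3 : (2 * R)⁻¹ * L p₀ ≤ R / 4 := by
      rw [inv_mul_le_iff₀ (by positivity)]; nlinarith
    have h4 : 0 ≤ 3 / 4 * R * Real.exp (-κ ^ 2 * T) := by positivity
    rw [inner_sub_right]
    linarith
  by_cases hz : θ T - p₀ = 0
  · simp [hz, hR.le]
  · have h5 := key (‖θ T - p₀‖⁻¹ • (θ T - p₀)) (by simp [norm_smul, hz])
    rw [real_inner_smul_left, real_inner_self_eq_norm_sq] at h5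
    have h6 : ‖θ T - p₀‖ ≠ 0 := norm_ne_zero_iff.2 hz
    have h7 : ‖θ T - p₀‖⁻¹ * ‖θ T - p₀‖ ^ 2 = ‖θ T - p₀‖ := by field_simp
    rwa [h7] at h5

/-- A curve that descends while it is inside the ball never leaves the ball. -/
theorem mem_ball (hL : IsPathPL L p₀ ρ κ) (hρ : 2 * L p₀ < (κ * ρ) ^ 2) (hρ0 : 0 < ρ)
    (hT : 0 ≤ T) (h0 : θ 0 = p₀) (hac : AbsolutelyContinuousOnInterval θ 0 T)
    (hflow : ∀ᵐ t ∂(volume.restrict (Icc 0 T)), θ t ∈ Metric.ball p₀ ρ →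
      ∃ g ∈ clarkeSubdifferential L (θ t), HasDerivAt θ (-g) t) :
    ∀ t ∈ Icc 0 T, θ t ∈ Metric.ball p₀ ρ := by
  have hκ := hL.pos
  -- The strict hypothesis leaves room for `R/κ < ρ' < ρ`. Up to the first time at radius `ρ'` the
  -- curve is inside the open ball of radius `ρ`, so `dist_le` applies and puts it within `R/κ`, a
  -- contradiction.
  obtain ⟨R, hR1, hR2⟩ : ∃ R, √(2 * L p₀) < R ∧ R < κ * ρ :=
    exists_between ((Real.sqrt_lt' (by positivity)).2 hρ)
  have hR : 0 < R := (Real.sqrt_nonneg _).trans_lt hR1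
  have hR0 : 2 * L p₀ ≤ R ^ 2 := by
    have := (Real.sqrt_lt' hR).1 hR1; linarith
  obtain ⟨ρ', hρ1, hρ2⟩ : ∃ ρ', R / κ < ρ' ∧ ρ' < ρ :=
    exists_between ((div_lt_iff₀' hκ).2 hR2)
  have hρ'0 : 0 < ρ' := (div_pos hR hκ).trans hρ1
  have hcont : ContinuousOn θ (Icc 0 T) := by simpa [uIcc_of_le hT] using hac.continuousOn
  by_contra! hcon
  obtain ⟨t₀, ht₀, hout⟩ := hcon
  set S : Set ℝ := {t ∈ Icc 0 T | ρ' ≤ ‖θ t - p₀‖} with hS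
  have hSc : IsClosed S :=
    (hcont.sub continuousOn_const).norm.preimage_isClosed_of_isClosed isClosed_Icc isClosed_Ici
  have hSne : S.Nonempty := ⟨t₀, ht₀, by
    rw [Metric.mem_ball, dist_eq_norm, not_lt] at hout; linarith⟩
  have hSb : BddBelow S := ⟨0, fun t ht => ht.1.1⟩
  have hmem := hSc.csInf_mem hSne hSb
  set τ := sInf S
  have hbefore : ∀ s ∈ Ico 0 τ, ‖θ s - p₀‖ < ρ' := by
    intro s hs
    by_contra! h
    exact absurd (csInf_le hSb (show s ∈ S from ⟨⟨hs.1, hs.2.le.trans hmem.1.2⟩, h⟩))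
      (not_le.2 hs.2)
  have hτ0 : 0 < τ := by
    rcases hmem.1.1.eq_or_lt with h | h
    · exfalso
      have := hmem.2
      rw [← h, h0] at this
      simp at this
      linarith
    · exact h
  have hτle : ‖θ τ - p₀‖ ≤ ρ' := by
    have hc : ContinuousWithinAt θ (Ico 0 τ) τ :=
      (hcont τ hmem.1).mono fun s hs => ⟨hs.1, hs.2.le.trans hmem.1.2⟩
    have hcl : τ ∈ closure (Ico 0 τ) := by
      rw [closure_Ico hτ0.ne]; exact right_mem_Icc.2 hτ0.le
    have := hc.mem_closure_image hcl
    have h2 : closure (θ '' Ico 0 τ) ⊆ Metric.closedBall p₀ ρ' := by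
      refine closure_minimal ?_ Metric.isClosed_closedBall
      rintro _ ⟨s, hs, rfl⟩
      rw [Metric.mem_closedBall, dist_eq_norm]
      exact (hbefore s hs).le
    simpa [dist_eq_norm] using h2 this
  have hball : ∀ t ∈ Icc 0 τ, θ t ∈ Metric.ball p₀ ρ := by
    intro t ht
    rw [Metric.mem_ball, dist_eq_norm]
    rcases ht.2.eq_or_lt with h | h
    · rw [h]; linarith
    · exact (hbefore t ⟨ht.1, h⟩).trans hρ2
  have hest := hL.dist_le hτ0.le h0 (hac.mono (by
      rw [uIcc_of_le hτ0.le, uIcc_of_le hT]; exact Icc_subset_Icc_right hmem.1.2)) hball (by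
      have h3 := ae_restrict_of_ae_restrict_of_subset (Icc_subset_Icc_right hmem.1.2) hflow
      filter_upwards [h3, ae_restrict_mem measurableSet_Icc] with t ht ht'
      exact ht (hball t ht')) hR hR0
  have h4 : ‖θ τ - p₀‖ ≤ R / κ := (le_div_iff₀' hκ).2 hest
  have h5 : ρ' ≤ ‖θ τ - p₀‖ := hmem.2
  linarith

end IsPathPL

end GradientFlow

/-! ### Existence of the Clarke gradient flow. -/

/-- In finite dimension the convex hull of a compact set is compact. -/
theorem isCompact_convexHull_of_isCompact {E : Type*} [NormedAddCommGroup E] [NormedSpace ℝ E]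
    [FiniteDimensional ℝ E] {s : Set E} (hs : IsCompact s) : IsCompact (convexHull ℝ s) := by
  -- By Carathéodory's theorem this many points suffice, so the hull is a continuous image of a
  -- compact set. Shorter combinations are padded with zero weights at a point already present.
  set N := Module.finrank ℝ E + 1
  have himage : convexHull ℝ s = (fun q : (Fin N → ℝ) × (Fin N → E) => ∑ i, q.1 i • q.2 i) ''
      (stdSimplex ℝ (Fin N) ×ˢ univ.pi fun _ => s) := by
    apply Subset.antisymm
    · intro x hx
      obtain ⟨ι, _, z, w, hz, hind, hw, hw1, rfl⟩ := eq_pos_convex_span_of_mem_convexHull hx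
      have hcard : Fintype.card ι ≤ Fintype.card (Fin N) := by
        have := hind.card_le_finrank_succ
        have h2 := Submodule.finrank_le (vectorSpan ℝ (range z))
        simp only [Fintype.card_fin, N]
        omega
      obtain ⟨f⟩ := Function.Embedding.nonempty_of_card_le hcard
      have hne : Nonempty ι := by
        by_contra h
        rw [not_nonempty_iff] at h
        simp at hw1
      obtain ⟨i₀⟩ := hne
      refine ⟨(Function.extend f w 0, Function.extend f z fun _ => z i₀), ⟨⟨fun j => ?_, ?_⟩, ?_⟩, ?_⟩
      · by_cases hj : ∃ i, f i = j
        · obtain ⟨i, rfl⟩ := hj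
          simp [f.injective.extend_apply, (hw i).le]
        · simp [Function.extend_apply' _ _ _ hj]
      · rw [← hw1]
        symm
        refine Fintype.sum_of_injective f f.injective _ _ (fun j hj => ?_) fun i => ?_
        · exact Function.extend_apply' _ _ _ (by simpa using hj)
        · simp [f.injective.extend_apply]
      · intro j _
        by_cases hj : ∃ i, f i = j
        · obtain ⟨i, rfl⟩ := hj
          simpa [f.injective.extend_apply] using hz (mem_range_self i)
        · simpa [Function.extend_apply' _ _ _ hj] using hz (mem_range_self i₀)
      · symm
        refine Fintype.sum_of_injective f f.injective _ _ (fun j hj => ?_) fun i => ?_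
        · have h0 : Function.extend f w 0 j = 0 :=
            Function.extend_apply' _ _ _ (by simpa using hj)
          simp [h0]
        · simp [f.injective.extend_apply]
    · rintro _ ⟨⟨w, z⟩, ⟨hw, hz⟩, rfl⟩
      exact (convex_convexHull ℝ s).sum_mem (fun i _ => hw.1 i) hw.2
        fun i _ => subset_convexHull ℝ s (hz i (mem_univ i))
  rw [himage]
  refine ((isCompact_stdSimplex ℝ (Fin N)).prod (isCompact_univ_pi fun _ => hs)).image ?_
  fun_prop

section Euler

variable {E : Type*} [NormedAddCommGroup E] [NormedSpace ℝ E]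

/-- Euler's polygon for the step size `ε` and the velocity field `-G`. -/
def eulerPoint (G : E → E) (p₀ : E) (ε : ℝ) : ℕ → E
  | 0 => p₀
  | j + 1 => eulerPoint G p₀ ε j - ε • G (eulerPoint G p₀ ε j)

theorem norm_eulerPoint_sub_le {G : E → E} {K : ℝ} (hG : ∀ p, ‖G p‖ ≤ K) (p₀ : E) {ε : ℝ}
    (hε : 0 ≤ ε) (i k : ℕ) :
    ‖eulerPoint G p₀ ε (i + k) - eulerPoint G p₀ ε i‖ ≤ K * (ε * k) := by
  induction k with
  | zero => simp
  | succ k ih =>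
    have h1 : eulerPoint G p₀ ε (i + (k + 1)) - eulerPoint G p₀ ε i =
        (eulerPoint G p₀ ε (i + k) - eulerPoint G p₀ ε i) -
          ε • G (eulerPoint G p₀ ε (i + k)) := by
      rw [← add_assoc, eulerPoint]; abel
    rw [h1]
    refine (norm_sub_le _ _).trans ?_
    rw [norm_smul, Real.norm_of_nonneg hε]
    have := mul_le_mul_of_nonneg_left (hG (eulerPoint G p₀ ε (i + k))) hε
    push_cast
    linarith

/-- The displacement of Euler's polygon is a multiple of an average of the velocities. -/
theorem eulerPoint_sub_mem {G : E → E} {p₀ : E} {ε : ℝ} {C : Set E} (hC : Convex ℝ C) (i k : ℕ)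
    (hk : 0 < k) (hGC : ∀ j < k, G (eulerPoint G p₀ ε (i + j)) ∈ C) :
    ∃ c ∈ C, eulerPoint G p₀ ε i - eulerPoint G p₀ ε (i + k) = (ε * k) • c := by
  have hk' : (k : ℝ) ≠ 0 := by positivity
  refine ⟨∑ j ∈ Finset.range k, (k : ℝ)⁻¹ • G (eulerPoint G p₀ ε (i + j)),
    hC.sum_mem (fun _ _ => by positivity) (by simp [hk'])
      fun j hj => hGC j (Finset.mem_range.1 hj), ?_⟩
  rw [← Finset.smul_sum, smul_smul, mul_assoc, mul_inv_cancel₀ hk', mul_one]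
  clear hGC hk hk'
  induction k with
  | zero => simp
  | succ k ih =>
    rw [Finset.sum_range_succ, smul_add, ← ih, ← add_assoc, eulerPoint]
    abel

end Euler

section Existence

variable {E : Type*} [NormedAddCommGroup E] [InnerProductSpace ℝ E] [FiniteDimensional ℝ E]

theorem norm_gradient_le {L : E → ℝ} {K : NNReal} {s : Set E} {q : E} (hs : s ∈ 𝓝 q)
    (hL : LipschitzOnWith K L s) : ‖gradient L q‖ ≤ K := by
  rw [gradient, LinearIsometryEquiv.norm_map]
  exact norm_fderiv_le_of_lipschitzOn ℝ hs hL

/-- The points of differentiability of a function that is Lipschitz on an open set are dense. -/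
theorem exists_differentiableAt_near {L : E → ℝ} {K : NNReal} {s : Set E} (hs : IsOpen s)
    (hL : LipschitzOnWith K L s) {p : E} (hp : p ∈ s) {ε : ℝ} (hε : 0 < ε) :
    ∃ q ∈ s, dist q p < ε ∧ DifferentiableAt ℝ L q := by
  let _ : MeasurableSpace E := borel E
  have : BorelSpace E := ⟨rfl⟩
  -- Rademacher's theorem; a set of full Lebesgue measure is dense.
  have hd : Dense {x | x ∈ s → DifferentiableWithinAt ℝ L s x} :=
    Measure.dense_of_ae (hL.ae_differentiableWithinAt_of_mem (μ := Measure.addHaar))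
  obtain ⟨q, hq, hqd⟩ := hd.inter_open_nonempty (s ∩ Metric.ball p ε)
    (hs.inter Metric.isOpen_ball) ⟨p, hp, Metric.mem_ball_self hε⟩
  exact ⟨q, hq.1, hq.2, (hqd hq.1).differentiableAt (hs.mem_nhds hq.1)⟩

/-- The gradients of `L` at the points of differentiability within distance `r` of `p`. -/
def nearGradients (L : E → ℝ) (p : E) (r : ℝ) : Set E :=
  {g | ∃ q, dist q p < r ∧ DifferentiableAt ℝ L q ∧ gradient L q = g}

theorem nearGradients_mono (L : E → ℝ) (p : E) {r r' : ℝ} (h : r ≤ r') :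
    nearGradients L p r ⊆ nearGradients L p r' :=
  fun _ ⟨q, hq, hd⟩ => ⟨q, hq.trans_le h, hd⟩

/-- The Clarke subdifferential as an intersection of closed convex hulls of gradients. -/
theorem mem_clarke_of_forall_mem_closure {L : E → ℝ} {p : E} {K : NNReal} {r₀ : ℝ} (hr₀ : 0 < r₀)
    (hL : LipschitzOnWith K L (Metric.ball p r₀)) {g : E}
    (hg : ∀ r > 0, g ∈ closure (convexHull ℝ (nearGradients L p r))) :
    g ∈ clarkeSubdifferential L p := by
  set D := {g : E | ∃ s : ℕ → E, Tendsto s atTop (𝓝 p) ∧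
    (∀ k, DifferentiableAt ℝ L (s k)) ∧ Tendsto (fun k => gradient L (s k)) atTop (𝓝 g)} with hD
  have hpos : ∀ k : ℕ, 0 < r₀ / (k + 1) := fun k => by positivity
  have hlim : Tendsto (fun k : ℕ => r₀ / ((k : ℝ) + 1)) atTop (𝓝 0) := by
    simpa [div_eq_mul_inv] using tendsto_one_div_add_atTop_nhds_zero_nat.const_mul r₀
  set V : ℕ → Set E := fun k => closure (nearGradients L p (r₀ / (k + 1))) with hV
  have hVD : ⋂ k, V k ⊆ D := by
    intro x hx
    rw [mem_iInter] at hx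
    have : ∀ k : ℕ, ∃ q, dist q p < r₀ / (k + 1) ∧ DifferentiableAt ℝ L q ∧
        dist (gradient L q) x < r₀ / (k + 1) := by
      intro k
      obtain ⟨_, ⟨q, hq, hd, rfl⟩, hdist⟩ := Metric.mem_closure_iff.1 (hx k) _ (hpos k)
      exact ⟨q, hq, hd, by rwa [dist_comm]⟩
    choose s hs1 hs2 hs3 using this
    exact ⟨s, tendsto_iff_dist_tendsto_zero.2
        (squeeze_zero (fun _ => dist_nonneg) (fun k => (hs1 k).le) hlim), hs2,
      tendsto_iff_dist_tendsto_zero.2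
        (squeeze_zero (fun _ => dist_nonneg) (fun k => (hs3 k).le) hlim)⟩
  have hDV : D ⊆ ⋂ k, V k := by
    rintro x ⟨s, hs1, hs2, hs3⟩
    refine mem_iInter.2 fun k => mem_closure_of_tendsto hs3 ?_
    filter_upwards [hs1.eventually (Metric.ball_mem_nhds p (hpos k))] with j hj
    exact ⟨s j, hj, hs2 j, rfl⟩
  have hDeq : D = ⋂ k, V k := hDV.antisymm hVD
  have hVcomp : ∀ k, IsCompact (V k) := by
    intro k
    refine (isCompact_closedBall (0 : E) K).of_isClosed_subset isClosed_closure
      (closure_minimal ?_ Metric.isClosed_closedBall)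
    rintro _ ⟨q, hq, -, rfl⟩
    rw [mem_closedBall_zero_iff]
    refine norm_gradient_le (Metric.isOpen_ball.mem_nhds (hq.trans_le ?_)) hL
    exact div_le_self hr₀.le (by linarith [Nat.cast_nonneg (α := ℝ) k])
  have hVdir : Directed (· ⊇ ·) V := by
    refine (antitone_nat_of_succ_le fun k => closure_mono (nearGradients_mono L p ?_)).directed_ge
    push_cast
    gcongr
    linarith
  have hDcomp : IsCompact D := by
    rw [hDeq]
    exact (hVcomp 0).of_isClosed_subset (isClosed_iInter fun k => isClosed_closure)
      (iInter_subset V 0)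
  -- As the hull is closed, it is enough to lie in each of its thickenings. The compact sets `V k`
  -- decrease to `D`, so some `V k` lies in a given thickening of `D`, and the thickening of the
  -- convex hull is convex and closed.
  have hcl : IsClosed (convexHull ℝ D) := (isCompact_convexHull_of_isCompact hDcomp).isClosed
  show g ∈ convexHull ℝ D
  rw [← hcl.closure_eq, Metric.closure_eq_iInter_cthickening]
  refine mem_iInter₂.2 fun δ hδ => ?_
  obtain ⟨k, hk⟩ := exists_subset_nhds_of_isCompact' hVdir hVcomp (fun k => isClosed_closure)
    (U := Metric.cthickening δ D) (fun x hx => by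
      rw [← hDeq] at hx
      exact mem_of_superset (Metric.isOpen_thickening.mem_nhds
        (Metric.self_subset_thickening hδ D hx)) (Metric.thickening_subset_cthickening δ D))
  refine closure_minimal (convexHull_min ?_ ((convex_convexHull ℝ D).cthickening δ))
    Metric.isClosed_cthickening (hg _ (hpos k))
  exact (subset_closure.trans hk).trans
    (Metric.cthickening_subset_of_subset δ (subset_convexHull ℝ D))

/-- Existence for the Clarke gradient flow: there is a Lipschitz curve from `p₀` that follows the
flow at almost every time at which it is inside the open set where `L` is Lipschitz. -/
theorem exists_lipschitz_flow {L : E → ℝ} {K : NNReal} {s : Set E} (hs : IsOpen s)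
    (hL : LipschitzOnWith K L s) (p₀ : E) :
    ∃ θ : ℝ → E, θ 0 = p₀ ∧ LipschitzWith K θ ∧
      ∀ᵐ t, 0 < t → θ t ∈ s → ∃ g ∈ clarkeSubdifferential L (θ t), HasDerivAt θ (-g) t := by
  classical
  -- The velocity at a point is borrowed from a nearby point of differentiability. Outside `s` it is
  -- set to zero, which keeps the polygons defined for all times.
  have hex : ∀ (k : ℕ) (p : E), ∃ g : E, ‖g‖ ≤ K ∧ (p ∈ s → ∃ q, dist q p < 1 / ((k : ℝ) + 1) ∧
      DifferentiableAt ℝ L q ∧ gradient L q = g) := by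
    intro k p
    by_cases hp : p ∈ s
    · obtain ⟨q, hqs, hq, hd⟩ := exists_differentiableAt_near hs hL hp
        (show 0 < 1 / ((k : ℝ) + 1) by positivity)
      exact ⟨gradient L q, norm_gradient_le (hs.mem_nhds hqs) hL, fun _ => ⟨q, hq, hd, rfl⟩⟩
    · exact ⟨0, by simp, fun h => absurd h hp⟩
  choose G hGK hG using hex
  set ε : ℕ → ℝ := fun k => 1 / ((k : ℝ) + 1) with hεdef
  have hε : ∀ k, 0 < ε k := fun k => by positivity
  have hε0 : Tendsto ε atTop (𝓝 0) := tendsto_one_div_add_atTop_nhds_zero_nat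
  -- A step function in time. Rounding to whole steps costs one step, hence the extra `ε k` in the
  -- bounds below; at times `t ≤ 0` the floor gives the starting point.
  set P : ℕ → ℝ → E := fun k t => eulerPoint (G k) p₀ (ε k) ⌊t / ε k⌋₊ with hP
  have hstep : ∀ (k : ℕ) (a b : ℝ), a ≤ b →
      ∃ N : ℕ, ⌊b / ε k⌋₊ = ⌊a / ε k⌋₊ + N ∧ ε k * N ≤ b - a + ε k ∧
        (0 ≤ a → b - a - ε k ≤ ε k * N) := by
    intro k a b hab
    have hdiv : a / ε k ≤ b / ε k := div_le_div_of_nonneg_right hab (hε k).le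
    obtain ⟨N, hN⟩ := Nat.exists_eq_add_of_le (Nat.floor_le_floor hdiv)
    have hNr : (⌊b / ε k⌋₊ : ℝ) = ⌊a / ε k⌋₊ + N := by exact_mod_cast hN
    have e1 : b / ε k * ε k = b := div_mul_cancel₀ _ (hε k).ne'
    have e2 : a / ε k * ε k = a := div_mul_cancel₀ _ (hε k).ne'
    refine ⟨N, hN, ?_, fun ha => ?_⟩
    · have h1 : a / ε k < ⌊a / ε k⌋₊ + 1 := Nat.lt_floor_add_one _
      rcases le_or_gt 0 (b / ε k) with hb | hb
      · have h2 : (⌊b / ε k⌋₊ : ℝ) ≤ b / ε k := Nat.floor_le hb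
        have h3 : (N : ℝ) ≤ b / ε k - a / ε k + 1 := by linarith
        nlinarith [mul_le_mul_of_nonneg_right h3 (hε k).le]
      · have h2 : ⌊b / ε k⌋₊ = 0 := Nat.floor_of_nonpos hb.le
        have h3 : N = 0 := by omega
        rw [h3]
        have := hε k
        push_cast
        linarith
    · have h1 : b / ε k < ⌊b / ε k⌋₊ + 1 := Nat.lt_floor_add_one _
      have h2 : (⌊a / ε k⌋₊ : ℝ) ≤ a / ε k := Nat.floor_le (div_nonneg ha (hε k).le)
      have h3 : b / ε k - a / ε k - 1 ≤ N := by linarith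
      nlinarith [mul_le_mul_of_nonneg_right h3 (hε k).le]
  have hPlip : ∀ (k : ℕ) (a b : ℝ), ‖P k a - P k b‖ ≤ K * (|a - b| + ε k) := by
    intro k a b
    wlog hab : b ≤ a generalizing a b
    · rw [norm_sub_rev, abs_sub_comm]; exact this b a (le_of_not_ge hab)
    obtain ⟨N, hN, hN1, -⟩ := hstep k b a hab
    simp only [hP, hN]
    refine (norm_eulerPoint_sub_le (hGK k) p₀ (hε k).le _ _).trans ?_
    rw [abs_of_nonneg (sub_nonneg.2 hab)]
    gcongr
  have hP0 : ∀ k, P k 0 = p₀ := fun k => by simp [hP, eulerPoint]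
  have hε1 : ∀ k, ε k ≤ 1 := fun k => by
    rw [hεdef]; simp only
    rw [div_le_one (by positivity)]; linarith [Nat.cast_nonneg (α := ℝ) k]
  -- Limits along an ultrafilter exist at every time by compactness of balls, with no subsequence to
  -- extract.
  let U : Ultrafilter ℕ := Filter.hyperfilter ℕ
  have hU : (U : Filter ℕ) ≤ atTop := Nat.hyperfilter_le_atTop
  have hlim : ∀ t : ℝ, ∃ x, Tendsto (fun k => P k t) U (𝓝 x) := by
    intro t
    obtain ⟨x, -, hx⟩ := (isCompact_closedBall p₀ (K * (|t| + 1))).ultrafilter_le_nhds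
      (U.map fun k => P k t) (by
        rw [le_principal_iff]
        refine Filter.Eventually.of_forall (f := (U : Filter ℕ)) fun k => ?_
        change P k t ∈ Metric.closedBall _ _
        rw [Metric.mem_closedBall, dist_eq_norm]
        have := hPlip k t 0
        rw [hP0, sub_zero] at this
        refine this.trans ?_
        gcongr
        exact hε1 k)
    exact ⟨x, hx⟩
  choose θ hθ using hlim
  have hεU : Tendsto ε U (𝓝 0) := hε0.mono_left hU
  have hθlip : LipschitzWith K θ := by
    refine LipschitzWith.of_dist_le_mul fun a b => ?_
    rw [dist_eq_norm, Real.dist_eq]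
    have h1 : Tendsto (fun k => K * (|a - b| + ε k)) U (𝓝 (K * (|a - b| + 0))) :=
      (tendsto_const_nhds.add hεU).const_mul _
    rw [add_zero] at h1
    exact le_of_tendsto_of_tendsto ((hθ a).sub (hθ b)).norm h1
      (Filter.Eventually.of_forall fun k => hPlip k a b)
  refine ⟨θ, ?_, hθlip, ?_⟩
  · exact tendsto_nhds_unique (hθ 0) (by simpa only [hP0] using tendsto_const_nhds)
  filter_upwards [hθlip.ae_differentiableAt (μ := volume)] with t htd ht hts
  refine ⟨-deriv θ t, ?_, by simpa using htd.hasDerivAt⟩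
  obtain ⟨r₀, hr₀, hball⟩ := Metric.isOpen_iff.1 hs _ hts
  refine mem_clarke_of_forall_mem_closure hr₀ (hL.mono hball) fun r hr => ?_
  set C := closure (convexHull ℝ (nearGradients L (θ t) r)) with hC
  have hCconv : Convex ℝ C := (convex_convexHull ℝ _).closure
  set r' := min r r₀ with hr'
  have hr'0 : 0 < r' := lt_min hr hr₀
  -- The quotient is a limit of averages of gradients taken near `θ t`. Four errors below `r'/4`
  -- each keep those gradients within `r'`: the borrowed point, the distance from `P k t` to `θ t`,
  -- the motion during `η`, and one extra step.
  have hmain : ∀ η : ℝ, 0 < η → K * η < r' / 4 → -(η⁻¹ • (θ (t + η) - θ t)) ∈ C := by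
    intro η hη hηr
    choose N hN hN1 hN2 using fun k => hstep k t (t + η) (by linarith)
    have hNlim : Tendsto (fun k => ε k * N k) U (𝓝 η) := by
      refine tendsto_of_tendsto_of_tendsto_of_le_of_le (g := fun k => η - ε k)
        (h := fun k => η + ε k) (by simpa using tendsto_const_nhds.sub hεU)
        (by simpa using tendsto_const_nhds.add hεU) (fun k => ?_) (fun k => ?_)
      · have := hN2 k ht.le; simp only; linarith
      · have := hN1 k; simp only; linarith
    have hKε : Tendsto (fun k => K * ε k) U (𝓝 0) := by simpa using hεU.const_mul (K : ℝ)
    have hmem : ∀ᶠ k in (U : Filter ℕ),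
        (ε k * N k)⁻¹ • (P k t - P k (t + η)) ∈ C := by
      filter_upwards [(hθ t).eventually (Metric.ball_mem_nhds _ (show 0 < r' / 4 by positivity)),
        hεU.eventually_lt_const (show (0:ℝ) < r' / 4 by positivity),
        hKε.eventually_lt_const (show (0:ℝ) < r' / 4 by positivity),
        hNlim.eventually_const_lt hη] with k hk1 hk2 hk3 hk4
      have hNpos : 0 < N k := by
        rcases Nat.eq_zero_or_pos (N k) with h | h
        · simp [h] at hk4
        · exact h
      obtain ⟨c, hc, hceq⟩ := eulerPoint_sub_mem (G := G k) (p₀ := p₀) (ε := ε k) hCconv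
        ⌊t / ε k⌋₊ (N k) hNpos (fun j hj => by
          have hj1 := norm_eulerPoint_sub_le (hGK k) p₀ (hε k).le ⌊t / ε k⌋₊ j
          have hj2 : ε k * j ≤ η + ε k := by
            have h1 := hN1 k
            have h2 : ε k * j ≤ ε k * N k := by
              have := (hε k).le
              gcongr
            linarith
          have hj3 : (K : ℝ) * (ε k * j) ≤ K * (η + ε k) := by gcongr
          have hj4 : dist (eulerPoint (G k) p₀ (ε k) (⌊t / ε k⌋₊ + j)) (θ t) < r' / 4 * 3 := by
            refine (dist_triangle _ (P k t) _).trans_lt ?_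
            rw [dist_eq_norm]
            have h3 : dist (P k t) (θ t) < r' / 4 := hk1
            have h4 : ‖eulerPoint (G k) p₀ (ε k) (⌊t / ε k⌋₊ + j) - P k t‖ ≤
              K * (ε k * j) := hj1
            linarith
          obtain ⟨q, hq, hd, hqe⟩ := hG k (eulerPoint (G k) p₀ (ε k) (⌊t / ε k⌋₊ + j))
            (hball (Metric.mem_ball.2 (by
              have := min_le_right r r₀; linarith)))
          refine subset_closure (subset_convexHull ℝ _ ⟨q, ?_, hd, hqe⟩)
          refine (dist_triangle _ _ _).trans_lt (lt_of_lt_of_le (add_lt_add hq hj4) ?_)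
          have := min_le_left r r₀
          have h5 : 1 / ((k : ℝ) + 1) < r' / 4 := hk2
          linarith)
      have h6 : P k t - P k (t + η) = (ε k * N k) • c := by
        simp only [hP, hN k]; exact hceq
      rw [h6, smul_smul, inv_mul_cancel₀ hk4.ne', one_smul]
      exact hc
    have hlimit : Tendsto (fun k => (ε k * N k)⁻¹ • (P k t - P k (t + η))) U
        (𝓝 (η⁻¹ • (θ t - θ (t + η)))) :=
      (hNlim.inv₀ hη.ne').smul ((hθ t).sub (hθ (t + η)))
    rw [← smul_neg, neg_sub]
    exact isClosed_closure.mem_of_tendsto hlimit hmem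
  have hder : Tendsto (fun η : ℝ => -(η⁻¹ • (θ (t + η) - θ t))) (𝓝[>] 0) (𝓝 (-deriv θ t)) :=
    ((hasDerivAt_iff_tendsto_slope_zero.1 htd.hasDerivAt).mono_left
      (nhdsWithin_mono _ fun x hx => ne_of_gt hx)).neg
  refine isClosed_closure.mem_of_tendsto hder ?_
  have hsmall : Tendsto (fun η : ℝ => K * η) (𝓝[>] 0) (𝓝 0) := by
    have : Tendsto (fun η : ℝ => K * η) (𝓝 0) (𝓝 (K * 0)) := tendsto_id.const_mul _
    rw [mul_zero] at this
    exact this.mono_left nhdsWithin_le_nhds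
  filter_upwards [self_mem_nhdsWithin, hsmall.eventually_lt_const
    (show (0:ℝ) < r' / 4 by positivity)] with η h1 h2 using hmain η h1 h2

end Existence

/-- Under the Polyak-Łojasiewicz inequality on a large enough ball, the Clarke gradient flow has a
trajectory on `[0, ∞)`, and every trajectory stays in the ball and converges at a linear rate. -/
theorem IsPathPL.gradientFlow {E : Type*} [NormedAddCommGroup E] [InnerProductSpace ℝ E]
    [FiniteDimensional ℝ E] {L : E → ℝ} {p₀ : E} {ρ κ : ℝ} (hL : IsPathPL L p₀ ρ κ)
    (hρ0 : 0 < ρ) (hρ : 2 * L p₀ < (κ * ρ) ^ 2) :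
    (∃ θ : ℝ → E, ∀ T : ℝ, 0 < T → IsGradientFlowOn L p₀ T θ) ∧
    ∀ (T : ℝ) (θ : ℝ → E), 0 < T → IsGradientFlowOn L p₀ T θ →
      ∀ t ∈ Icc 0 T, θ t ∈ Metric.ball p₀ ρ ∧
        L (θ t) ≤ Real.exp (-(2 * κ ^ 2) * t) * L p₀ := by
  constructor
  · obtain ⟨K, hK⟩ := hL.lipschitz
    obtain ⟨θ, h0, hlip, hflow⟩ := exists_lipschitz_flow Metric.isOpen_ball hK p₀
    refine ⟨θ, fun T hT => ?_⟩
    have hac : AbsolutelyContinuousOnInterval θ 0 T :=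
      hlip.lipschitzOnWith.absolutelyContinuousOnInterval
    -- The constructed curve is known to follow the flow only inside the ball. `mem_ball` asks for
    -- no more, and its conclusion then removes the proviso.
    have hflow' : ∀ᵐ t ∂(volume.restrict (Icc 0 T)), θ t ∈ Metric.ball p₀ ρ →
        ∃ g ∈ clarkeSubdifferential L (θ t), HasDerivAt θ (-g) t := by
      have h1 : ∀ᵐ t : ℝ ∂(volume.restrict (Icc 0 T)), t ≠ 0 :=
        ae_restrict_of_ae (Measure.ae_ne volume 0)
      filter_upwards [ae_restrict_of_ae hflow, h1, ae_restrict_mem measurableSet_Icc]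
        with t ht hne hmem hball
      exact ht (lt_of_le_of_ne hmem.1 hne.symm) hball
    have hball := hL.mem_ball hρ hρ0 hT.le h0 hac hflow'
    refine ⟨h0, hac, ?_⟩
    filter_upwards [hflow', ae_restrict_mem measurableSet_Icc] with t ht hmem
    exact ht (hball t hmem)
  · rintro T θ hT ⟨h0, hac, hflow⟩ t ht
    have hball := hL.mem_ball hρ hρ0 hT.le h0 hac (hflow.mono fun t h _ => h)
    refine ⟨hball t ht, hL.loss_le ht.1 h0 (hac.mono ?_)
      (fun s hs => hball s ⟨hs.1, hs.2.trans ht.2⟩)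
      (ae_restrict_of_ae_restrict_of_subset (Icc_subset_Icc_right ht.2) hflow)⟩
    rw [uIcc_of_le ht.1, uIcc_of_le hT.le]
    exact Icc_subset_Icc_right ht.2

/-! ### The equilibrium equation as a contraction. -/

section Network

variable {m d n : ℕ}

/-- The weight matrix `A` as an operator of the Euclidean space. -/
def opA (θ : Param m d) : EuclideanSpace ℝ (Fin m) →L[ℝ] EuclideanSpace ℝ (Fin m) :=
  Matrix.toEuclideanCLM (n := Fin m) (𝕜 := ℝ) (matA θ)

/-- The feature vector as an element of the Euclidean space. -/
def feat (θ : Param m d) (x : EuclideanSpace ℝ (Fin d)) : EuclideanSpace ℝ (Fin m) :=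
  WithLp.toLp 2 (feature θ x)

/-- The equilibrium point as an element of the Euclidean space. -/
def equil (γ : ℝ) (θ : Param m d) (x : EuclideanSpace ℝ (Fin d)) : EuclideanSpace ℝ (Fin m) :=
  WithLp.toLp 2 (equilibrium γ θ x)

/-- The ReLU, entrywise. -/
def reluVec (z : EuclideanSpace ℝ (Fin m)) : EuclideanSpace ℝ (Fin m) :=
  WithLp.toLp 2 fun r => relu (z r)

/-- The argument of the ReLU in the equilibrium equation. -/
def preact (γ : ℝ) (θ : Param m d) (x : EuclideanSpace ℝ (Fin d)) (z : EuclideanSpace ℝ (Fin m)) :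
    EuclideanSpace ℝ (Fin m) :=
  (γ / √(m : ℝ)) • opA θ z + feat θ x

theorem opA_apply (θ : Param m d) (z : EuclideanSpace ℝ (Fin m)) (r : Fin m) :
    opA θ z r = (matA θ).mulVec z.ofLp r := by
  simp [opA, Matrix.ofLp_toEuclideanCLM]

theorem toLp_transition (γ : ℝ) (θ : Param m d) (x : EuclideanSpace ℝ (Fin d))
    (z : EuclideanSpace ℝ (Fin m)) :
    WithLp.toLp 2 (transition γ θ x z.ofLp) = reluVec (preact γ θ x z) := by
  ext r
  simp [transition, reluVec, preact, opA_apply, feat]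

theorem norm_le_norm_of_abs_le {ι : Type*} [Fintype ι] {a b : EuclideanSpace ℝ ι}
    (h : ∀ r, |a r| ≤ |b r|) : ‖a‖ ≤ ‖b‖ := by
  rw [EuclideanSpace.norm_eq, EuclideanSpace.norm_eq]
  refine Real.sqrt_le_sqrt (Finset.sum_le_sum fun r _ => ?_)
  simpa using sq_le_sq' (by linarith [h r, abs_nonneg (a r), abs_nonneg (b r)]) (h r)

theorem norm_reluVec_sub_le (a b : EuclideanSpace ℝ (Fin m)) :
    ‖reluVec a - reluVec b‖ ≤ ‖a - b‖ :=
  norm_le_norm_of_abs_le fun r => relu_lipschitz (a r) (b r)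

theorem norm_reluVec_le (a : EuclideanSpace ℝ (Fin m)) : ‖reluVec a‖ ≤ ‖a‖ :=
  norm_le_norm_of_abs_le fun r => abs_relu_le (a r)

theorem opA_sub (p q : Param m d) : opA (p - q) = opA p - opA q := by
  rw [opA, opA, opA, ← map_sub]
  rfl

theorem norm_matrix_mulVec_sq_le {ι κ : Type*} [Fintype ι] [Fintype κ] (M : Matrix ι κ ℝ)
    (v : κ → ℝ) : ∑ r, (M.mulVec v r) ^ 2 ≤ (∑ r, ∑ s, M r s ^ 2) * ∑ s, v s ^ 2 := by
  rw [Finset.sum_mul]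
  exact Finset.sum_le_sum fun r _ => Finset.sum_mul_sq_le_sq_mul_sq _ _ _

theorem norm_sq_eq_param (θ : Param m d) : ‖θ‖ ^ 2 = (∑ r, ∑ s, matA θ r s ^ 2) +
    ((∑ r, ∑ s, matW θ r s ^ 2) + ((∑ r, vecU θ r ^ 2) + ∑ r, vecV θ r ^ 2)) := by
  rw [EuclideanSpace.norm_sq_eq]
  simp [Fintype.sum_sum_type, Fintype.sum_prod_type, matA, matW, vecU, vecV]

theorem sum_matA_sq_le (θ : Param m d) : ∑ r, ∑ s, matA θ r s ^ 2 ≤ ‖θ‖ ^ 2 := by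
  rw [norm_sq_eq_param]
  have : 0 ≤ (∑ r, ∑ s, matW θ r s ^ 2) + ((∑ r, vecU θ r ^ 2) + ∑ r, vecV θ r ^ 2) := by
    positivity
  linarith

theorem sum_matW_sq_le (θ : Param m d) : ∑ r, ∑ s, matW θ r s ^ 2 ≤ ‖θ‖ ^ 2 := by
  rw [norm_sq_eq_param]
  have h1 : 0 ≤ ∑ r, ∑ s, matA θ r s ^ 2 := by positivity
  have : 0 ≤ (∑ r, vecU θ r ^ 2) + ∑ r, vecV θ r ^ 2 := by positivity
  linarith

theorem norm_opA_le (θ : Param m d) : ‖opA θ‖ ≤ ‖θ‖ := by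
  refine ContinuousLinearMap.opNorm_le_bound _ (norm_nonneg _) fun v => ?_
  refine abs_le_of_sq_le_sq' ?_ (by positivity) |>.2
  rw [mul_pow, EuclideanSpace.norm_sq_eq, EuclideanSpace.norm_sq_eq v]
  simp only [opA_apply, Real.norm_eq_abs, sq_abs]
  refine (norm_matrix_mulVec_sq_le _ _).trans ?_
  gcongr
  exact sum_matA_sq_le θ

/-- The ReLU is 1-Lipschitz and the Frobenius norm of the `W`-block is at most the parameter norm.
The factor `1/√m` is what keeps the features of a wide network nearly fixed. -/
theorem norm_feat_sub_le (p q : Param m d) (x : EuclideanSpace ℝ (Fin d)) :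
    ‖feat p x - feat q x‖ ≤ 1 / √(m : ℝ) * ‖p - q‖ * ‖x‖ := by
  refine abs_le_of_sq_le_sq' ?_ (by positivity) |>.2
  rw [mul_pow, mul_pow, EuclideanSpace.norm_sq_eq, EuclideanSpace.norm_sq_eq x]
  calc ∑ r, ‖(feat p x - feat q x) r‖ ^ 2
      ≤ ∑ r, (1 / √(m : ℝ)) ^ 2 * ((matW (p - q)).mulVec x.ofLp r) ^ 2 := by
        refine Finset.sum_le_sum fun r _ => ?_
        have h1 : (matW (p - q)).mulVec x.ofLp r =
            (matW p).mulVec x.ofLp r - (matW q).mulVec x.ofLp r := by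
          rw [← Pi.sub_apply, ← Matrix.sub_mulVec]; rfl
        have h2 : (feat p x - feat q x) r = 1 / √(m : ℝ) *
            (relu ((matW p).mulVec x.ofLp r) - relu ((matW q).mulVec x.ofLp r)) := by
          simp [feat, feature]; ring
        rw [h2, h1, norm_mul, mul_pow, Real.norm_eq_abs, Real.norm_eq_abs, sq_abs]
        exact mul_le_mul_of_nonneg_left (sq_le_sq.2 (by
          rw [abs_abs]; exact relu_lipschitz _ _)) (by positivity)
    _ ≤ (1 / √(m : ℝ)) ^ 2 * (‖p - q‖ ^ 2 * ∑ s, x.ofLp s ^ 2) := by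
        rw [← Finset.mul_sum]
        gcongr
        refine (norm_matrix_mulVec_sq_le _ _).trans ?_
        gcongr
        exact sum_matW_sq_le _
    _ = _ := by simp; ring

theorem feat_zero (x : EuclideanSpace ℝ (Fin d)) : feat (0 : Param m d) x = 0 := by
  ext r
  simp [feat, feature, matW, Matrix.mulVec, dotProduct, relu]

/-- The parameters at which the transition is a contraction with constant `1 / 2`. -/
def Contracting (γ : ℝ) (θ : Param m d) : Prop := γ / √(m : ℝ) * ‖opA θ‖ ≤ 1 / 2

variable {γ : ℝ} {θ : Param m d} {x : EuclideanSpace ℝ (Fin d)}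

theorem norm_smul_opA_le (hγ : 0 ≤ γ) (hθ : Contracting γ θ) (v : EuclideanSpace ℝ (Fin m)) :
    ‖(γ / √(m : ℝ)) • opA θ v‖ ≤ 1 / 2 * ‖v‖ := by
  rw [norm_smul, Real.norm_of_nonneg (by positivity)]
  calc γ / √(m : ℝ) * ‖opA θ v‖ ≤ γ / √(m : ℝ) * (‖opA θ‖ * ‖v‖) := by
        gcongr; exact (opA θ).le_opNorm v
    _ = γ / √(m : ℝ) * ‖opA θ‖ * ‖v‖ := by ring
    _ ≤ _ := by gcongr; exact hθ

theorem contractingWith_transition (hγ : 0 ≤ γ) (hθ : Contracting γ θ)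
    (x : EuclideanSpace ℝ (Fin d)) :
    ContractingWith (1 / 2) fun z => reluVec (preact γ θ x z) := by
  refine ⟨by rw [← NNReal.coe_lt_coe]; norm_num, LipschitzWith.of_dist_le_mul fun z w => ?_⟩
  rw [dist_eq_norm, dist_eq_norm]
  refine (norm_reluVec_sub_le _ _).trans ?_
  have h1 : preact γ θ x z - preact γ θ x w = (γ / √(m : ℝ)) • opA θ (z - w) := by
    simp [preact, smul_sub]
  rw [h1]
  simpa using norm_smul_opA_le hγ hθ (z - w)

theorem isEquilibrium_iff (z : EuclideanSpace ℝ (Fin m)) :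
    IsEquilibrium γ θ x z.ofLp ↔
      Function.IsFixedPt (fun z => reluVec (preact γ θ x z)) z := by
  rw [IsEquilibrium, Function.IsFixedPt, ← toLp_transition]
  constructor
  · intro h; rw [← h]
  · intro h; exact (congrArg WithLp.ofLp h).symm

/-- The network is well posed where the transition is a contraction. -/
theorem Contracting.wellPosed (hγ : 0 ≤ γ) (hθ : Contracting γ θ) : WellPosed γ θ := by
  intro x
  have hc := contractingWith_transition hγ hθ x
  refine ⟨(hc.fixedPoint).ofLp, (isEquilibrium_iff _).2 hc.fixedPoint_isFixedPt,
    fun z' hz' => ?_, ?_⟩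
  · have := hc.fixedPoint_unique ((isEquilibrium_iff (WithLp.toLp 2 z')).1 hz')
    rw [← this]
  · have h1 := hc.tendsto_iterate_fixedPoint (0 : EuclideanSpace ℝ (Fin m))
    have h2 : ∀ l, ((fun z => reluVec (preact γ θ x z))^[l] 0).ofLp = layer γ θ x l := by
      intro l
      induction l with
      | zero => rfl
      | succ l ih =>
        rw [Function.iterate_succ_apply', ← toLp_transition, ih, layer, layer,
          Function.iterate_succ_apply']
    have h3 := ((PiLp.continuous_ofLp 2 fun _ : Fin m => ℝ).tendsto _).comp h1
    exact h3.congr h2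

theorem Contracting.equil_eq (hγ : 0 ≤ γ) (hθ : Contracting γ θ)
    (x : EuclideanSpace ℝ (Fin d)) :
    equil γ θ x = reluVec (preact γ θ x (equil γ θ x)) := by
  obtain ⟨z, hz, huniq, -⟩ := hθ.wellPosed hγ x
  have hex : ∃! z : Fin m → ℝ, IsEquilibrium γ θ x z := ⟨z, hz, huniq⟩
  have h1 : IsEquilibrium γ θ x (equil γ θ x).ofLp := by
    simp only [equil, equilibrium, dif_pos hex]
    exact hex.choose_spec.1
  exact ((isEquilibrium_iff _).1 h1).symm

theorem Contracting.norm_equil_le (hγ : 0 ≤ γ) (hθ : Contracting γ θ)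
    (x : EuclideanSpace ℝ (Fin d)) : ‖equil γ θ x‖ ≤ 2 * ‖feat θ x‖ := by
  have h1 : ‖equil γ θ x‖ ≤ 1 / 2 * ‖equil γ θ x‖ + ‖feat θ x‖ := by
    conv_lhs => rw [hθ.equil_eq hγ x]
    exact (norm_reluVec_le _).trans ((norm_add_le _ _).trans
      (by gcongr; exact norm_smul_opA_le hγ hθ _))
  linarith

/-- The difference of the arguments splits into `A_p (z_p - z_q)`, absorbed on the left by
contraction, and the changes of `A` at `z_q` and of the features. -/
theorem norm_equil_sub_le {p q : Param m d} (hγ : 0 ≤ γ) (hp : Contracting γ p)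
    (hq : Contracting γ q) (x : EuclideanSpace ℝ (Fin d)) :
    ‖equil γ p x - equil γ q x‖ ≤
      2 * (γ / √(m : ℝ) * ‖p - q‖ * ‖equil γ q x‖ + ‖feat p x - feat q x‖) := by
  set a := γ / √(m : ℝ) with ha
  have ha0 : 0 ≤ a := by positivity
  have h1 : preact γ p x (equil γ p x) - preact γ q x (equil γ q x) =
      a • opA p (equil γ p x - equil γ q x) +
        (a • opA (p - q) (equil γ q x) + (feat p x - feat q x)) := by
    simp only [preact, opA_sub, map_sub, smul_sub, sub_apply, ← ha]
    abel
  have h2 : ‖equil γ p x - equil γ q x‖ ≤ 1 / 2 * ‖equil γ p x - equil γ q x‖ +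
      (a * ‖p - q‖ * ‖equil γ q x‖ + ‖feat p x - feat q x‖) := by
    conv_lhs => rw [hp.equil_eq hγ x, hq.equil_eq hγ x]
    refine (norm_reluVec_sub_le _ _).trans ?_
    rw [h1]
    refine (norm_add_le _ _).trans (add_le_add (norm_smul_opA_le hγ hp _) ?_)
    refine (norm_add_le _ _).trans (add_le_add_left ?_ _)
    rw [norm_smul, Real.norm_of_nonneg ha0, mul_assoc]
    gcongr
    exact ((opA (p - q)).le_opNorm _).trans (by gcongr; exact norm_opA_le _)
  linarith

end Network

/-! ### Lipschitz continuity and strict directional derivatives of the loss. -/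

section BoundedLipschitz

variable {E : Type*} [NormedAddCommGroup E]

/-- `f` is bounded and Lipschitz on `s`. -/
def BddLipOn (f : E → ℝ) (s : Set E) : Prop :=
  ∃ K : ℝ, 0 ≤ K ∧ (∀ p ∈ s, |f p| ≤ K) ∧ ∀ p ∈ s, ∀ q ∈ s, |f p - f q| ≤ K * ‖p - q‖

namespace BddLipOn

variable {f g : E → ℝ} {s : Set E}

theorem const (c : ℝ) (s : Set E) : BddLipOn (fun _ => c) s :=
  ⟨|c|, abs_nonneg c, fun _ _ => le_rfl, fun p _ q _ => by simp; positivity⟩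

theorem add (hf : BddLipOn f s) (hg : BddLipOn g s) : BddLipOn (fun p => f p + g p) s := by
  obtain ⟨K, hK, hf1, hf2⟩ := hf
  obtain ⟨M, hM, hg1, hg2⟩ := hg
  refine ⟨K + M, by positivity, fun p hp => (abs_add_le _ _).trans
    (add_le_add (hf1 p hp) (hg1 p hp)), fun p hp q hq => ?_⟩
  rw [add_sub_add_comm, add_mul]
  exact (abs_add_le _ _).trans (add_le_add (hf2 p hp q hq) (hg2 p hp q hq))

theorem mul (hf : BddLipOn f s) (hg : BddLipOn g s) : BddLipOn (fun p => f p * g p) s := by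
  obtain ⟨K, hK, hf1, hf2⟩ := hf
  obtain ⟨M, hM, hg1, hg2⟩ := hg
  refine ⟨K * M + K * M, by positivity, fun p hp => ?_, fun p hp q hq => ?_⟩
  · rw [abs_mul]
    have := mul_le_mul (hf1 p hp) (hg1 p hp) (abs_nonneg _) hK
    nlinarith [mul_nonneg hK hM]
  · have h1 : f p * g p - f q * g q = f p * (g p - g q) + (f p - f q) * g q := by ring
    rw [h1]
    refine (abs_add_le _ _).trans ?_
    rw [abs_mul, abs_mul]
    have h2 := mul_le_mul (hf1 p hp) (hg2 p hp q hq) (abs_nonneg _) hK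
    have h3 := mul_le_mul (hf2 p hp q hq) (hg1 q hq) (abs_nonneg _)
      (mul_nonneg hK (norm_nonneg _))
    linarith

theorem sum {ι : Type*} (t : Finset ι) {f : ι → E → ℝ} (hf : ∀ i ∈ t, BddLipOn (f i) s) :
    BddLipOn (fun p => ∑ i ∈ t, f i p) s := by
  classical
  induction t using Finset.induction_on with
  | empty => simpa using const 0 s
  | insert a t ha ih =>
    simp only [Finset.sum_insert ha]
    exact (hf a (by simp)).add (ih fun i hi => hf i (by simp [hi]))

theorem lipschitzOnWith (hf : BddLipOn f s) : ∃ K, LipschitzOnWith K f s := by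
  obtain ⟨K, hK, -, hf2⟩ := hf
  exact ⟨⟨K, hK⟩, LipschitzOnWith.of_dist_le_mul fun p hp q hq => by
    rw [Real.dist_eq, dist_eq_norm]; exact hf2 p hp q hq⟩

end BddLipOn

end BoundedLipschitz

section Loss

variable {m d n : ℕ} {γ : ℝ}

theorem norm_feat_le (p : Param m d) (x : EuclideanSpace ℝ (Fin d)) :
    ‖feat p x‖ ≤ 1 / √(m : ℝ) * ‖p‖ * ‖x‖ := by
  simpa [feat_zero] using norm_feat_sub_le p 0 x

theorem abs_coord_le {ι : Type*} [Fintype ι] (z : EuclideanSpace ℝ ι) (r : ι) : |z r| ≤ ‖z‖ := by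
  simpa using PiLp.norm_apply_le z r

theorem bddLipOn_coord {ι : Type*} [Fintype ι] (p₀ : EuclideanSpace ℝ ι) (ρ : ℝ) (i : ι) :
    BddLipOn (fun p : EuclideanSpace ℝ ι => p i) (Metric.ball p₀ ρ) := by
  refine ⟨‖p₀‖ + |ρ| + 1, by positivity, fun p hp => ?_, fun p hp q hq => ?_⟩
  · rw [Metric.mem_ball, dist_eq_norm] at hp
    have h1 : ‖p‖ ≤ ‖p₀‖ + ‖p - p₀‖ := by
      simpa [add_comm] using norm_add_le (p - p₀) p₀
    linarith [abs_coord_le p i, le_abs_self ρ]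
  · have h1 := abs_coord_le (p - q) i
    rw [PiLp.sub_apply] at h1
    nlinarith [norm_nonneg p₀, abs_nonneg ρ, norm_nonneg (p - q),
      mul_nonneg (norm_nonneg p₀) (norm_nonneg (p - q)),
      mul_nonneg (abs_nonneg ρ) (norm_nonneg (p - q))]

theorem norm_le_of_mem_ball {E : Type*} [NormedAddCommGroup E] {p p₀ : E} {ρ : ℝ}
    (hp : p ∈ Metric.ball p₀ ρ) : ‖p‖ ≤ ‖p₀‖ + |ρ| := by
  rw [Metric.mem_ball, dist_eq_norm] at hp
  have h1 : ‖p‖ ≤ ‖p₀‖ + ‖p - p₀‖ := by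
    simpa [add_comm] using norm_add_le (p - p₀) p₀
  linarith [le_abs_self ρ]

theorem bddLipOn_feat (p₀ : Param m d) (ρ : ℝ) (x : EuclideanSpace ℝ (Fin d)) (r : Fin m) :
    BddLipOn (fun p => feat p x r) (Metric.ball p₀ ρ) := by
  refine ⟨1 / √(m : ℝ) * (‖p₀‖ + |ρ|) * ‖x‖ + 1 / √(m : ℝ) * ‖x‖, by positivity,
    fun p hp => ?_, fun p hp q hq => ?_⟩
  · have h1 := (abs_coord_le (feat p x) r).trans (norm_feat_le p x)
    have h2 : 1 / √(m : ℝ) * ‖p‖ * ‖x‖ ≤ 1 / √(m : ℝ) * (‖p₀‖ + |ρ|) * ‖x‖ := by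
      gcongr; exact norm_le_of_mem_ball hp
    have h3 : 0 ≤ 1 / √(m : ℝ) * ‖x‖ := by positivity
    linarith
  · have h1 := (abs_coord_le (feat p x - feat q x) r).trans (norm_feat_sub_le p q x)
    rw [PiLp.sub_apply] at h1
    refine h1.trans ?_
    have h3 : 0 ≤ 1 / √(m : ℝ) * (‖p₀‖ + |ρ|) * ‖x‖ * ‖p - q‖ := by positivity
    nlinarith

theorem bddLipOn_equil (hγ : 0 ≤ γ) {p₀ : Param m d} {ρ : ℝ}
    (hc : ∀ p ∈ Metric.ball p₀ ρ, Contracting γ p) (x : EuclideanSpace ℝ (Fin d)) (r : Fin m) :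
    BddLipOn (fun p => equil γ p x r) (Metric.ball p₀ ρ) := by
  set F := 1 / √(m : ℝ) * (‖p₀‖ + |ρ|) * ‖x‖ with hF
  have hF0 : 0 ≤ F := by positivity
  have hz : ∀ p ∈ Metric.ball p₀ ρ, ‖equil γ p x‖ ≤ 2 * F := by
    intro p hp
    refine ((hc p hp).norm_equil_le hγ x).trans ?_
    gcongr
    refine (norm_feat_le p x).trans ?_
    rw [hF]
    gcongr
    exact norm_le_of_mem_ball hp
  refine ⟨2 * F + 2 * (γ / √(m : ℝ) * (2 * F) + 1 / √(m : ℝ) * ‖x‖), by positivity,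
    fun p hp => ?_, fun p hp q hq => ?_⟩
  · have h3 : 0 ≤ 2 * (γ / √(m : ℝ) * (2 * F) + 1 / √(m : ℝ) * ‖x‖) := by positivity
    linarith [abs_coord_le (equil γ p x) r, hz p hp]
  · have h1 := (abs_coord_le (equil γ p x - equil γ q x) r).trans
      (norm_equil_sub_le hγ (hc p hp) (hc q hq) x)
    rw [PiLp.sub_apply] at h1
    refine h1.trans ?_
    have h2 := norm_feat_sub_le p q x
    have h4 : γ / √(m : ℝ) * ‖p - q‖ * ‖equil γ q x‖ ≤ γ / √(m : ℝ) * ‖p - q‖ * (2 * F) := by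
      gcongr; exact hz q hq
    have h5 : 0 ≤ 2 * F * ‖p - q‖ := by positivity
    nlinarith

/-- The `i`-th residual `ŷ_i - y_i`. -/
def residual (γ : ℝ) (x : Fin n → EuclideanSpace ℝ (Fin d)) (y : EuclideanSpace ℝ (Fin n))
    (θ : Param m d) (i : Fin n) : ℝ :=
  (∑ r, vecU θ r * equil γ θ (x i) r + ∑ r, vecV θ r * feat θ (x i) r) + -y i

variable (x : Fin n → EuclideanSpace ℝ (Fin d)) (y : EuclideanSpace ℝ (Fin n))

theorem norm_prediction_sub_sq (θ : Param m d) :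
    ‖prediction γ x θ - y‖ ^ 2 = ∑ i, residual γ x y θ i * residual γ x y θ i := by
  rw [EuclideanSpace.norm_sq_eq]
  refine Finset.sum_congr rfl fun i _ => ?_
  rw [Real.norm_eq_abs, sq_abs, sq]
  rfl

theorem loss_eq_sum (θ : Param m d) :
    loss γ x y θ = 1 / 2 * ∑ i, residual γ x y θ i * residual γ x y θ i := by
  rw [loss, norm_prediction_sub_sq]

theorem lipschitzOnWith_loss (hγ : 0 ≤ γ) {p₀ : Param m d} {ρ : ℝ}
    (hc : ∀ p ∈ Metric.ball p₀ ρ, Contracting γ p) :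
    ∃ K, LipschitzOnWith K (loss γ x y) (Metric.ball p₀ ρ) := by
  apply BddLipOn.lipschitzOnWith
  have h1 : ∀ i, BddLipOn (fun θ => residual γ x y θ i) (Metric.ball p₀ ρ) := fun i =>
    ((BddLipOn.sum _ fun r _ => (bddLipOn_coord p₀ ρ _).mul (bddLipOn_equil hγ hc (x i) r)).add
      (BddLipOn.sum _ fun r _ => (bddLipOn_coord p₀ ρ _).mul (bddLipOn_feat p₀ ρ (x i) r))).add
      (BddLipOn.const _ _)
  have h2 : loss γ x y = fun θ : Param m d =>
      1 / 2 * ∑ i, residual γ x y θ i * residual γ x y θ i := funext (loss_eq_sum x y)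
  rw [h2]
  exact (BddLipOn.const _ _).mul (BddLipOn.sum _ fun i _ => (h1 i).mul (h1 i))

theorem hasStrictDirDeriv_coord {ι : Type*} [Fintype ι] (p h : EuclideanSpace ℝ ι) (i : ι) :
    HasStrictDirDeriv (fun q : EuclideanSpace ℝ ι => q i) p h (h i) :=
  HasStrictDirDeriv.clm (EuclideanSpace.proj i) p h

theorem matW_mulVec_eq (q : Param m d) (x : EuclideanSpace ℝ (Fin d)) (r : Fin m) :
    (matW q).mulVec x.ofLp r = ∑ k, x k * q (Sum.inr (Sum.inl (r, k))) := by
  simp [matW, Matrix.mulVec, dotProduct, mul_comm]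

theorem opA_apply_eq (q : Param m d) (z : EuclideanSpace ℝ (Fin m)) (r : Fin m) :
    opA q z r = ∑ s, q (Sum.inl (r, s)) * z s := by
  simp [opA_apply, matA, Matrix.mulVec, dotProduct]

/-- The derivative of the feature vector in direction `h`, where it exists. -/
def featDeriv (p h : Param m d) (x : EuclideanSpace ℝ (Fin d)) : EuclideanSpace ℝ (Fin m) :=
  WithLp.toLp 2 fun r => 1 / √(m : ℝ) *
    if 0 < (matW p).mulVec x.ofLp r then (matW h).mulVec x.ofLp r else 0

theorem hasStrictDirDeriv_feat {p h : Param m d} {x : EuclideanSpace ℝ (Fin d)} {r : Fin m}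
    (h0 : (matW p).mulVec x.ofLp r = 0 → (matW h).mulVec x.ofLp r = 0) :
    HasStrictDirDeriv (fun q => feat q x r) p h (featDeriv p h x r) := by
  refine HasStrictDirDeriv.const_mul (1 / √(m : ℝ)) (HasStrictDirDeriv.relu ?_ h0)
  simp only [matW_mulVec_eq]
  exact HasStrictDirDeriv.sum _ fun k _ => (hasStrictDirDeriv_coord p h _).const_mul _

theorem tendsto_of_coord {α ι : Type*} [Fintype ι] {l : Filter α} {f : α → EuclideanSpace ℝ ι}
    {z : EuclideanSpace ℝ ι} (h : ∀ r, Tendsto (fun a => f a r) l (𝓝 (z r))) :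
    Tendsto f l (𝓝 z) :=
  ((PiLp.continuous_toLp 2 fun _ : ι => ℝ).tendsto z.ofLp).comp (tendsto_pi_nhds.2 h)

theorem tendsto_clm_apply {α E F : Type*} [NormedAddCommGroup E] [NormedSpace ℝ E]
    [NormedAddCommGroup F] [NormedSpace ℝ F] {l : Filter α} {f : α → E →L[ℝ] F} {g : α → E}
    {A : E →L[ℝ] F} {z : E} (hf : Tendsto f l (𝓝 A)) (hg : Tendsto g l (𝓝 z)) :
    Tendsto (fun a => f a (g a)) l (𝓝 (A z)) :=
  (isBoundedBilinearMap_apply.continuous.tendsto (A, z)).comp (hf.prodMk_nhds hg)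

theorem continuousAt_equil (hγ : 0 ≤ γ) {p : Param m d}
    (hc : ∀ᶠ q in 𝓝 p, Contracting γ q) (x : EuclideanSpace ℝ (Fin d)) :
    ContinuousAt (fun q => equil γ q x) p := by
  rw [ContinuousAt, tendsto_iff_norm_sub_tendsto_zero]
  have h1 : Tendsto (fun q : Param m d => ‖q - p‖) (𝓝 p) (𝓝 0) :=
    tendsto_iff_norm_sub_tendsto_zero.1 tendsto_id
  have h2 : Tendsto (fun q => 2 * (γ / √(m : ℝ) * ‖q - p‖ * ‖equil γ p x‖ +
      1 / √(m : ℝ) * ‖q - p‖ * ‖x‖)) (𝓝 p) (𝓝 0) := by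
    simpa using ((((h1.const_mul (γ / √(m : ℝ))).mul_const ‖equil γ p x‖)).add
      ((h1.const_mul (1 / √(m : ℝ))).mul_const ‖x‖)).const_mul 2
  refine squeeze_zero' (Eventually.of_forall fun _ => norm_nonneg _) ?_ h2
  filter_upwards [hc] with q hq
  refine (norm_equil_sub_le hγ hq hc.self_of_nhds x).trans ?_
  gcongr
  exact norm_feat_sub_le q p x

theorem continuous_feat (x : EuclideanSpace ℝ (Fin d)) :
    Continuous fun q : Param m d => feat q x := by
  have h : LipschitzWith (Real.toNNReal (1 / √(m : ℝ) * ‖x‖)) fun q : Param m d => feat q x := by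
    refine LipschitzWith.of_dist_le_mul fun p q => ?_
    rw [dist_eq_norm, dist_eq_norm, Real.coe_toNNReal _ (by positivity)]
    exact (norm_feat_sub_le p q x).trans (le_of_eq (by ring))
  exact h.continuous

/-- Strict differentiability of the equilibrium point in a direction in which no entry at the kink
of the ReLU moves. -/
theorem hasStrictDirDeriv_equil (hγ : 0 ≤ γ) {p h : Param m d}
    (hc : ∀ᶠ q in 𝓝 p, Contracting γ q) {x : EuclideanSpace ℝ (Fin d)}
    {ζ φ' ς : EuclideanSpace ℝ (Fin m)}
    (hfeat : ∀ r, HasStrictDirDeriv (fun q => feat q x r) p h (φ' r))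
    (hς : ς = (γ / √(m : ℝ)) • (opA h (equil γ p x) + opA p ζ) + φ')
    (hζ : ∀ r, ζ r = if 0 < preact γ p x (equil γ p x) r then ς r else 0)
    (h0 : ∀ r, preact γ p x (equil γ p x) r = 0 → ς r = 0) (r : Fin m) :
    HasStrictDirDeriv (fun q => equil γ q x r) p h (ζ r) := by
  set a := γ / √(m : ℝ) with ha
  have ha0 : 0 ≤ a := by positivity
  have hcont := continuousAt_equil hγ hc x
  set F := 𝓝 p ×ˢ 𝓝[≠] (0 : ℝ) with hFdef
  have hq1 : Tendsto (fun q : Param m d × ℝ => q.1) F (𝓝 p) := tendsto_fst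
  have hq2 : Tendsto (fun q : Param m d × ℝ => q.1 + q.2 • h) F (𝓝 p) := tendsto_add_smul p h
  have hz1 : Tendsto (fun q : Param m d × ℝ => equil γ q.1 x) F (𝓝 (equil γ p x)) :=
    hcont.tendsto.comp hq1
  have hz2 : Tendsto (fun q : Param m d × ℝ => equil γ (q.1 + q.2 • h) x) F
      (𝓝 (equil γ p x)) := hcont.tendsto.comp hq2
  have hopA : Continuous fun q : Param m d => opA q := by
    have : LipschitzWith 1 fun q : Param m d => opA q := LipschitzWith.of_dist_le_mul fun q q' => by
      rw [dist_eq_norm, dist_eq_norm, ← opA_sub, NNReal.coe_one, one_mul]; exact norm_opA_le _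
    exact this.continuous
  have hpre : ∀ {f : Param m d × ℝ → Param m d}, Tendsto f F (𝓝 p) →
      Tendsto (fun q => equil γ (f q) x) F (𝓝 (equil γ p x)) → ∀ r,
      Tendsto (fun q => preact γ (f q) x (equil γ (f q) x) r) F
        (𝓝 (preact γ p x (equil γ p x) r)) := by
    intro f hf hzf r
    have h1 : Tendsto (fun q => preact γ (f q) x (equil γ (f q) x)) F
        (𝓝 (preact γ p x (equil γ p x))) :=
      ((tendsto_clm_apply ((hopA.tendsto p).comp hf) hzf).const_smul _).add
        (((continuous_feat x).tendsto p).comp hf)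
    exact ((EuclideanSpace.proj (𝕜 := ℝ) r).continuous.tendsto _).comp h1
  -- `ζ` is a given solution of the linearised equation. Its error `e` satisfies `‖e‖ ≤ ‖e‖ / 2 +
  -- o(1)` by contraction, hence tends to `0`.
  set e : Param m d × ℝ → EuclideanSpace ℝ (Fin m) := fun q =>
    q.2⁻¹ • (equil γ (q.1 + q.2 • h) x - equil γ q.1 x) - ζ with he
  set D : Param m d × ℝ → EuclideanSpace ℝ (Fin m) := fun q =>
    q.2⁻¹ • (feat (q.1 + q.2 • h) x - feat q.1 x) - φ' with hD
  have hD0 : Tendsto D F (𝓝 0) := by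
    refine tendsto_of_coord fun r => ?_
    have := (hfeat r).2.sub_const (φ' r)
    rw [sub_self] at this
    refine this.congr fun q => ?_
    simp [hD, div_eq_inv_mul]
  have hbound : ∀ᶠ q in F, ‖e q‖ ≤ 2 * (‖a • opA (q.1 - p) ζ‖ +
      ‖a • opA h (equil γ (q.1 + q.2 • h) x - equil γ p x)‖ + ‖D q‖) := by
    -- An entry off the kink keeps its sign near `p`, so the ReLU acts there as zero or the
    -- identity. At the kink both `ζ` and `ς` vanish, and the Lipschitz bound is enough.
    have hcoord : ∀ᶠ q in F, ∀ r, |e q r| ≤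
        |(q.2⁻¹ • (preact γ (q.1 + q.2 • h) x (equil γ (q.1 + q.2 • h) x) -
          preact γ q.1 x (equil γ q.1 x)) - ς) r| := by
      rw [eventually_all]
      intro r
      have hs1 := hpre hq1 hz1 r
      have hs2 := hpre hq2 hz2 r
      have hc1 := hq1.eventually hc
      have hc2 := hq2.eventually hc
      have hval : ∀ q : Param m d × ℝ, Contracting γ q.1 → Contracting γ (q.1 + q.2 • h) →
          e q r = q.2⁻¹ * (relu (preact γ (q.1 + q.2 • h) x (equil γ (q.1 + q.2 • h) x) r) -
            relu (preact γ q.1 x (equil γ q.1 x) r)) - ζ r := by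
        intro q h1 h2
        have e1 : equil γ q.1 x r = relu (preact γ q.1 x (equil γ q.1 x) r) :=
          congrArg (fun z : EuclideanSpace ℝ (Fin m) => z r) (h1.equil_eq hγ x)
        have e2 : equil γ (q.1 + q.2 • h) x r =
            relu (preact γ (q.1 + q.2 • h) x (equil γ (q.1 + q.2 • h) x) r) :=
          congrArg (fun z : EuclideanSpace ℝ (Fin m) => z r) (h2.equil_eq hγ x)
        rw [← e1, ← e2]
        simp [he]
      rcases lt_trichotomy (preact γ p x (equil γ p x) r) 0 with hs | hs | hs
      · filter_upwards [hc1, hc2, hs1.eventually_lt_const hs, hs2.eventually_lt_const hs]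
          with q h1 h2 h3 h4
        rw [hval q h1 h2, hζ r, if_neg hs.not_gt, relu_of_nonpos h3.le, relu_of_nonpos h4.le]
        simp
      · filter_upwards [hc1, hc2] with q h1 h2
        rw [hval q h1 h2, hζ r, if_neg hs.not_gt]
        simp only [PiLp.sub_apply, PiLp.smul_apply, smul_eq_mul, h0 r hs, sub_zero, abs_mul]
        exact mul_le_mul_of_nonneg_left (relu_lipschitz _ _) (abs_nonneg _)
      · filter_upwards [hc1, hc2, hs1.eventually_const_lt hs, hs2.eventually_const_lt hs]
          with q h1 h2 h3 h4
        rw [hval q h1 h2, hζ r, if_pos hs, relu_of_nonneg h3.le, relu_of_nonneg h4.le]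
        simp
    filter_upwards [hcoord, hq1.eventually hc, eventually_snd_ne_zero p] with q h1 h2 h3
    have h4 := norm_le_norm_of_abs_le h1
    have h5 : q.2⁻¹ • (preact γ (q.1 + q.2 • h) x (equil γ (q.1 + q.2 • h) x) -
          preact γ q.1 x (equil γ q.1 x)) - ς = a • opA q.1 (e q) +
        (a • opA (q.1 - p) ζ + a • opA h (equil γ (q.1 + q.2 • h) x - equil γ p x) + D q) := by
      have hadd : opA (q.1 + q.2 • h) = opA q.1 + q.2 • opA h := by
        ext v r
        simp [opA_apply_eq, add_mul, Finset.sum_add_distrib, Finset.mul_sum, mul_assoc]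
      simp only [preact, ← ha, hς, hD, he, hadd, opA_sub, map_sub, map_smul, add_apply, sub_apply,
        smul_apply]
      ext r
      simp only [PiLp.sub_apply, PiLp.smul_apply, PiLp.add_apply, smul_eq_mul]
      field_simp
      ring
    rw [h5] at h4
    have h6 := norm_add_le (a • opA q.1 (e q)) (a • opA (q.1 - p) ζ +
      a • opA h (equil γ (q.1 + q.2 • h) x - equil γ p x) + D q)
    have h7 := norm_smul_opA_le hγ h2 (e q)
    have h8 := norm_add₃_le (a := a • opA (q.1 - p) ζ)
      (b := a • opA h (equil γ (q.1 + q.2 • h) x - equil γ p x)) (c := D q)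
    linarith
  have he0 : Tendsto e F (𝓝 0) := by
    refine squeeze_zero_norm' hbound ?_
    have t1 : Tendsto (fun q : Param m d × ℝ => ‖a • opA (q.1 - p) ζ‖) F (𝓝 0) := by
      have h1 : Tendsto (fun q : Param m d × ℝ => opA (q.1 - p)) F (𝓝 (opA p - opA p)) := by
        simp only [opA_sub]
        exact ((hopA.tendsto p).comp hq1).sub_const _
      rw [sub_self] at h1
      simpa using ((tendsto_clm_apply h1 (tendsto_const_nhds (x := ζ))).const_smul a).norm
    have t2 : Tendsto (fun q : Param m d × ℝ =>
        ‖a • opA h (equil γ (q.1 + q.2 • h) x - equil γ p x)‖) F (𝓝 0) := by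
      have h1 := ((((opA h).continuous.tendsto _).comp (hz2.sub_const (equil γ p x))).const_smul
        a).norm
      simpa using h1
    simpa using ((t1.add t2).add hD0.norm).const_mul 2
  refine ⟨((EuclideanSpace.proj (𝕜 := ℝ) r).continuous.continuousAt).comp hcont, ?_⟩
  have h1 : Tendsto (fun q => e q r + ζ r) F (𝓝 (0 + ζ r)) :=
    (((EuclideanSpace.proj (𝕜 := ℝ) r).continuous.tendsto 0).comp he0).add_const _
  rw [zero_add] at h1
  refine h1.congr fun q => ?_
  simp [he, div_eq_inv_mul]

theorem hasStrictDirDeriv_loss {p h : Param m d} {ζ φ' : Fin n → EuclideanSpace ℝ (Fin m)}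
    (hz : ∀ i r, HasStrictDirDeriv (fun q => equil γ q (x i) r) p h (ζ i r))
    (hf : ∀ i r, HasStrictDirDeriv (fun q => feat q (x i) r) p h (φ' i r)) :
    HasStrictDirDeriv (loss γ x y) p h (∑ i, residual γ x y p i *
      (∑ r, (vecU h r * equil γ p (x i) r + vecU p r * ζ i r) +
        ∑ r, (vecV h r * feat p (x i) r + vecV p r * φ' i r))) := by
  have h1 : ∀ i, HasStrictDirDeriv (fun θ => residual γ x y θ i) p h
      ((∑ r, (vecU h r * equil γ p (x i) r + vecU p r * ζ i r) +
        ∑ r, (vecV h r * feat p (x i) r + vecV p r * φ' i r)) + 0) := fun i =>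
    ((HasStrictDirDeriv.sum _ fun r _ => (hasStrictDirDeriv_coord p h _).mul (hz i r)).add
      (HasStrictDirDeriv.sum _ fun r _ => (hasStrictDirDeriv_coord p h _).mul (hf i r))).add
      (HasStrictDirDeriv.const _ _ _)
  have h2 : loss γ x y = fun θ : Param m d =>
      1 / 2 * ∑ i, residual γ x y θ i * residual γ x y θ i := funext (loss_eq_sum x y)
  rw [h2]
  have h3 := (HasStrictDirDeriv.sum Finset.univ fun i _ => (h1 i).mul (h1 i)).const_mul (1 / 2)
  convert h3 using 1
  rw [Finset.mul_sum]
  refine Finset.sum_congr rfl fun i _ => ?_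
  ring

end Loss

/-! ### The PL inequality for the loss, and deterministic convergence. -/

section Deterministic

variable {m d n : ℕ} {γ : ℝ}

theorem lipschitzOnWith_coord_equil (hγ : 0 ≤ γ) {p₀ : Param m d} {ρ : ℝ}
    (hc : ∀ p ∈ Metric.ball p₀ ρ, Contracting γ p) (x : EuclideanSpace ℝ (Fin d)) (r : Fin m) :
    ∃ K, LipschitzOnWith K (fun p => equil γ p x r) (Metric.ball p₀ ρ) :=
  (bddLipOn_equil hγ hc x r).lipschitzOnWith

theorem hasDerivAt_coord {ι : Type*} [Fintype ι] {θ : ℝ → EuclideanSpace ℝ ι}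
    {h : EuclideanSpace ℝ ι} {t : ℝ} (hd : HasDerivAt θ h t) (i : ι) :
    HasDerivAt (fun u => θ u i) (h i) t :=
  (EuclideanSpace.proj (𝕜 := ℝ) i).hasFDerivAt.comp_hasDerivAt t hd

/-- Along an absolutely continuous curve the velocity is, at almost every time, a direction of
strict differentiability of the loss. -/
theorem ae_exists_hasStrictDirDeriv_loss (hγ : 0 ≤ γ) {p₀ : Param m d} {ρ : ℝ}
    (hc : ∀ p ∈ Metric.ball p₀ ρ, Contracting γ p) (x : Fin n → EuclideanSpace ℝ (Fin d))
    (y : EuclideanSpace ℝ (Fin n)) (T : ℝ) (θ : ℝ → Param m d)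
    (hac : AbsolutelyContinuousOnInterval θ 0 T)
    (hball : ∀ t ∈ uIcc 0 T, θ t ∈ Metric.ball p₀ ρ) :
    ∀ᵐ t, t ∈ uIcc 0 T → ∀ h, HasDerivAt θ h t →
      ∃ l, HasStrictDirDeriv (loss γ x y) (θ t) h l := by
  -- Equilibria are Lipschitz in the parameter, so along the curve they are differentiable almost
  -- everywhere. Their derivatives serve as the solution `ζ` of the linearised equation, which
  -- therefore need not be solved.
  have hdiff : ∀ i r, ∀ᵐ t, t ∈ uIcc 0 T →
      DifferentiableAt ℝ (fun u => equil γ (θ u) (x i) r) t := by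
    intro i r
    obtain ⟨K, hK⟩ := lipschitzOnWith_coord_equil hγ hc (x i) r
    exact (LipschitzOnWith.comp_absolutelyContinuousOnInterval hK hac hball).ae_differentiableAt
  have hkink1 : ∀ i r, ∀ᵐ t : ℝ, ∀ l, (matW (θ t)).mulVec (x i).ofLp r = 0 →
      HasDerivAt (fun u => (matW (θ u)).mulVec (x i).ofLp r) l t → l = 0 :=
    fun i r => ae_deriv_eq_zero_of_eq_zero _
  have hkink2 : ∀ i r, ∀ᵐ t : ℝ, ∀ l, preact γ (θ t) (x i) (equil γ (θ t) (x i)) r = 0 →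
      HasDerivAt (fun u => preact γ (θ u) (x i) (equil γ (θ u) (x i)) r) l t → l = 0 :=
    fun i r => ae_deriv_eq_zero_of_eq_zero _
  filter_upwards [ae_all_iff.2 fun i => ae_all_iff.2 (hdiff i),
    ae_all_iff.2 fun i => ae_all_iff.2 (hkink1 i),
    ae_all_iff.2 fun i => ae_all_iff.2 (hkink2 i)] with t hdiff hkink1 hkink2 ht h hd
  have hev : ∀ᶠ q in 𝓝 (θ t), Contracting γ q := by
    filter_upwards [Metric.isOpen_ball.mem_nhds (hball t ht)] with q hq using hc q hq
  have hW : ∀ i r, HasDerivAt (fun u => (matW (θ u)).mulVec (x i).ofLp r)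
      ((matW h).mulVec (x i).ofLp r) t := by
    intro i r
    simp only [matW_mulVec_eq]
    exact HasDerivAt.fun_sum fun k _ => (hasDerivAt_coord hd _).const_mul _
  have hfeat : ∀ i r, HasStrictDirDeriv (fun q => feat q (x i) r) (θ t) h
      (featDeriv (θ t) h (x i) r) :=
    fun i r => hasStrictDirDeriv_feat fun h0 => hkink1 i r _ h0 (hW i r)
  set ζ : Fin n → EuclideanSpace ℝ (Fin m) := fun i =>
    WithLp.toLp 2 fun r => deriv (fun u => equil γ (θ u) (x i) r) t with hζ
  have hz : ∀ i r, HasDerivAt (fun u => equil γ (θ u) (x i) r) (ζ i r) t :=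
    fun i r => (hdiff i r ht).hasDerivAt
  set ς : Fin n → EuclideanSpace ℝ (Fin m) := fun i =>
    (γ / √(m : ℝ)) • (opA h (equil γ (θ t) (x i)) + opA (θ t) (ζ i)) +
      featDeriv (θ t) h (x i) with hς
  have hf : ∀ i r, HasDerivAt (fun u => feat (θ u) (x i) r) (featDeriv (θ t) h (x i) r) t :=
    fun i r => (hasDerivAt_relu_comp (hW i r) fun h0 => hkink1 i r _ h0 (hW i r)).const_mul _
  have hpre : ∀ i r, HasDerivAt (fun u => preact γ (θ u) (x i) (equil γ (θ u) (x i)) r)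
      (ς i r) t := by
    intro i r
    have h1 : HasDerivAt (fun u => (γ / √(m : ℝ)) *
        (∑ s, θ u (Sum.inl (r, s)) * equil γ (θ u) (x i) s) + feat (θ u) (x i) r)
        ((γ / √(m : ℝ)) * (∑ s, (h (Sum.inl (r, s)) * equil γ (θ t) (x i) s +
          θ t (Sum.inl (r, s)) * ζ i s)) + featDeriv (θ t) h (x i) r) t := by
      refine (HasDerivAt.const_mul _ (HasDerivAt.fun_sum fun s _ => ?_)).fun_add (hf i r)
      exact (hasDerivAt_coord hd (Sum.inl (r, s))).fun_mul (hz i s)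
    simpa [hς, preact, opA_apply_eq, Finset.sum_add_distrib, mul_add] using h1
  have hς0 : ∀ i r, preact γ (θ t) (x i) (equil γ (θ t) (x i)) r = 0 → ς i r = 0 :=
    fun i r h0 => hkink2 i r _ h0 (hpre i r)
  have hζς : ∀ i r, ζ i r =
      if 0 < preact γ (θ t) (x i) (equil γ (θ t) (x i)) r then ς i r else 0 := by
    intro i r
    refine (hz i r).unique ((hasDerivAt_relu_comp (hpre i r) (hς0 i r)).congr_of_eventuallyEq ?_)
    filter_upwards [hd.continuousAt.eventually hev] with u hu
    exact congrArg (fun z : EuclideanSpace ℝ (Fin m) => z r) (hu.equil_eq hγ (x i))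
  exact ⟨_, hasStrictDirDeriv_loss x y
    (fun i r => hasStrictDirDeriv_equil hγ hev (hfeat i) rfl (hζς i) (hς0 i) r) hfeat⟩

/-- The direction in parameter space that only moves `v`. -/
def directionV (η : Fin m → ℝ) : Param m d :=
  WithLp.toLp 2 (Sum.elim 0 (Sum.elim 0 (Sum.elim 0 η)))

/-- The Clarke subgradients are at least as large as the derivative with respect to `v`. -/
theorem norm_sum_residual_smul_feat_le (hγ : 0 ≤ γ) {p : Param m d}
    (hc : ∀ᶠ q in 𝓝 p, Contracting γ q) (x : Fin n → EuclideanSpace ℝ (Fin d))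
    (y : EuclideanSpace ℝ (Fin n)) {g : Param m d}
    (hg : g ∈ clarkeSubdifferential (loss γ x y) p) :
    ‖∑ i, residual γ x y p i • feat p (x i)‖ ≤ ‖g‖ := by
  set η := ∑ i, residual γ x y p i • feat p (x i) with hη
  -- In this direction only `v` moves, so no ReLU argument changes. The derivative of the loss is
  -- `‖η‖²`, and Cauchy-Schwarz bounds it by `‖g‖ ‖η‖`.
  set h : Param m d := directionV η.ofLp with hh
  have hA : ∀ z : EuclideanSpace ℝ (Fin m), opA h z = 0 := by
    intro z; ext r; simp [opA_apply_eq, hh, directionV]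
  have hW : ∀ (x : EuclideanSpace ℝ (Fin d)) (r : Fin m), (matW h).mulVec x.ofLp r = 0 := by
    intro x r; simp [matW_mulVec_eq, hh, directionV]
  have hU : ∀ r, vecU h r = 0 := fun r => rfl
  have hV : ∀ r, vecV h r = η r := fun r => rfl
  have hF : ∀ i, featDeriv p h (x i) = 0 := by
    intro i; ext r; simp [featDeriv, hW]
  have hfeat : ∀ i r, HasStrictDirDeriv (fun q => feat q (x i) r) p h
      ((0 : EuclideanSpace ℝ (Fin m)) r) := by
    intro i r
    rw [← hF i]
    exact hasStrictDirDeriv_feat fun _ => hW _ _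
  have hz : ∀ i r, HasStrictDirDeriv (fun q => equil γ q (x i) r) p h
      ((0 : EuclideanSpace ℝ (Fin m)) r) := fun i r =>
    hasStrictDirDeriv_equil hγ hc (ς := 0) (hfeat i) (by simp [hA]) (by simp) (by simp) r
  have h1 := (hasStrictDirDeriv_loss x y (ζ := fun _ => 0) (φ' := fun _ => 0)
    hz hfeat).inner_eq_of_mem_clarke hg
  have h2 : ∑ i, residual γ x y p i *
      (∑ r, (vecU h r * equil γ p (x i) r + vecU p r * (0 : EuclideanSpace ℝ (Fin m)) r) +
        ∑ r, (vecV h r * feat p (x i) r + vecV p r * (0 : EuclideanSpace ℝ (Fin m)) r)) =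
      ‖η‖ ^ 2 := by
    rw [← real_inner_self_eq_norm_sq]
    conv_rhs => rw [hη, sum_inner, ← hη]
    refine Finset.sum_congr rfl fun i _ => ?_
    rw [real_inner_smul_left, PiLp.inner_apply]
    simp [hU, hV]
  have h3 : ‖h‖ = ‖η‖ := by
    rw [EuclideanSpace.norm_eq, EuclideanSpace.norm_eq]
    simp [Fintype.sum_sum_type, hh, directionV]
  rw [h2] at h1
  have h4 := real_inner_le_norm g h
  rw [h1, h3] at h4
  rcases (norm_nonneg η).eq_or_lt with h0 | h0
  · rw [← h0]; positivity
  · exact le_of_mul_le_mul_right (by linarith [sq ‖η‖]) h0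

/-- Each of the `n` unit inputs has its feature moved by at most `ρ/√m`, so the least singular value
drops by at most `√n ρ/√m`. -/
theorem mul_norm_le_norm_sum_smul_feat {p₀ : Param m d} {ρ κ : ℝ}
    {x : Fin n → EuclideanSpace ℝ (Fin d)} (hx : ∀ i, ‖x i‖ = 1)
    (hgram : ∀ c : EuclideanSpace ℝ (Fin n),
      (κ + √(n : ℝ) / √(m : ℝ) * ρ) * ‖c‖ ≤ ‖∑ i, c i • feat p₀ (x i)‖)
    {p : Param m d} (hp : p ∈ Metric.ball p₀ ρ) (c : EuclideanSpace ℝ (Fin n)) :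
    κ * ‖c‖ ≤ ‖∑ i, c i • feat p (x i)‖ := by
  have h1 : ‖∑ i, c i • (feat p₀ (x i) - feat p (x i))‖ ≤
      √(n : ℝ) / √(m : ℝ) * ρ * ‖c‖ := by
    have hρ : ‖p₀ - p‖ ≤ ρ := by
      rw [← dist_eq_norm, dist_comm]; exact (Metric.mem_ball.1 hp).le
    have hcs : ∑ i, |c i| ≤ √(n : ℝ) * ‖c‖ := by
      rw [EuclideanSpace.norm_eq, ← Real.sqrt_mul (Nat.cast_nonneg n)]
      refine Real.le_sqrt_of_sq_le ?_
      simpa using sq_sum_le_card_mul_sum_sq (s := Finset.univ) (f := fun i => |c i|)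
    calc _ ≤ ∑ i, |c i| * (1 / √(m : ℝ) * ρ) := by
          refine norm_sum_le_of_le _ fun i _ => ?_
          rw [norm_smul, Real.norm_eq_abs]
          gcongr
          refine (norm_feat_sub_le p₀ p (x i)).trans ?_
          rw [hx i, mul_one]
          gcongr
      _ = (∑ i, |c i|) * (1 / √(m : ℝ) * ρ) := by rw [Finset.sum_mul]
      _ ≤ √(n : ℝ) * ‖c‖ * (1 / √(m : ℝ) * ρ) := by
          have := (norm_nonneg _).trans hρ
          gcongr
      _ = _ := by ring
  have h2 : ∑ i, c i • feat p₀ (x i) =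
      ∑ i, c i • (feat p₀ (x i) - feat p (x i)) + ∑ i, c i • feat p (x i) := by
    rw [← Finset.sum_add_distrib]
    simp [smul_sub]
  have h3 := hgram c
  rw [h2] at h3
  have h4 := norm_add_le (∑ i, c i • (feat p₀ (x i) - feat p (x i))) (∑ i, c i • feat p (x i))
  nlinarith

/-- Deterministic convergence: the gradient flow converges if the initial features have a large
least singular value compared with the initial residual. -/
theorem flowConverges_of_initial (hγ : 0 ≤ γ) {p₀ : Param m d} {ρ κ : ℝ} (hκ : 0 < κ)
    (hρ : 0 < ρ) {x : Fin n → EuclideanSpace ℝ (Fin d)} (hx : ∀ i, ‖x i‖ = 1)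
    {y : EuclideanSpace ℝ (Fin n)}
    (hop : γ / √(m : ℝ) * (‖opA p₀‖ + ρ) ≤ 1 / 2)
    (hgram : ∀ c : EuclideanSpace ℝ (Fin n),
      (κ + √(n : ℝ) / √(m : ℝ) * ρ) * ‖c‖ ≤ ‖∑ i, c i • feat p₀ (x i)‖)
    (hres : ‖prediction γ x p₀ - y‖ < κ * ρ) (hlam : lambdaZero x ≤ 2 * κ ^ 2) :
    FlowConverges γ x y p₀ := by
  have hc : ∀ p ∈ Metric.ball p₀ ρ, Contracting γ p := by
    intro p hp
    refine le_trans ?_ hop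
    gcongr
    have h1 : opA p = opA p₀ + opA (p - p₀) := by rw [opA_sub]; abel
    rw [h1]
    refine (norm_add_le _ _).trans (add_le_add_right ((norm_opA_le _).trans ?_) _)
    rw [← dist_eq_norm]
    exact (Metric.mem_ball.1 hp).le
  have hPL : IsPathPL (loss γ x y) p₀ ρ κ := by
    refine ⟨hκ, fun p => by unfold loss; positivity, lipschitzOnWith_loss x y hγ hc,
      ae_exists_hasStrictDirDeriv_loss hγ hc x y, fun p hp g hg => ?_⟩
    have hev : ∀ᶠ q in 𝓝 p, Contracting γ q := by
      filter_upwards [Metric.isOpen_ball.mem_nhds hp] with q hq using hc q hq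
    have h1 := norm_sum_residual_smul_feat_le hγ hev x y hg
    have h2 := mul_norm_le_norm_sum_smul_feat hx hgram hp (prediction γ x p - y)
    have h3 : ∀ i, (prediction γ x p - y) i = residual γ x y p i := fun i => rfl
    simp only [h3] at h2
    have h4 := h2.trans h1
    have h5 : (κ * ‖prediction γ x p - y‖) ^ 2 ≤ ‖g‖ ^ 2 := by gcongr
    unfold loss
    nlinarith
  obtain ⟨hex, hall⟩ := hPL.gradientFlow hρ (by
    unfold loss
    have : ‖prediction γ x p₀ - y‖ ^ 2 < (κ * ρ) ^ 2 := by gcongr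
    linarith)
  refine ⟨hex, fun T θ hT hθ t ht => ?_⟩
  obtain ⟨hmem, hle⟩ := hall T θ hT hθ t ht
  refine ⟨(hc _ hmem).wellPosed hγ, ?_⟩
  rw [hθ.1]
  unfold loss at hle
  have h1 : Real.exp (-(2 * κ ^ 2) * t) ≤ Real.exp (-(lambdaZero x) * t) := by
    apply Real.exp_le_exp.2
    have := ht.1
    nlinarith
  have h2 := mul_le_mul_of_nonneg_right h1 (sq_nonneg ‖prediction γ x p₀ - y‖)
  nlinarith

end Deterministic

/-! ### Positivity of the limiting Gram matrix. -/

section Gram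

variable {n d : ℕ} (x : Fin n → EuclideanSpace ℝ (Fin d))

instance isOpenPosMeasure_gaussianReal : (gaussianReal 0 1).IsOpenPosMeasure :=
  (gaussianReal_absolutelyContinuous' 0 one_ne_zero).isOpenPosMeasure

/-- Full support turns almost-everywhere vanishing of a continuous function into vanishing
everywhere. -/
instance isOpenPosMeasure_stdGaussian :
    (stdGaussian (EuclideanSpace ℝ (Fin d))).IsOpenPosMeasure := by
  rw [← map_pi_eq_stdGaussian]
  exact (PiLp.continuous_toLp 2 fun _ : Fin d => ℝ).isOpenPosMeasure_map
    (WithLp.toLp_surjective 2)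

theorem integrable_relu_mul_relu (u v : EuclideanSpace ℝ (Fin d)) :
    Integrable (fun w => relu (inner ℝ u w) * relu (inner ℝ v w))
      (stdGaussian (EuclideanSpace ℝ (Fin d))) := by
  have h1 : Integrable (fun w : EuclideanSpace ℝ (Fin d) => ‖w‖ ^ 2)
      (stdGaussian (EuclideanSpace ℝ (Fin d))) := by
    simpa using (IsGaussian.memLp_two_id (μ := stdGaussian (EuclideanSpace ℝ (Fin d)))).norm.integrable_sq
  refine (h1.const_mul (‖u‖ * ‖v‖)).mono' ?_ (Eventually.of_forall fun w => ?_)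
  · refine Continuous.aestronglyMeasurable ?_
    have := continuous_relu
    fun_prop
  · rw [norm_mul, Real.norm_eq_abs, Real.norm_eq_abs]
    have h2 := (abs_relu_le (inner ℝ u w)).trans (abs_real_inner_le_norm u w)
    have h3 := (abs_relu_le (inner ℝ v w)).trans (abs_real_inner_le_norm v w)
    calc _ ≤ (‖u‖ * ‖w‖) * (‖v‖ * ‖w‖) := mul_le_mul h2 h3 (abs_nonneg _) (by positivity)
      _ = _ := by ring

theorem gramInf_isHermitian : (gramInf x).IsHermitian := by
  ext i j
  simp [gramInf, mul_comm]

theorem sum_gramInf_eq_integral (c : Fin n → ℝ) :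
    ∑ i, ∑ j, c i * c j * gramInf x i j =
      ∫ w, (∑ i, c i * relu (inner ℝ (x i) w)) ^ 2 ∂(stdGaussian (EuclideanSpace ℝ (Fin d))) := by
  have h1 : ∀ w, (∑ i, c i * relu (inner ℝ (x i) w)) ^ 2 =
      ∑ i, ∑ j, c i * c j * (relu (inner ℝ (x i) w) * relu (inner ℝ (x j) w)) := by
    intro w
    rw [sq, Finset.sum_mul_sum]
    exact Finset.sum_congr rfl fun i _ => Finset.sum_congr rfl fun j _ => by ring
  simp only [h1]
  rw [integral_finsetSum _ fun i _ => integrable_finsetSum _ fun j _ =>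
    (integrable_relu_mul_relu (x i) (x j)).const_mul _]
  refine Finset.sum_congr rfl fun i _ => ?_
  rw [integral_finsetSum _ fun j _ => (integrable_relu_mul_relu (x i) (x j)).const_mul _]
  refine Finset.sum_congr rfl fun j _ => ?_
  rw [integral_const_mul]
  rfl

theorem relu_add_relu_sub {a b : ℝ} (hab : |b| ≤ |a|) :
    relu (a + b) + relu (a - b) = 2 * relu a := by
  rcases le_total 0 a with h | h
  · rw [abs_of_nonneg h, abs_le] at hab
    rw [relu_of_nonneg h, relu_of_nonneg (by linarith), relu_of_nonneg (by linarith)]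
    ring
  · rw [abs_of_nonpos h, abs_le] at hab
    rw [relu_of_nonpos h, relu_of_nonpos (by linarith), relu_of_nonpos (by linarith)]
    ring

variable {x}

/-- The functions `w ↦ σ(⟨x_i, w⟩)` are linearly independent if no two of the `x_i` are parallel:
the kink of one of them is not hidden by the others. -/
theorem coeff_eq_zero_of_sum_relu_eq_zero (hx : DataAssumption x) {c : Fin n → ℝ}
    (h : ∀ w, ∑ i, c i * relu (inner ℝ (x i) w) = 0) (i : Fin n) : c i = 0 := by
  have hxi : inner ℝ (x i) (x i) = (1 : ℝ) := by
    rw [real_inner_self_eq_norm_sq, hx.1 i, one_pow]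
  -- The parts of the other inputs orthogonal to `x i` are nonzero because no two inputs are
  -- parallel. A functional that vanishes on none of them yields a `w` on the kink of `x i` and off
  -- all the other kinks.
  set v : {j // j ≠ i} → EuclideanSpace ℝ (Fin d) :=
    fun j => x j - inner ℝ (x i) (x j) • x i with hv
  have hv0 : ∀ j, v j ≠ 0 := by
    intro j hj
    have hli := hx.2 i j j.2.symm
    rw [LinearIndependent.pair_iff] at hli
    have := hli (-inner ℝ (x i) (x j)) 1 (by
      rw [← hj, hv]; simp only [neg_smul, one_smul]; abel)
    exact one_ne_zero this.2
  obtain ⟨f, hf⟩ := Module.exists_dual_forall_apply_ne_zero (K := ℝ) v hv0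
  set z := (InnerProductSpace.toDual ℝ (EuclideanSpace ℝ (Fin d))).symm
    (LinearMap.toContinuousLinearMap f) with hz
  have hzf : ∀ w, inner ℝ z w = f w := fun w => by
    rw [hz, InnerProductSpace.toDual_symm_apply]; rfl
  set w := z - inner ℝ (x i) z • x i with hw
  have hwi : inner ℝ (x i) w = 0 := by
    rw [hw, inner_sub_right, inner_smul_right, hxi]; ring
  have hwj : ∀ j, j ≠ i → inner ℝ (x j) w ≠ 0 := by
    intro j hj
    have h1 : inner ℝ (x j) w = f (v ⟨j, hj⟩) := by
      rw [← hzf, hw, hv, inner_sub_right, inner_sub_right, inner_smul_right, inner_smul_right,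
        real_inner_comm (x j) z, real_inner_comm (x j) (x i), real_inner_comm z (x i)]
      ring
    rw [h1]
    exact hf _
  clear_value w
  obtain ⟨ε, hε, hεj⟩ : ∃ ε : ℝ, 0 < ε ∧ ∀ j, j ≠ i →
      |ε * inner ℝ (x j) (x i)| ≤ |inner ℝ (x j) w| := by
    have h1 : ∀ᶠ ε : ℝ in 𝓝[>] 0, ∀ j, j ≠ i →
        |ε * inner ℝ (x j) (x i)| ≤ |inner ℝ (x j) w| := by
      rw [eventually_all]
      intro j
      by_cases hj : j = i
      · exact Eventually.of_forall fun _ h => absurd hj h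
      · have h2 : Tendsto (fun ε : ℝ => |ε * inner ℝ (x j) (x i)|) (𝓝[>] 0) (𝓝 0) := by
          have : Continuous fun ε : ℝ => |ε * inner ℝ (x j) (x i)| := by fun_prop
          have h3 := this.tendsto 0
          simp only [zero_mul, abs_zero] at h3
          exact h3.mono_left nhdsWithin_le_nhds
        filter_upwards [h2.eventually_le_const (abs_pos.2 (hwj j hj))] with ε h4 _ using h4
    obtain ⟨ε, h2, h3⟩ := (h1.and self_mem_nhdsWithin).exists
    exact ⟨ε, h3, h2⟩
  -- The second difference at `w` along `x i`: every term with `j ≠ i` is linear on the short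
  -- segment and drops out, while the `i`-th leaves `c i * ε`.
  have hsum : ∑ j, c j * (relu (inner ℝ (x j) (w + ε • x i)) +
      relu (inner ℝ (x j) (w - ε • x i)) - 2 * relu (inner ℝ (x j) w)) = 0 := by
    simp only [mul_sub, mul_add, Finset.sum_sub_distrib, Finset.sum_add_distrib, h]
    have h1 := h w
    simp only [mul_left_comm _ (2 : ℝ), ← Finset.mul_sum, h1]
    simp
  rw [Finset.sum_eq_single i (fun j _ hj => ?_) (by simp)] at hsum
  · rw [inner_add_right, inner_sub_right, inner_smul_right, hxi, hwi, mul_one, zero_add, zero_sub,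
      relu_of_nonneg hε.le, relu_of_nonpos (by linarith), relu_of_nonneg le_rfl] at hsum
    have : c i * ε = 0 := by linarith
    exact (mul_eq_zero.1 this).resolve_right hε.ne'
  · rw [inner_add_right, inner_sub_right, inner_smul_right, relu_add_relu_sub (hεj j hj)]
    ring

/-- The quadratic form is the mean square of `∑ c_i σ(⟨x_i, w⟩)`. If it vanishes, continuity and
full support make this sum zero everywhere, against linear independence. -/
theorem gramInf_posDef (hx : DataAssumption x) : (gramInf x).PosDef := by
  refine Matrix.PosDef.of_dotProduct_mulVec_pos (gramInf_isHermitian x) fun c hc => ?_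
  have h1 : star c ⬝ᵥ (gramInf x).mulVec c = ∑ i, ∑ j, c i * c j * gramInf x i j := by
    simp only [dotProduct, Matrix.mulVec, Finset.mul_sum, star_trivial]
    exact Finset.sum_congr rfl fun i _ => Finset.sum_congr rfl fun j _ => by ring
  rw [h1, sum_gramInf_eq_integral]
  have hcont : Continuous fun w : EuclideanSpace ℝ (Fin d) =>
      ∑ i, c i * relu (inner ℝ (x i) w) := by
    have := continuous_relu
    fun_prop
  refine lt_of_le_of_ne (integral_nonneg fun w => sq_nonneg _) fun h0 => hc ?_
  have hint : Integrable (fun w => (∑ i, c i * relu (inner ℝ (x i) w)) ^ 2)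
      (stdGaussian (EuclideanSpace ℝ (Fin d))) := by
    have h2 : ∀ w, (∑ i, c i * relu (inner ℝ (x i) w)) ^ 2 =
        ∑ i, ∑ j, c i * c j * (relu (inner ℝ (x i) w) * relu (inner ℝ (x j) w)) := by
      intro w
      rw [sq, Finset.sum_mul_sum]
      exact Finset.sum_congr rfl fun i _ => Finset.sum_congr rfl fun j _ => by ring
    simp only [h2]
    exact integrable_finsetSum _ fun i _ => integrable_finsetSum _ fun j _ =>
      (integrable_relu_mul_relu (x i) (x j)).const_mul _
  have hae := (integral_eq_zero_iff_of_nonneg (fun w => sq_nonneg _) hint).1 h0.symm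
  have hall := ((hcont.pow 2).ae_eq_iff_eq _ continuous_zero).1 hae
  funext i
  refine coeff_eq_zero_of_sum_relu_eq_zero hx (fun w => ?_) i
  have := congrFun hall w
  simpa using this

theorem lambdaZero_pos (hn : 0 < n) (hx : DataAssumption x) : 0 < lambdaZero x := by
  have : Nonempty (Fin n) := ⟨⟨0, hn⟩⟩
  rw [lambdaZero, (gramInf_isHermitian x).spectrum_real_eq_range_eigenvalues]
  obtain ⟨i, hi⟩ := (range_nonempty _).csInf_mem (finite_range (gramInf_isHermitian x).eigenvalues)
  rw [← hi]
  exact (gramInf_posDef hx).eigenvalues_pos i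

variable (x)

theorem lambdaZero_mul_le (c : Fin n → ℝ) :
    lambdaZero x * ∑ i, c i ^ 2 ≤ ∑ i, ∑ j, c i * c j * gramInf x i j := by
  have hH := gramInf_isHermitian x
  have hpsd : (gramInf x - algebraMap ℝ (Matrix (Fin n) (Fin n) ℝ) (lambdaZero x)).PosSemidef := by
    rw [Matrix.posSemidef_iff_isHermitian_and_spectrum_nonneg]
    constructor
    · refine hH.sub ?_
      rw [Algebra.algebraMap_eq_smul_one]
      ext i j
      simp [Matrix.one_apply, eq_comm]
    · rw [← spectrum.sub_singleton_eq]
      rintro _ ⟨a, ha, b, rfl, rfl⟩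
      have hb : BddBelow (spectrum ℝ (gramInf x)) := by
        rw [hH.spectrum_real_eq_range_eigenvalues]
        exact (finite_range _).bddBelow
      exact sub_nonneg.2 (csInf_le hb ha)
  have h1 := hpsd.dotProduct_mulVec_nonneg c
  have h2 : star c ⬝ᵥ (gramInf x - algebraMap ℝ (Matrix (Fin n) (Fin n) ℝ)
      (lambdaZero x)).mulVec c =
      ∑ i, ∑ j, c i * c j * gramInf x i j - lambdaZero x * ∑ i, c i ^ 2 := by
    rw [Matrix.sub_mulVec, dotProduct_sub, Algebra.algebraMap_eq_smul_one, Matrix.smul_mulVec,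
      Matrix.one_mulVec]
    congr 1
    · simp only [dotProduct, Matrix.mulVec, Finset.mul_sum, star_trivial]
      exact Finset.sum_congr rfl fun i _ => Finset.sum_congr rfl fun j _ => by ring
    · simp only [dotProduct, star_trivial, Pi.smul_apply, smul_eq_mul, Finset.mul_sum]
      exact Finset.sum_congr rfl fun i _ => by ring
  rw [h2] at h1
  linarith

theorem map_inner_stdGaussian (u : EuclideanSpace ℝ (Fin d)) (hu : ‖u‖ = 1) :
    (stdGaussian (EuclideanSpace ℝ (Fin d))).map (fun w => inner ℝ u w) = gaussianReal 0 1 := by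
  have h := IsGaussian.map_eq_gaussianReal (μ := stdGaussian (EuclideanSpace ℝ (Fin d)))
    (innerSL ℝ u)
  rw [variance_dual_stdGaussian, integral_strongDual_stdGaussian, innerSL_apply_norm, hu] at h
  simpa using h

theorem gramInf_diag_le {i : Fin n} (hx : ‖x i‖ = 1) : gramInf x i i ≤ 1 := by
  have h1 : gramInf x i i ≤ ∫ w, (inner ℝ (x i) w) ^ 2
      ∂(stdGaussian (EuclideanSpace ℝ (Fin d))) := by
    refine integral_mono (integrable_relu_mul_relu (x i) (x i)) ?_ fun w => ?_
    · have h2 : MemLp (innerSL ℝ (x i)) 2 (stdGaussian (EuclideanSpace ℝ (Fin d))) :=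
        IsGaussian.memLp_dual _ _ _ (by norm_num)
      exact h2.integrable_sq
    · have h3 := sq_le_sq.2 (abs_relu_le (inner ℝ (x i) w))
      simp only; nlinarith
  refine h1.trans ?_
  have h4 : ∫ w, (inner ℝ (x i) w) ^ 2 ∂(stdGaussian (EuclideanSpace ℝ (Fin d))) =
      ∫ g, g ^ 2 ∂(gaussianReal 0 1) := by
    rw [← map_inner_stdGaussian (x i) hx, integral_map (by fun_prop) (by fun_prop)]
  rw [h4]
  have h5 := variance_fun_id_gaussianReal (μ := 0) (v := 1)
  rw [variance_eq_integral (by fun_prop), integral_id_gaussianReal] at h5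
  simpa using h5.le

theorem lambdaZero_le_one (hn : 0 < n) (hx : ∀ i, ‖x i‖ = 1) : lambdaZero x ≤ 1 := by
  have h1 := lambdaZero_mul_le x (Pi.single ⟨0, hn⟩ 1)
  have h2 := gramInf_diag_le x (hx ⟨0, hn⟩)
  simp [Pi.single_apply, ite_pow] at h1
  linarith

end Gram

/-! ### The law of the initialization, arranged by rows. -/

section Law

variable {m d : ℕ}

instance isProbabilityMeasure_rademacher : IsProbabilityMeasure rademacher := by
  refine ⟨?_⟩
  simp [rademacher, ENNReal.inv_two_add_inv_two]

/-- The space of the rows of `A`, the rows of `W`, and the entries of `u` and `v`. -/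
abbrev Rows (m d : ℕ) : Type :=
  ((Fin m → EuclideanSpace ℝ (Fin m)) × (Fin m → EuclideanSpace ℝ (Fin d))) × (Fin m ⊕ Fin m → ℝ)

/-- The parameter with given rows. -/
def ofRows (q : Rows m d) : Param m d :=
  WithLp.toLp 2 (Sum.elim (fun rs => q.1.1 rs.1 rs.2)
    (Sum.elim (fun rk => q.1.2 rk.1 rk.2) q.2))

/-- The law of the rows at initialisation. -/
def rowsMeasure (m d : ℕ) : Measure (Rows m d) :=
  ((Measure.pi fun _ => stdGaussian (EuclideanSpace ℝ (Fin m))).prod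
    (Measure.pi fun _ => stdGaussian (EuclideanSpace ℝ (Fin d)))).prod
    (Measure.pi fun _ => rademacher)

instance isProbabilityMeasure_rowsMeasure : IsProbabilityMeasure (rowsMeasure m d) := by
  unfold rowsMeasure; infer_instance

theorem continuous_ofRows : Continuous (ofRows : Rows m d → Param m d) := by
  refine (PiLp.continuous_toLp 2 _).comp (continuous_pi fun i => ?_)
  rcases i with rs | rk | s <;> simp only [Sum.elim_inl, Sum.elim_inr] <;> fun_prop

theorem stdGaussian_preimage_box (s : Fin d → Set ℝ) (hs : ∀ k, MeasurableSet (s k)) :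
    stdGaussian (EuclideanSpace ℝ (Fin d)) {w | ∀ k, w k ∈ s k} =
      ∏ k, gaussianReal 0 1 (s k) := by
  rw [← map_pi_eq_stdGaussian, Measure.map_apply (PiLp.continuous_toLp 2 _).measurable]
  · rw [← Measure.pi_pi]
    congr 1
    ext w
    simp
  · have : {w : EuclideanSpace ℝ (Fin d) | ∀ k, w k ∈ s k} = ⋂ k, (fun w => w k) ⁻¹' s k := by
      ext w; simp
    rw [this]
    exact MeasurableSet.iInter fun k => (EuclideanSpace.proj k).continuous.measurable (hs k)

/-- The initialisation has independent standard Gaussian rows. -/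
theorem initMeasure_eq_map : initMeasure m d = (rowsMeasure m d).map ofRows := by
  have hσ : ∀ i, SigmaFinite (initLaw m d i) := by
    rintro (i | i | i) <;> unfold initLaw <;> infer_instance
  have hm : Measurable fun q : Rows m d => (ofRows q).ofLp :=
    ((PiLp.continuous_ofLp 2 _).comp continuous_ofRows).measurable
  have h1 : Measure.pi (initLaw m d) =
      (rowsMeasure m d).map fun q => (ofRows q).ofLp := by
    refine Measure.pi_eq fun s hs => ?_
    rw [Measure.map_apply hm (MeasurableSet.univ_pi hs)]
    have h2 : (fun q : Rows m d => (ofRows q).ofLp) ⁻¹' univ.pi s =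
        ((univ.pi fun r => {w | ∀ k, w k ∈ s (Sum.inl (r, k))}) ×ˢ
          (univ.pi fun r => {w | ∀ k, w k ∈ s (Sum.inr (Sum.inl (r, k)))})) ×ˢ
          (univ.pi fun i => s (Sum.inr (Sum.inr i))) := by
      ext q
      simp only [mem_preimage, Set.mem_pi, mem_univ, true_imp_iff, mem_prod, mem_ofPred_eq, ofRows]
      constructor
      · exact fun h => ⟨⟨fun r k => h (Sum.inl (r, k)), fun r k => h (Sum.inr (Sum.inl (r, k)))⟩,
          fun i => h (Sum.inr (Sum.inr i))⟩
      · rintro ⟨⟨hA, hW⟩, hU⟩ (⟨r, k⟩ | ⟨r, k⟩ | i)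
        · exact hA r k
        · exact hW r k
        · exact hU i
    rw [h2, rowsMeasure, Measure.prod_prod, Measure.prod_prod, Measure.pi_pi, Measure.pi_pi,
      Measure.pi_pi]
    simp only [stdGaussian_preimage_box _ fun k => hs _]
    simp only [Fintype.prod_sum_type, Fintype.prod_prod_type, mul_assoc]
    rfl
  rw [initMeasure, h1, Measure.map_map (PiLp.continuous_toLp 2 _).measurable hm]
  rfl

instance isProbabilityMeasure_initMeasure : IsProbabilityMeasure (initMeasure m d) := by
  rw [initMeasure_eq_map]
  exact Measure.isProbabilityMeasure_map continuous_ofRows.aemeasurable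

theorem opA_ofRows (q : Rows m d) (z : EuclideanSpace ℝ (Fin m)) (r : Fin m) :
    opA (ofRows q) z r = inner ℝ z (q.1.1 r) := by
  simp [opA_apply_eq, ofRows, PiLp.inner_apply]

theorem feat_ofRows (q : Rows m d) (x : EuclideanSpace ℝ (Fin d)) (r : Fin m) :
    feat (ofRows q) x r = 1 / √(m : ℝ) * relu (inner ℝ x (q.1.2 r)) := by
  have h : (matW (ofRows q)).mulVec x.ofLp r = inner ℝ x (q.1.2 r) := by
    simp [matW_mulVec_eq, ofRows, PiLp.inner_apply, mul_comm]
  rw [← h]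
  rfl

end Law

/-! ### Exponential moments and Chernoff's bound. -/

section Chernoff

/-- Chernoff's bound for a sum of functions of independent variables. -/
theorem measureReal_pi_sum_ge_le {ι E : Type*} [Fintype ι] [MeasurableSpace E] (μ : Measure E)
    [IsProbabilityMeasure μ] {f : ι → E → ℝ} {s : ℝ} (hs : 0 ≤ s) {L : ι → ℝ}
    (hint : ∀ i, Integrable (fun w => Real.exp (s * f i w)) μ)
    (hmgf : ∀ i, ∫ w, Real.exp (s * f i w) ∂μ ≤ Real.exp (L i)) (b : ℝ) :
    (Measure.pi fun _ : ι => μ).real {w | b ≤ ∑ i, f i (w i)} ≤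
      Real.exp (-s * b + ∑ i, L i) := by
  have h1 : ∀ w : ι → E, Real.exp (s * ∑ i, f i (w i)) = ∏ i, Real.exp (s * f i (w i)) := by
    intro w
    rw [Finset.mul_sum, Real.exp_sum]
  have h2 : Integrable (fun w : ι → E => Real.exp (s * ∑ i, f i (w i)))
      (Measure.pi fun _ : ι => μ) := by
    simp only [h1]
    exact Integrable.fintype_prod (f := fun i w => Real.exp (s * f i w)) hint
  refine (measure_ge_le_exp_mul_mgf b hs h2).trans ?_
  rw [mgf, Real.exp_add]
  simp only [h1]
  rw [integral_fintype_prod_eq_prod (f := fun i w => Real.exp (s * f i w)), Real.exp_sum]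
  exact mul_le_mul_of_nonneg_left (Finset.prod_le_prod
    (fun i _ => integral_nonneg fun w => (Real.exp_pos _).le) fun i _ => hmgf i) (Real.exp_pos _).le

end Chernoff

section GaussianSquare

theorem integral_exp_sq_gaussianReal :
    ∫ g, Real.exp (1 / 4 * g ^ 2) ∂(gaussianReal 0 1) = √2 := by
  rw [integral_gaussianReal_eq_integral_smul one_ne_zero]
  have h1 : ∀ g : ℝ, gaussianPDFReal 0 1 g • Real.exp (1 / 4 * g ^ 2) =
      (√(2 * Real.pi))⁻¹ * Real.exp (-(1 / 4) * g ^ 2) := by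
    intro g
    rw [gaussianPDFReal, smul_eq_mul, mul_assoc, ← Real.exp_add]
    simp only [NNReal.coe_one, mul_one, sub_zero]
    congr 2
    ring
  simp only [h1]
  rw [integral_const_mul, integral_gaussian, inv_mul_eq_div, ← Real.sqrt_div (by positivity)]
  congr 1
  field_simp
  ring

theorem integrable_exp_sq_gaussianReal :
    Integrable (fun g => Real.exp (1 / 4 * g ^ 2)) (gaussianReal 0 1) := by
  by_contra h
  have h1 := integral_exp_sq_gaussianReal
  rw [integral_undef h] at h1
  exact (Real.sqrt_pos.2 two_pos).ne h1

variable {d : ℕ}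

theorem integrable_exp_inner_sq {u : EuclideanSpace ℝ (Fin d)} (hu : ‖u‖ = 1) :
    Integrable (fun w => Real.exp (1 / 4 * inner ℝ u w ^ 2))
      (stdGaussian (EuclideanSpace ℝ (Fin d))) := by
  have h := integrable_exp_sq_gaussianReal
  rw [← map_inner_stdGaussian u hu, integrable_map_measure (by fun_prop) (by fun_prop)] at h
  exact h

theorem integral_exp_inner_sq {u : EuclideanSpace ℝ (Fin d)} (hu : ‖u‖ = 1) :
    ∫ w, Real.exp (1 / 4 * inner ℝ u w ^ 2) ∂(stdGaussian (EuclideanSpace ℝ (Fin d))) = √2 := by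
  rw [← integral_exp_sq_gaussianReal, ← map_inner_stdGaussian u hu,
    integral_map (by fun_prop) (by fun_prop)]

/-- After normalising `u`, the exponent is at most a quarter of the square of a standard Gaussian.
-/
theorem integrable_and_integral_exp_inner_sq_le {u : EuclideanSpace ℝ (Fin d)} (hu : ‖u‖ ≤ 1 / 2) :
    Integrable (fun w => Real.exp (inner ℝ u w ^ 2)) (stdGaussian (EuclideanSpace ℝ (Fin d))) ∧
    ∫ w, Real.exp (inner ℝ u w ^ 2) ∂(stdGaussian (EuclideanSpace ℝ (Fin d))) ≤ √2 := by
  by_cases h0 : u = 0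
  · subst h0
    refine ⟨by simp, ?_⟩
    simp [Real.one_le_sqrt]
  · have hu1 : ‖‖u‖⁻¹ • u‖ = 1 := by
      rw [norm_smul, norm_inv, norm_norm, inv_mul_cancel₀ (norm_ne_zero_iff.2 h0)]
    have hle : ∀ w, Real.exp (inner ℝ u w ^ 2) ≤
        Real.exp (1 / 4 * inner ℝ (‖u‖⁻¹ • u) w ^ 2) := by
      intro w
      apply Real.exp_le_exp.2
      have h1 : inner ℝ u w = ‖u‖ * inner ℝ (‖u‖⁻¹ • u) w := by
        rw [real_inner_smul_left, mul_inv_cancel_left₀ (norm_ne_zero_iff.2 h0)]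
      rw [h1, mul_pow]
      have : ‖u‖ ^ 2 ≤ 1 / 4 := by nlinarith [norm_nonneg u]
      gcongr
    have hint : Integrable (fun w => Real.exp (inner ℝ u w ^ 2))
        (stdGaussian (EuclideanSpace ℝ (Fin d))) := by
      refine (integrable_exp_inner_sq hu1).mono' (Continuous.aestronglyMeasurable (by fun_prop))
        (Eventually.of_forall fun w => ?_)
      rw [Real.norm_of_nonneg (Real.exp_pos _).le]
      exact hle w
    exact ⟨hint, (integral_mono hint (integrable_exp_inner_sq hu1) hle).trans
      (integral_exp_inner_sq hu1).le⟩

end GaussianSquare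

/-! ### The operator norm of a Gaussian matrix. -/

section OperatorNorm

/-- A matrix expands a ball of radius `1 / 10` inside the ball of radius `1 / 2` by a fixed
fraction of its operator norm. -/
theorem exists_ball_norm_le {E : Type*} [NormedAddCommGroup E] [NormedSpace ℝ E] (A : E →L[ℝ] E) :
    ∃ v : E, Metric.ball v (1 / 10) ⊆ Metric.ball 0 (1 / 2) ∧
      ∀ w ∈ Metric.ball v (1 / 10), 1 / 5 * ‖A‖ ≤ ‖A w‖ := by
  rcases (norm_nonneg A).eq_or_lt with h0 | h0
  · exact ⟨0, Metric.ball_subset_ball (by norm_num), fun w _ => by rw [← h0]; simp⟩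
  · obtain ⟨v, hv, hAv⟩ := A.exists_lt_apply_of_lt_opNorm (show 3 / 4 * ‖A‖ < ‖A‖ by linarith)
    -- The constants: `2/5 + 1/10 = 1/2` for the inclusion, and `2/5 * 3/4 - 1/10 = 1/5` for the
    -- norm.
    refine ⟨(2 / 5 : ℝ) • v, fun w hw => ?_, fun w hw => ?_⟩
    · rw [mem_ball_zero_iff]
      rw [mem_ball_iff_norm] at hw
      have h1 : ‖w‖ ≤ ‖w - (2 / 5 : ℝ) • v‖ + ‖(2 / 5 : ℝ) • v‖ := by
        simpa using norm_add_le (w - (2 / 5 : ℝ) • v) ((2 / 5 : ℝ) • v)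
      rw [norm_smul, Real.norm_of_nonneg (by norm_num)] at h1
      linarith
    · rw [mem_ball_iff_norm] at hw
      have h1 : ‖A ((2 / 5 : ℝ) • v)‖ ≤ ‖A w‖ + ‖A (w - (2 / 5 : ℝ) • v)‖ := by
        have := norm_sub_le (A w) (A (w - (2 / 5 : ℝ) • v))
        rwa [← map_sub, sub_sub_cancel] at this
      rw [map_smul, norm_smul, Real.norm_of_nonneg (by norm_num)] at h1
      have h2 := A.le_opNorm (w - (2 / 5 : ℝ) • v)
      nlinarith

theorem continuous_opA {m d : ℕ} : Continuous fun q : Param m d => opA q := by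
  have : LipschitzWith 1 fun q : Param m d => opA q := LipschitzWith.of_dist_le_mul fun q q' => by
    rw [dist_eq_norm, dist_eq_norm, ← opA_sub, NNReal.coe_one, one_mul]; exact norm_opA_le _
  exact this.continuous

/-- `‖Az‖²` is a sum over the independent rows, so its exponential moment is a product of `m`
one-row moments. -/
theorem lintegral_exp_norm_opA_sq_le {m d : ℕ} {z : EuclideanSpace ℝ (Fin m)}
    (hz : ‖z‖ ≤ 1 / 2) :
    ∫⁻ θ, ENNReal.ofReal (Real.exp (‖opA θ z‖ ^ 2)) ∂(initMeasure m d) ≤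
      ENNReal.ofReal (√2 ^ m) := by
  obtain ⟨h1, h2⟩ := integrable_and_integral_exp_inner_sq_le hz
  have hcont : Continuous fun θ : Param m d => ENNReal.ofReal (Real.exp (‖opA θ z‖ ^ 2)) :=
    ENNReal.continuous_ofReal.comp (Real.continuous_exp.comp
      (((continuous_opA.clm_apply continuous_const).norm).pow 2))
  rw [initMeasure_eq_map, lintegral_map hcont.measurable continuous_ofRows.measurable]
  have h3 : ∀ q : Rows m d, Real.exp (‖opA (ofRows q) z‖ ^ 2) =
      ∏ r, Real.exp (inner ℝ z (q.1.1 r) ^ 2) := by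
    intro q
    rw [EuclideanSpace.norm_sq_eq, Real.exp_sum]
    simp [opA_ofRows]
  simp only [h3]
  have hmp : (rowsMeasure m d).map (fun q => q.1.1) =
      Measure.pi fun _ => stdGaussian (EuclideanSpace ℝ (Fin m)) := by
    rw [rowsMeasure]
    have e1 := Measure.map_map (μ := ((Measure.pi fun _ : Fin m =>
      stdGaussian (EuclideanSpace ℝ (Fin m))).prod
      (Measure.pi fun _ : Fin m => stdGaussian (EuclideanSpace ℝ (Fin d)))).prod
      (Measure.pi fun _ : Fin m ⊕ Fin m => rademacher)) measurable_fst measurable_fst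
    rw [Measure.map_fst_prod, measure_univ, one_smul, Measure.map_fst_prod, measure_univ,
      one_smul] at e1
    exact e1.symm
  have hmeas : Measurable fun A : Fin m → EuclideanSpace ℝ (Fin m) =>
      ENNReal.ofReal (∏ r, Real.exp (inner ℝ z (A r) ^ 2)) := by
    refine Continuous.measurable (ENNReal.continuous_ofReal.comp ?_)
    fun_prop
  rw [← lintegral_map (g := fun q : Rows m d => q.1.1) hmeas (by fun_prop), hmp,
    ← ofReal_integral_eq_lintegral_ofReal
      (Integrable.fintype_prod (f := fun _ w => Real.exp (inner ℝ z w ^ 2)) fun _ => h1)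
      (Eventually.of_forall fun _ => Finset.prod_nonneg fun _ _ => (Real.exp_pos _).le),
    integral_fintype_prod_eq_prod (f := fun _ w => Real.exp (inner ℝ z w ^ 2)), Finset.prod_const,
    Finset.card_univ, Fintype.card_fin]
  exact ENNReal.ofReal_le_ofReal
    (pow_le_pow_left₀ (integral_nonneg fun _ => (Real.exp_pos _).le) h2 m)

/-- The operator norm of a Gaussian matrix is at most `10 √m` with probability `1 - 2 e^{-m}`. -/
theorem isOpNormConstant_ten : IsOpNormConstant 10 := by
  refine ⟨by norm_num, fun m d => ?_⟩
  set S : Set (Param m d) := {θ | 10 * √(m : ℝ) < ‖opA θ‖} with hS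
  change initMeasure m d S ≤ _
  set V := (volume : Measure (EuclideanSpace ℝ (Fin m))) (Metric.ball 0 1) with hV
  have hV0 : V ≠ 0 := (Metric.measure_ball_pos volume 0 one_pos).ne'
  have hVt : V ≠ ⊤ := measure_ball_lt_top.ne
  have hball : ∀ (v : EuclideanSpace ℝ (Fin m)) (r : ℝ), 0 < r →
      volume (Metric.ball v r) = ENNReal.ofReal (r ^ m) * V := by
    intro v r hr
    rw [Measure.addHaar_ball_of_pos _ _ hr, finrank_euclideanSpace_fin]
  -- Integration over a ball takes the place of a net. If `‖A‖ > 10√m`, the integrand is at least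
  -- `exp(4m)` on a ball of volume `10⁻ᵐ V`, whereas the mean of `F` is at most `(√2/2)ᵐ V`;
  -- Markov's inequality compares the two.
  set F : Param m d → ENNReal := fun θ => ∫⁻ w in Metric.ball (0 : EuclideanSpace ℝ (Fin m)) (1 / 2),
    ENNReal.ofReal (Real.exp (‖opA θ w‖ ^ 2)) with hF
  have hjoint : Measurable (Function.uncurry fun (θ : Param m d) (w : EuclideanSpace ℝ (Fin m)) =>
      ENNReal.ofReal (Real.exp (‖opA θ w‖ ^ 2))) := by
    refine Continuous.measurable (ENNReal.continuous_ofReal.comp (Real.continuous_exp.comp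
      (Continuous.pow (Continuous.norm ?_) 2)))
    exact isBoundedBilinearMap_apply.continuous.comp
      ((continuous_opA.comp continuous_fst).prodMk continuous_snd)
  have hFm : Measurable F := hjoint.lintegral_prod_right'
  have hlow : ∀ θ ∈ S, ENNReal.ofReal ((1 / 10) ^ m * Real.exp (4 * m)) * V ≤ F θ := by
    intro θ hθ
    obtain ⟨v, hsub, hv⟩ := exists_ball_norm_le (opA θ)
    have h1 : ∀ w ∈ Metric.ball v (1 / 10), ENNReal.ofReal (Real.exp (4 * m)) ≤
        ENNReal.ofReal (Real.exp (‖opA θ w‖ ^ 2)) := by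
      intro w hw
      apply ENNReal.ofReal_le_ofReal
      apply Real.exp_le_exp.2
      have h2 : 2 * √(m : ℝ) ≤ ‖opA θ w‖ := by
        have := hv w hw
        have h3 : 10 * √(m : ℝ) < ‖opA θ‖ := hθ
        linarith
      calc (4 * m : ℝ) = (2 * √(m : ℝ)) ^ 2 := by
            rw [mul_pow, Real.sq_sqrt (Nat.cast_nonneg m)]; norm_num
        _ ≤ _ := by gcongr
    calc ENNReal.ofReal ((1 / 10) ^ m * Real.exp (4 * m)) * V
        = ∫⁻ w in Metric.ball v (1 / 10), ENNReal.ofReal (Real.exp (4 * m)) := by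
          rw [setLIntegral_const, hball v _ (by norm_num), ← mul_assoc,
            ← ENNReal.ofReal_mul (Real.exp_pos _).le, mul_comm (Real.exp _)]
      _ ≤ ∫⁻ w in Metric.ball v (1 / 10), ENNReal.ofReal (Real.exp (‖opA θ w‖ ^ 2)) :=
          setLIntegral_mono' measurableSet_ball h1
      _ ≤ F θ := lintegral_mono_set hsub
  have hup : ∫⁻ θ, F θ ∂(initMeasure m d) ≤ ENNReal.ofReal (√2 ^ m * (1 / 2) ^ m) * V := by
    rw [hF, lintegral_lintegral_swap hjoint.aemeasurable]
    calc _ ≤ ∫⁻ w in Metric.ball (0 : EuclideanSpace ℝ (Fin m)) (1 / 2),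
          ENNReal.ofReal (√2 ^ m) := by
          refine setLIntegral_mono' measurableSet_ball fun w hw => ?_
          exact lintegral_exp_norm_opA_sq_le (mem_ball_zero_iff.1 hw).le
      _ = _ := by
          rw [setLIntegral_const, hball 0 _ (by norm_num), ← mul_assoc,
            ← ENNReal.ofReal_mul (by positivity)]
  have hmarkov := (mul_meas_ge_le_lintegral (μ := initMeasure m d) hFm
    (ENNReal.ofReal ((1 / 10) ^ m * Real.exp (4 * m)) * V)).trans hup
  have hmono : initMeasure m d S ≤ initMeasure m d
      {θ | ENNReal.ofReal ((1 / 10) ^ m * Real.exp (4 * m)) * V ≤ F θ} := measure_mono hlow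
  have hcanc : ENNReal.ofReal ((1 / 10) ^ m * Real.exp (4 * m)) * initMeasure m d S ≤
      ENNReal.ofReal (√2 ^ m * (1 / 2) ^ m) := by
    have h1 : V * (ENNReal.ofReal ((1 / 10) ^ m * Real.exp (4 * m)) * initMeasure m d S) ≤
        V * ENNReal.ofReal (√2 ^ m * (1 / 2) ^ m) := by
      rw [← mul_assoc, mul_comm V, mul_comm V]
      exact (mul_le_mul_right hmono _).trans hmarkov
    exact (ENNReal.mul_le_mul_iff_right hV0 hVt).1 h1
  have hpos : 0 < (1 / 10 : ℝ) ^ m * Real.exp (4 * m) := by positivity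
  rw [mul_comm, ← ENNReal.le_div_iff_mul_le (Or.inl (by simpa using hpos))
    (Or.inl ENNReal.ofReal_ne_top), ← ENNReal.ofReal_div_of_pos hpos] at hcanc
  refine hcanc.trans (ENNReal.ofReal_le_ofReal ?_)
  rw [div_le_iff₀ hpos]
  have he : Real.exp (-(m : ℝ)) * Real.exp (4 * m) = Real.exp 3 ^ m := by
    rw [← Real.exp_add, ← Real.exp_nat_mul]; ring_nf
  -- The bound from Markov's inequality is `(10 e⁻⁴ √2/2)ᵐ`; this inequality says that its base is
  -- at most `e⁻¹`.
  have h20 : √2 * (1 / 2) ≤ 1 / 10 * Real.exp 3 := by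
    have h1 : √2 ≤ 3 / 2 := by rw [Real.sqrt_le_left (by norm_num)]; norm_num
    have h2 : (2 : ℝ) ^ 3 ≤ Real.exp 3 := by
      have h3 : (2 : ℝ) ≤ Real.exp 1 := by linarith [Real.add_one_le_exp (1 : ℝ)]
      calc (2 : ℝ) ^ 3 ≤ Real.exp 1 ^ 3 := by gcongr
        _ = Real.exp 3 := by rw [← Real.exp_nat_mul]; norm_num
    linarith
  calc √2 ^ m * (1 / 2) ^ m = (√2 * (1 / 2)) ^ m := by rw [mul_pow]
    _ ≤ (1 / 10 * Real.exp 3) ^ m := by gcongr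
    _ = (1 / 10) ^ m * (Real.exp (-(m : ℝ)) * Real.exp (4 * m)) := by rw [mul_pow, he]
    _ ≤ 2 * Real.exp (-(m : ℝ)) * ((1 / 10) ^ m * Real.exp (4 * m)) := by
        have : 0 ≤ (1 / 10 : ℝ) ^ m * (Real.exp (-(m : ℝ)) * Real.exp (4 * m)) := by positivity
        linarith

end OperatorNorm

/-! ### Concentration of the empirical Gram matrix. -/

section Bernstein

theorem exp_le_one_add_add_sq_mul (y : ℝ) :
    Real.exp y ≤ 1 + y + y ^ 2 * Real.exp |y| := by
  have h1 : Real.exp y - 1 ≤ y * Real.exp y := by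
    have h := Real.add_one_le_exp (-y)
    rw [Real.exp_neg] at h
    have := mul_le_mul_of_nonneg_right h (Real.exp_pos y).le
    rw [inv_mul_cancel₀ (Real.exp_pos y).ne'] at this
    linarith
  have h2 : y ≤ Real.exp y - 1 := by linarith [Real.add_one_le_exp y]
  rcases le_or_gt 0 y with h | h
  · rw [abs_of_nonneg h]
    nlinarith
  · have h3 : 1 ≤ Real.exp |y| := Real.one_le_exp (abs_nonneg y)
    nlinarith [Real.exp_pos y, sq_nonneg y]

/-- Half of the exponential moment pays for the square in the second-order remainder, via `(t/2)²/2
≤ exp(t/2)`. -/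
theorem sq_mul_exp_half_le {t : ℝ} (ht : 0 ≤ t) : t ^ 2 * Real.exp (t / 2) ≤ 8 * Real.exp t := by
  have h1 := Real.quadratic_le_exp_of_nonneg (show 0 ≤ t / 2 by positivity)
  have h2 : Real.exp t = Real.exp (t / 2) * Real.exp (t / 2) := by rw [← Real.exp_add]; ring_nf
  rw [h2]
  nlinarith [Real.exp_pos (t / 2)]

/-- The exponential moments of a centred random variable with an exponential tail are
sub-Gaussian near the origin. -/
theorem integrable_and_integral_exp_mul_le {Ω : Type*} [MeasurableSpace Ω] {μ : Measure Ω}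
    [IsProbabilityMeasure μ] {X : Ω → ℝ} (hX : Integrable X μ) (h0 : ∫ w, X w ∂μ = 0)
    {a M s : ℝ} (ha : 0 < a) (hint : Integrable (fun w => Real.exp (a * |X w|)) μ)
    (hM : ∫ w, Real.exp (a * |X w|) ∂μ ≤ M) (hs : |s| ≤ a / 2) :
    Integrable (fun w => Real.exp (s * X w)) μ ∧
    ∫ w, Real.exp (s * X w) ∂μ ≤ Real.exp (8 * M * s ^ 2 / a ^ 2) := by
  have hb : ∀ w, Real.exp (s * X w) ≤
      1 + s * X w + 8 * s ^ 2 / a ^ 2 * Real.exp (a * |X w|) := by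
    intro w
    refine (exp_le_one_add_add_sq_mul _).trans (add_le_add_right ?_ _)
    have h1 : |s * X w| ≤ a * |X w| / 2 := by
      rw [abs_mul]; nlinarith [abs_nonneg (X w)]
    calc (s * X w) ^ 2 * Real.exp |s * X w|
        ≤ (s * X w) ^ 2 * Real.exp (a * |X w| / 2) := by gcongr
      _ = s ^ 2 / a ^ 2 * ((a * |X w|) ^ 2 * Real.exp (a * |X w| / 2)) := by
          rw [mul_pow, mul_pow, sq_abs]; field_simp
      _ ≤ s ^ 2 / a ^ 2 * (8 * Real.exp (a * |X w|)) := by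
          exact mul_le_mul_of_nonneg_left
            (sq_mul_exp_half_le (mul_nonneg ha.le (abs_nonneg _))) (by positivity)
      _ = _ := by ring
  have hI : Integrable (fun w => 1 + s * X w + 8 * s ^ 2 / a ^ 2 * Real.exp (a * |X w|)) μ :=
    ((integrable_const _).add (hX.const_mul _)).add (hint.const_mul _)
  have hI' : Integrable (fun w => Real.exp (s * X w)) μ := by
    refine hI.mono' (Real.continuous_exp.comp_aestronglyMeasurable
      (hX.aestronglyMeasurable.const_mul s)) (Eventually.of_forall fun w => ?_)
    rw [Real.norm_of_nonneg (Real.exp_pos _).le]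
    exact hb w
  refine ⟨hI', (integral_mono hI' hI hb).trans ?_⟩
  have e1 : Integrable (fun w => 1 + s * X w) μ := (integrable_const _).add (hX.const_mul _)
  rw [integral_add e1 (hint.const_mul _), integral_add (integrable_const _) (hX.const_mul _),
    integral_const_mul, integral_const_mul, h0]
  simp only [integral_const, probReal_univ, smul_eq_mul, mul_one, mul_zero, add_zero]
  have h2 : 8 * s ^ 2 / a ^ 2 * ∫ w, Real.exp (a * |X w|) ∂μ ≤ 8 * M * s ^ 2 / a ^ 2 := by
    calc _ ≤ 8 * s ^ 2 / a ^ 2 * M := by gcongr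
      _ = _ := by ring
  linarith [Real.add_one_le_exp (8 * M * s ^ 2 / a ^ 2)]

end Bernstein

section GramConcentration

variable {m n d : ℕ} {x : Fin n → EuclideanSpace ℝ (Fin d)}

theorem gramInf_nonneg (x : Fin n → EuclideanSpace ℝ (Fin d)) (i j : Fin n) :
    0 ≤ gramInf x i j :=
  integral_nonneg fun _ => mul_nonneg (relu_nonneg _) (relu_nonneg _)

theorem gramInf_le_one (hx : ∀ i, ‖x i‖ = 1) (i j : Fin n) : gramInf x i j ≤ 1 := by
  have h : gramInf x i j ≤ (1 / 2) * (gramInf x i i + gramInf x j j) := by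
    have hij := integrable_relu_mul_relu (x i) (x j)
    have hii := integrable_relu_mul_relu (x i) (x i)
    have hjj := integrable_relu_mul_relu (x j) (x j)
    simp only [gramInf, Matrix.of_apply]
    rw [← integral_add hii hjj, ← integral_const_mul]
    refine integral_mono hij ((hii.add hjj).const_mul _) fun w => ?_
    dsimp only
    nlinarith [sq_nonneg (relu (inner ℝ (x i) w) - relu (inner ℝ (x j) w))]
  linarith [gramInf_diag_le x (hx i), gramInf_diag_le x (hx j)]

/-- The general moment bound with `a = 1/4` and `M = 4`, so `8 M / a² = 512`. Products of two
Gaussians have only exponential tails, hence the restriction on `s`. -/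
theorem integrable_and_integral_exp_gram_le (hx : ∀ i, ‖x i‖ = 1) (i j : Fin n) {s : ℝ}
    (hs : |s| ≤ 1 / 8) :
    Integrable (fun w => Real.exp
      (s * (relu (inner ℝ (x i) w) * relu (inner ℝ (x j) w) - gramInf x i j)))
      (stdGaussian (EuclideanSpace ℝ (Fin d))) ∧
    ∫ w, Real.exp (s * (relu (inner ℝ (x i) w) * relu (inner ℝ (x j) w) - gramInf x i j))
      ∂(stdGaussian (EuclideanSpace ℝ (Fin d))) ≤ Real.exp (512 * s ^ 2) := by
  set P := stdGaussian (EuclideanSpace ℝ (Fin d))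
  set X : EuclideanSpace ℝ (Fin d) → ℝ := fun w =>
    relu (inner ℝ (x i) w) * relu (inner ℝ (x j) w) - gramInf x i j with hXdef
  have hXi : Integrable X P := (integrable_relu_mul_relu (x i) (x j)).sub (integrable_const _)
  have h0 : ∫ w, X w ∂P = 0 := by
    rw [hXdef, integral_sub (integrable_relu_mul_relu (x i) (x j)) (integrable_const _)]
    simp [gramInf]
  have he : Real.exp (1 / 4) ≤ 2 := by
    have h1 : Real.exp (1 / 4) ^ 4 ≤ 2 ^ 4 := by
      rw [← Real.exp_nat_mul]
      have := Real.exp_one_lt_d9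
      norm_num at this ⊢; linarith
    exact le_of_pow_le_pow_left₀ (by norm_num) (by norm_num) h1
  -- The product is at most the mean of the two squares; the centring costs `exp(1/4) ≤ 2`, which
  -- the arithmetic-geometric inequality between the exponentials absorbs.
  have hb : ∀ w, Real.exp (1 / 4 * |X w|) ≤
      Real.exp (1 / 4 * inner ℝ (x i) w ^ 2) + Real.exp (1 / 4 * inner ℝ (x j) w ^ 2) := by
    intro w
    set a := (inner ℝ (x i) w : ℝ)
    set b := (inner ℝ (x j) w : ℝ)
    have h1 : |X w| ≤ (a ^ 2 + b ^ 2) / 2 + 1 := by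
      have hp : 0 ≤ relu a * relu b := mul_nonneg (relu_nonneg _) (relu_nonneg _)
      have hq : relu a * relu b ≤ (a ^ 2 + b ^ 2) / 2 := by
        have h2 := sq_le_sq.2 (abs_relu_le a)
        have h3 := sq_le_sq.2 (abs_relu_le b)
        nlinarith [sq_nonneg (relu a - relu b)]
      have hg0 := gramInf_nonneg x i j
      have hg1 := gramInf_le_one hx i j
      rw [abs_le]
      constructor <;> simp only [hXdef] <;> linarith
    have h2 : Real.exp (1 / 4 * |X w|) ≤
        Real.exp (1 / 8 * a ^ 2) * Real.exp (1 / 8 * b ^ 2) * Real.exp (1 / 4) := by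
      rw [← Real.exp_add, ← Real.exp_add]
      apply Real.exp_le_exp.2
      linarith
    have h3 : ∀ t : ℝ, Real.exp (1 / 4 * t ^ 2) = Real.exp (1 / 8 * t ^ 2) ^ 2 := by
      intro t
      rw [← Real.exp_nat_mul]; congr 1; push_cast; ring
    rw [h3, h3]
    have h4 := mul_le_mul_of_nonneg_left he
      (mul_pos (Real.exp_pos (1 / 8 * a ^ 2)) (Real.exp_pos (1 / 8 * b ^ 2))).le
    nlinarith [sq_nonneg (Real.exp (1 / 8 * a ^ 2) - Real.exp (1 / 8 * b ^ 2))]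
  have hI := (integrable_exp_inner_sq (hx i)).add (integrable_exp_inner_sq (hx j))
  have hint : Integrable (fun w => Real.exp (1 / 4 * |X w|)) P := by
    refine hI.mono' (Real.continuous_exp.comp_aestronglyMeasurable
      (hXi.aestronglyMeasurable.norm.const_mul _)) (Eventually.of_forall fun w => ?_)
    rw [Real.norm_of_nonneg (Real.exp_pos _).le]
    exact hb w
  have hM : ∫ w, Real.exp (1 / 4 * |X w|) ∂P ≤ 4 := by
    refine (integral_mono hint hI hb).trans ?_
    simp only [Pi.add_apply]
    rw [integral_add (integrable_exp_inner_sq (hx i)) (integrable_exp_inner_sq (hx j)),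
      integral_exp_inner_sq (hx i), integral_exp_inner_sq (hx j)]
    have : √2 ≤ 2 := by rw [Real.sqrt_le_left (by norm_num)]; norm_num
    linarith
  obtain ⟨h1, h2⟩ := integrable_and_integral_exp_mul_le (s := s) hXi h0 (by norm_num) hint hM
    (by linarith)
  refine ⟨h1, h2.trans (le_of_eq ?_)⟩
  congr 1
  ring

theorem map_snd_fst_rowsMeasure : (rowsMeasure m d).map (fun q => q.1.2) =
    Measure.pi fun _ => stdGaussian (EuclideanSpace ℝ (Fin d)) := by
  rw [rowsMeasure]
  have e1 := Measure.map_map (μ := ((Measure.pi fun _ : Fin m =>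
    stdGaussian (EuclideanSpace ℝ (Fin m))).prod
    (Measure.pi fun _ : Fin m => stdGaussian (EuclideanSpace ℝ (Fin d)))).prod
    (Measure.pi fun _ : Fin m ⊕ Fin m => rademacher)) measurable_snd measurable_fst
  rw [Measure.map_fst_prod, measure_univ, one_smul, Measure.map_snd_prod, measure_univ,
    one_smul] at e1
  exact e1.symm

/-- The empirical Gram matrix concentrates around its expectation. -/
theorem rowsMeasure_gram_deviation_le (hx : ∀ i, ‖x i‖ = 1) (i j : Fin n) {ε : ℝ} (h0 : 0 ≤ ε)
    (h1 : ε ≤ 1) :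
    rowsMeasure m d {q | ε * m ≤ |∑ r, (relu (inner ℝ (x i) (q.1.2 r)) *
      relu (inner ℝ (x j) (q.1.2 r)) - gramInf x i j)|} ≤
      ENNReal.ofReal (2 * Real.exp (-(m * ε ^ 2 / 2048))) := by
  set Q : Measure (Fin m → EuclideanSpace ℝ (Fin d)) :=
    Measure.pi fun _ => stdGaussian (EuclideanSpace ℝ (Fin d)) with hQ
  have key : ∀ τ : ℝ, |τ| = 1 → Q.real {w | ε * m ≤ ∑ r, τ * (relu (inner ℝ (x i) (w r)) *
      relu (inner ℝ (x j) (w r)) - gramInf x i j)} ≤ Real.exp (-(m * ε ^ 2 / 2048)) := by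
    intro τ hτ
    -- `s = ε/1024` minimises the Chernoff exponent `-sε + 512 s²`, with value `-ε²/2048`. The sign
    -- `τ` treats both tails.
    have hs : |ε / 1024 * τ| ≤ 1 / 8 := by
      rw [abs_mul, hτ, abs_of_nonneg (by positivity)]; linarith
    obtain ⟨h2, h3⟩ := integrable_and_integral_exp_gram_le hx i j hs
    have hτ2 : τ ^ 2 = 1 := by rw [← sq_abs, hτ, one_pow]
    have h4 := measureReal_pi_sum_ge_le (ι := Fin m) (stdGaussian (EuclideanSpace ℝ (Fin d)))
      (f := fun _ w => τ * (relu (inner ℝ (x i) w) * relu (inner ℝ (x j) w) - gramInf x i j))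
      (s := ε / 1024) (by positivity) (L := fun _ => 512 * (ε / 1024 * τ) ^ 2)
      (fun _ => by simpa only [mul_assoc] using h2) (fun _ => by simpa only [mul_assoc] using h3)
      (ε * m)
    refine h4.trans (Real.exp_le_exp.2 (le_of_eq ?_))
    rw [Finset.sum_const, Finset.card_univ, Fintype.card_fin, nsmul_eq_mul, mul_pow, hτ2]
    ring
  have hmap : rowsMeasure m d {q | ε * m ≤ |∑ r, (relu (inner ℝ (x i) (q.1.2 r)) *
      relu (inner ℝ (x j) (q.1.2 r)) - gramInf x i j)|} =
      Q {w | ε * m ≤ |∑ r, (relu (inner ℝ (x i) (w r)) *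
        relu (inner ℝ (x j) (w r)) - gramInf x i j)|} := by
    rw [hQ, ← map_snd_fst_rowsMeasure, Measure.map_apply (by fun_prop)]
    · rfl
    · refine measurableSet_le measurable_const (Continuous.measurable (Continuous.abs ?_))
      refine continuous_finsetSum _ fun r _ => Continuous.sub (Continuous.mul ?_ ?_)
        continuous_const
      · exact continuous_relu.comp (by fun_prop)
      · exact continuous_relu.comp (by fun_prop)
  rw [hmap]
  have hsub : {w : Fin m → EuclideanSpace ℝ (Fin d) | ε * m ≤ |∑ r, (relu (inner ℝ (x i) (w r)) *
        relu (inner ℝ (x j) (w r)) - gramInf x i j)|} ⊆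
      {w | ε * m ≤ ∑ r, 1 * (relu (inner ℝ (x i) (w r)) *
        relu (inner ℝ (x j) (w r)) - gramInf x i j)} ∪
      {w | ε * m ≤ ∑ r, -1 * (relu (inner ℝ (x i) (w r)) *
        relu (inner ℝ (x j) (w r)) - gramInf x i j)} := by
    intro w hw
    simp only [mem_union, mem_ofPred_eq, one_mul, neg_one_mul, Finset.sum_neg_distrib] at hw ⊢
    exact le_abs.1 hw
  rw [← ENNReal.ofReal_toReal (measure_ne_top Q _)]
  apply ENNReal.ofReal_le_ofReal
  refine (measureReal_mono hsub).trans ((measureReal_union_le _ _).trans ?_)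
  linarith [key 1 (by simp), key (-1) (by simp)]

end GramConcentration

/-! ### Random signs and the size of the initial predictions. -/

section Rademacher

theorem integral_rademacher (f : ℝ → ℝ) : ∫ s, f s ∂rademacher = (f 1 + f (-1)) / 2 := by
  rw [rademacher, integral_add_measure, integral_smul_measure, integral_smul_measure,
    integral_dirac, integral_dirac]
  · simp; ring
  · exact (integrable_dirac (by simp)).smul_measure (by simp)
  · exact (integrable_dirac (by simp)).smul_measure (by simp)

theorem integrable_rademacher (f : ℝ → ℝ) : Integrable f rademacher := by
  rw [rademacher, integrable_add_measure]
  exact ⟨(integrable_dirac (by simp)).smul_measure (by simp),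
    (integrable_dirac (by simp)).smul_measure (by simp)⟩

/-- Hoeffding's bound for a sum of random signs. -/
theorem measure_pi_rademacher_abs_sum_ge_le {ι : Type*} [Fintype ι] {c : ι → ℝ} {V b : ℝ}
    (hV : 0 < V) (hc : ∑ i, c i ^ 2 ≤ V) (hb : 0 ≤ b) :
    (Measure.pi fun _ : ι => rademacher) {w | b ≤ |∑ i, w i * c i|} ≤
      ENNReal.ofReal (2 * Real.exp (-(b ^ 2 / (2 * V)))) := by
  set Q : Measure (ι → ℝ) := Measure.pi fun _ => rademacher with hQ
  have key : ∀ τ : ℝ, τ ^ 2 = 1 → Q.real {w | b ≤ ∑ i, w i * (τ * c i)} ≤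
      Real.exp (-(b ^ 2 / (2 * V))) := by
    intro τ hτ
    -- The moment generating function of a sign is `cosh t ≤ exp(t²/2)`, and `s = b/V` is the
    -- optimal exponent.
    have h := measureReal_pi_sum_ge_le rademacher (f := fun i w => w * (τ * c i)) (s := b / V)
      (by positivity) (L := fun i => (b / V * (τ * c i)) ^ 2 / 2)
      (fun i => integrable_rademacher _) (fun i => ?_) b
    · refine h.trans (Real.exp_le_exp.2 ?_)
      have h2 : ∑ i, (b / V * (τ * c i)) ^ 2 / 2 = (b / V) ^ 2 / 2 * ∑ i, c i ^ 2 := by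
        rw [Finset.mul_sum]
        refine Finset.sum_congr rfl fun i _ => ?_
        rw [mul_pow, mul_pow, hτ]; ring
      rw [h2]
      have h3 : (b / V) ^ 2 / 2 * ∑ i, c i ^ 2 ≤ (b / V) ^ 2 / 2 * V := by gcongr
      have h4 : -(b / V) * b + (b / V) ^ 2 / 2 * V = -(b ^ 2 / (2 * V)) := by
        field_simp; ring
      linarith
    · rw [integral_rademacher]
      have h5 := Real.cosh_le_exp_half_sq (b / V * (τ * c i))
      rw [Real.cosh_eq] at h5
      refine le_trans (le_of_eq ?_) h5
      congr 3 <;> ring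
  have hsub : {w : ι → ℝ | b ≤ |∑ i, w i * c i|} ⊆
      {w | b ≤ ∑ i, w i * (1 * c i)} ∪ {w | b ≤ ∑ i, w i * (-1 * c i)} := by
    intro w hw
    simp only [mem_union, mem_ofPred_eq, one_mul, neg_one_mul, mul_neg, Finset.sum_neg_distrib]
      at hw ⊢
    exact le_abs.1 hw
  rw [← ENNReal.ofReal_toReal (measure_ne_top Q _)]
  apply ENNReal.ofReal_le_ofReal
  refine (measureReal_mono hsub).trans ((measureReal_union_le _ _).trans ?_)
  linarith [key 1 (by norm_num), key (-1) (by norm_num)]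

end Rademacher

section PredictionBound

variable {m n d : ℕ} {γ : ℝ}

/-- The prediction, as a linear form in the output weights. -/
def outputForm (γ : ℝ) (θ : Param m d) (x : EuclideanSpace ℝ (Fin d)) (i : Fin m ⊕ Fin m) : ℝ :=
  Sum.elim (fun r => equil γ θ x r) (fun r => feat θ x r) i

theorem prediction_ofRows (γ : ℝ) (x : Fin n → EuclideanSpace ℝ (Fin d)) (q : Rows m d)
    (i : Fin n) :
    prediction γ x (ofRows q) i = ∑ s, q.2 s * outputForm γ (ofRows q) (x i) s := by
  rw [Fintype.sum_sum_type]
  rfl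

/-- The equilibrium has at most twice the norm of the features, which gives `4 * 2 + 2`. -/
theorem sum_outputForm_sq_le (hγ : 0 ≤ γ) {θ : Param m d} {x : EuclideanSpace ℝ (Fin d)}
    (hθ : Contracting γ θ) (hφ : ‖feat θ x‖ ^ 2 ≤ 2) :
    ∑ s, outputForm γ θ x s ^ 2 ≤ 10 := by
  have h1 := hθ.norm_equil_le hγ x
  have h2 := EuclideanSpace.norm_sq_eq (equil γ θ x)
  have h3 := EuclideanSpace.norm_sq_eq (feat θ x)
  simp only [Real.norm_eq_abs, sq_abs] at h2 h3
  rw [Fintype.sum_sum_type]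
  simp only [outputForm, Sum.elim_inl, Sum.elim_inr]
  rw [← h2, ← h3]
  nlinarith [norm_nonneg (equil γ θ x), norm_nonneg (feat θ x)]

/-- The threshold `1/4` instead of `1/2` leaves a neighbourhood of contracting parameters, on which
equilibria vary continuously. -/
theorem continuousOn_outputForm (hγ : 0 ≤ γ) (x : EuclideanSpace ℝ (Fin d)) (i : Fin m ⊕ Fin m) :
    ContinuousOn (fun θ : Param m d => outputForm γ θ x i)
      {θ | γ / √(m : ℝ) * ‖opA θ‖ ≤ 1 / 4} := by
  rcases i with r | r
  · intro θ hθ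
    have hev : ∀ᶠ q in 𝓝 θ, Contracting γ q := by
      have hc : Continuous fun q : Param m d => γ / √(m : ℝ) * ‖opA q‖ :=
        continuous_const.mul continuous_opA.norm
      have hlt : γ / √(m : ℝ) * ‖opA θ‖ < 1 / 2 := lt_of_le_of_lt hθ (by norm_num)
      exact (hc.continuousAt.eventually (gt_mem_nhds hlt)).mono fun q hq => hq.le
    have := (EuclideanSpace.proj (𝕜 := ℝ) r).continuous.continuousAt.comp
      (continuousAt_equil hγ hev x)
    exact this.continuousWithinAt
  · exact ((EuclideanSpace.proj (𝕜 := ℝ) r).continuous.comp (continuous_feat x)).continuousOn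

/-- With the random signs independent of the weights, the initial prediction has a sub-Gaussian
tail. -/
theorem rowsMeasure_prediction_ge_le (hγ : 0 ≤ γ) (x : EuclideanSpace ℝ (Fin d)) {b : ℝ}
    (hb : 0 ≤ b) :
    rowsMeasure m d {q | γ / √(m : ℝ) * ‖opA (ofRows q)‖ ≤ 1 / 4 ∧ ‖feat (ofRows q) x‖ ^ 2 ≤ 2 ∧
      b ≤ |∑ s, q.2 s * outputForm γ (ofRows q) x s|} ≤
      ENNReal.ofReal (2 * Real.exp (-(b ^ 2 / 20))) := by
  set F : Set (Rows m d) := {q | γ / √(m : ℝ) * ‖opA (ofRows q)‖ ≤ 1 / 4 ∧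
    ‖feat (ofRows q) x‖ ^ 2 ≤ 2} with hF
  set N : Set (Rows m d) := {q | γ / √(m : ℝ) * ‖opA (ofRows q)‖ ≤ 1 / 4 ∧
    ‖feat (ofRows q) x‖ ^ 2 ≤ 2 ∧ b ≤ |∑ s, q.2 s * outputForm γ (ofRows q) x s|} with hN
  have hFc : IsClosed F := by
    have h1 : IsClosed {q : Rows m d | γ / √(m : ℝ) * ‖opA (ofRows q)‖ ≤ 1 / 4} :=
      isClosed_le (continuous_const.mul (continuous_opA.comp continuous_ofRows).norm)
        continuous_const
    have h2 : IsClosed {q : Rows m d | ‖feat (ofRows q) x‖ ^ 2 ≤ 2} :=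
      isClosed_le ((((continuous_feat x).comp continuous_ofRows).norm).pow 2) continuous_const
    exact h1.inter h2
  have hcont : ContinuousOn (fun q : Rows m d =>
      |∑ s, q.2 s * outputForm γ (ofRows q) x s|) F := by
    refine ContinuousOn.abs (continuousOn_finsetSum _ fun s _ => ContinuousOn.mul ?_ ?_)
    · fun_prop
    · exact (continuousOn_outputForm hγ x s).comp continuous_ofRows.continuousOn
        fun q hq => hq.1
  -- Closedness supplies the measurability that Fubini's theorem requires; equilibria are controlled
  -- only on `F`.
  have hNc : IsClosed N := by
    have := hcont.preimage_isClosed_of_isClosed hFc (isClosed_Ici (a := b))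
    convert this using 1
    ext q
    simp only [hN, hF, mem_inter_iff, mem_preimage, mem_Ici, mem_ofPred_eq, and_assoc]
  rw [rowsMeasure, Measure.prod_apply hNc.measurableSet]
  refine (lintegral_mono (g := fun _ => ENNReal.ofReal (2 * Real.exp (-(b ^ 2 / 20)))) ?_).trans
    (by simp)
  intro p
  -- The conditions in `F` and the form `outputForm` involve only `A` and `W`, so the signs may be
  -- set to `0` in them. With `A, W` fixed, only a sum of independent signs remains.
  by_cases hp : (p, (0 : Fin m ⊕ Fin m → ℝ)) ∈ F
  · have hc : Contracting γ (ofRows (p, (0 : Fin m ⊕ Fin m → ℝ))) :=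
      hp.1.trans (by norm_num)
    have h := measure_pi_rademacher_abs_sum_ge_le (c := outputForm γ (ofRows (p, 0)) x)
      (V := 10) (by norm_num) (sum_outputForm_sq_le hγ hc hp.2) hb
    refine (measure_mono fun s hs => ?_).trans (h.trans (le_of_eq (by norm_num)))
    exact hs.2.2
  · have : Prod.mk p ⁻¹' N = ∅ := by
      ext s
      simp only [mem_preimage, mem_empty_iff_false, iff_false]
      exact fun hs => hp ⟨hs.1, hs.2.1⟩
    simp only [this, measure_empty, zero_le]

end PredictionBound

/-! ### Convergence from Gram and prediction bounds. -/

section Deterministic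

variable {m n d : ℕ} {γ : ℝ} {x : Fin n → EuclideanSpace ℝ (Fin d)}

/-- An entrywise error `ε` changes the quadratic form by at most `ε (∑ |c_i|)² ≤ n ε ‖c‖²`. -/
theorem norm_sum_feat_sq_ge {θ : Param m d} {ε : ℝ}
    (hG : ∀ i j, |∑ r, feat θ (x i) r * feat θ (x j) r - gramInf x i j| ≤ ε)
    (c : EuclideanSpace ℝ (Fin n)) :
    (lambdaZero x - n * ε) * ‖c‖ ^ 2 ≤ ‖∑ i, c i • feat θ (x i)‖ ^ 2 := by
  have h1 : ‖∑ i, c i • feat θ (x i)‖ ^ 2 =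
      ∑ i, ∑ j, c i * c j * ∑ r, feat θ (x i) r * feat θ (x j) r := by
    rw [← real_inner_self_eq_norm_sq, sum_inner]
    refine Finset.sum_congr rfl fun i _ => ?_
    rw [inner_sum]
    refine Finset.sum_congr rfl fun j _ => ?_
    rw [real_inner_smul_left, real_inner_smul_right, PiLp.inner_apply]
    simp [mul_comm, mul_assoc]
  have hc : ‖c‖ ^ 2 = ∑ i, c i ^ 2 := by simp [EuclideanSpace.norm_sq_eq]
  have h2 := lambdaZero_mul_le x c
  have h3 : ∑ i, ∑ j, c i * c j * gramInf x i j -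
      ∑ i, ∑ j, c i * c j * ∑ r, feat θ (x i) r * feat θ (x j) r ≤ ε * (∑ i, |c i|) ^ 2 := by
    rw [sq, Finset.sum_mul_sum, Finset.mul_sum, ← Finset.sum_sub_distrib]
    refine Finset.sum_le_sum fun i _ => ?_
    rw [Finset.mul_sum, ← Finset.sum_sub_distrib]
    refine Finset.sum_le_sum fun j _ => ?_
    rw [← mul_sub]
    refine (le_abs_self _).trans ?_
    rw [abs_mul, abs_mul, abs_sub_comm, mul_comm ε]
    exact mul_le_mul_of_nonneg_left (hG i j) (by positivity)
  have h4 : (∑ i, |c i|) ^ 2 ≤ n * ∑ i, c i ^ 2 := by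
    have := sq_sum_le_card_mul_sum_sq (s := Finset.univ) (f := fun i => |c i|)
    simpa using this
  rcases Nat.eq_zero_or_pos n with hn | hn
  · subst hn
    rw [hc]; simp
  have hε : 0 ≤ ε := (abs_nonneg _).trans (hG ⟨0, hn⟩ ⟨0, hn⟩)
  rw [h1, hc]
  nlinarith [mul_le_mul_of_nonneg_left h4 hε]

/-- The gradient flow converges as soon as the initial weight matrix is small, the empirical Gram
matrix is near its expectation and the initial predictions are moderate. -/
theorem flowConverges_of_gram (hn : 0 < n) (hx : DataAssumption x) {y : EuclideanSpace ℝ (Fin n)}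
    {B b : ℝ} (hy : ∀ i, |y i| ≤ B) (hm : 0 < m) (hγ : 0 ≤ γ) (hγ2 : γ ≤ 1 / 2) {θ : Param m d}
    (hop : γ / √(m : ℝ) * ‖opA θ‖ ≤ 1 / 4)
    (hG : ∀ i j, |∑ r, feat θ (x i) r * feat θ (x j) r - gramInf x i j| ≤ lambdaZero x / (4 * n))
    (hb : ∀ i, |prediction γ x θ i| ≤ b)
    (hwidth : 128 * n ^ 2 * (B + b) ^ 2 < lambdaZero x ^ 2 * m) :
    FlowConverges γ x y θ := by
  have hl := lambdaZero_pos hn hx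
  have hl1 := lambdaZero_le_one x hn hx.1
  have hn' : (0 : ℝ) < n := by exact_mod_cast hn
  have hm' : (0 : ℝ) < m := by exact_mod_cast hm
  have hn1 : (1 : ℝ) ≤ n := by exact_mod_cast hn
  set l := √(lambdaZero x) with hldef
  have hl2 : l ^ 2 = lambdaZero x := Real.sq_sqrt hl.le
  have hlpos : 0 < l := Real.sqrt_pos.2 hl
  have hlle : l ≤ 1 := Real.sqrt_le_one.2 hl1
  set sn := √(n : ℝ)
  set sm := √(m : ℝ)
  have hsn : sn ^ 2 = n := Real.sq_sqrt hn'.le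
  have hsm : sm ^ 2 = m := Real.sq_sqrt hm'.le
  have hsn0 : 0 < sn := Real.sqrt_pos.2 hn'
  have hsm0 : 0 < sm := Real.sqrt_pos.2 hm'
  have hsn1 : 1 ≤ sn := Real.one_le_sqrt.2 hn1
  have hB : 0 ≤ B := (abs_nonneg _).trans (hy ⟨0, hn⟩)
  have hb0 : 0 ≤ b := (abs_nonneg _).trans (hb ⟨0, hn⟩)
  -- `κ` lies just above `√(λ₀/2)`, so that `2κ² ≥ λ₀`. The drift of the features costs `l/8`, and
  -- `(71/100 + 1/8)² ≤ 3/4` fits the Gram bound. The residual condition follows from `hwidth` since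
  -- `(71/800)² > 1/128`.
  refine flowConverges_of_initial (ρ := l * sm / (8 * sn)) (κ := 71 / 100 * l) hγ (by positivity)
    (by positivity) hx.1 ?_ (fun c => ?_) ?_ ?_
  · have h1 : γ / sm * (l * sm / (8 * sn)) = γ * (l / sn) / 8 := by field_simp
    have h2 : l / sn ≤ 1 := (div_le_one hsn0).2 (hlle.trans hsn1)
    have h3 : γ * (l / sn) ≤ 1 / 2 * 1 := by gcongr
    rw [mul_add, h1]
    linarith
  · have h1 : sn / sm * (l * sm / (8 * sn)) = l / 8 := by field_simp
    rw [h1]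
    refine abs_le_of_sq_le_sq' ?_ (norm_nonneg _) |>.2
    have h2 := norm_sum_feat_sq_ge hG c
    have h3 : (n : ℝ) * (lambdaZero x / (4 * n)) = lambdaZero x / 4 := by field_simp
    rw [h3, ← hl2] at h2
    refine le_trans ?_ h2
    rw [mul_pow]
    gcongr
    nlinarith
  · refine lt_of_pow_lt_pow_left₀ 2 (by positivity) ?_
    have h1 : ‖prediction γ x θ - y‖ ^ 2 ≤ n * (B + b) ^ 2 := by
      rw [EuclideanSpace.norm_sq_eq]
      calc _ ≤ ∑ _i : Fin n, (B + b) ^ 2 := by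
            refine Finset.sum_le_sum fun i _ => ?_
            have : ‖(prediction γ x θ - y) i‖ ≤ B + b := by
              have h2 := abs_sub (prediction γ x θ i) (y i)
              have h3 := hb i
              have h4 := hy i
              rw [Real.norm_eq_abs, PiLp.sub_apply]
              linarith
            gcongr
        _ = _ := by simp
    refine h1.trans_lt ?_
    have h2 : (71 / 100 * l * (l * sm / (8 * sn))) ^ 2 =
        (71 / 800) ^ 2 * (lambdaZero x ^ 2 * m) / n := by
      rw [← hl2, ← hsn, ← hsm]; field_simp; ring
    rw [h2, lt_div_iff₀ hn']
    have : 0 ≤ (n : ℝ) ^ 2 * (B + b) ^ 2 := by positivity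
    nlinarith
  · rw [← hl2]; nlinarith

end Deterministic

/-! ### The union bound over the initialization. -/

section HighProbability

variable {m n d : ℕ} {γ : ℝ} {x : Fin n → EuclideanSpace ℝ (Fin d)}

theorem ofRows_injective : Function.Injective (ofRows : Rows m d → Param m d) := by
  rintro ⟨⟨A, W⟩, s⟩ ⟨⟨A', W'⟩, s'⟩ h
  have h' : ∀ i, ofRows ((A, W), s) i = ofRows ((A', W'), s') i := fun i => by rw [h]
  refine Prod.ext (Prod.ext (funext fun r => ?_) (funext fun r => ?_)) (funext fun i => ?_)
  · ext k; exact h' (Sum.inl (r, k))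
  · ext k; exact h' (Sum.inr (Sum.inl (r, k)))
  · exact h' (Sum.inr (Sum.inr i))

/-- Valid for every set because `ofRows` is a measurable embedding; hence the failure event need not
be shown measurable. -/
theorem initMeasure_apply (S : Set (Param m d)) :
    initMeasure m d S = rowsMeasure m d (ofRows ⁻¹' S) := by
  rw [initMeasure_eq_map, (continuous_ofRows.measurableEmbedding ofRows_injective).map_apply]

theorem sum_feat_mul_feat_ofRows (q : Rows m d) (u v : EuclideanSpace ℝ (Fin d)) :
    ∑ r, feat (ofRows q) u r * feat (ofRows q) v r =
      (∑ r, relu (inner ℝ u (q.1.2 r)) * relu (inner ℝ v (q.1.2 r))) / m := by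
  rw [Finset.sum_div]
  refine Finset.sum_congr rfl fun r _ => ?_
  have h : 1 / √(m : ℝ) * (1 / √(m : ℝ)) = 1 / m := by
    rw [div_mul_div_comm, Real.mul_self_sqrt (Nat.cast_nonneg m), one_mul]
  rw [feat_ofRows, feat_ofRows, mul_mul_mul_comm, h, one_div_mul_eq_div]

/-- Three kinds of bad events get `δ/3` each: a large `‖A‖`, one of `n²` Gram deviations, one of `n`
large predictions. Each single event has probability at most `2 exp(-L)`; the choices `ε = λ₀/(4n)`
and `b = √(20L)` serve this. -/
theorem initMeasure_not_flowConverges_le {c : ℝ} (hc : IsOpNormConstant c) (hn : 0 < n)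
    (hx : DataAssumption x) {y : EuclideanSpace ℝ (Fin n)} {B : ℝ} (hy : ∀ i, |y i| ≤ B)
    (hm : 0 < m) (hγ : 0 ≤ γ) (hγ2 : γ ≤ 1 / 2) (hγc : γ ≤ 1 / (4 * c)) {δ L : ℝ} (hL0 : 0 ≤ L)
    (hL : 6 * n ^ 2 * Real.exp (-L) ≤ δ) (h1 : 32768 * n ^ 2 * L ≤ lambdaZero x ^ 2 * m)
    (h2 : 128 * n ^ 2 * (B + √(20 * L)) ^ 2 < lambdaZero x ^ 2 * m) :
    initMeasure m d {θ | ¬ FlowConverges γ x y θ} ≤ ENNReal.ofReal δ := by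
  have hl := lambdaZero_pos hn hx
  have hl1 := lambdaZero_le_one x hn hx.1
  have hn' : (0 : ℝ) < n := by exact_mod_cast hn
  have hm' : (0 : ℝ) < m := by exact_mod_cast hm
  have hn1 : (1 : ℝ) ≤ n := by exact_mod_cast hn
  have hc0 := hc.1
  set ε := lambdaZero x / (4 * n) with hε
  have hε0 : 0 ≤ ε := by positivity
  have hε1 : ε ≤ 1 := by
    rw [hε, div_le_one (by positivity)]; linarith
  set b := √(20 * L) with hb
  set S : Set (Rows m d) := {q | c * √(m : ℝ) < ‖opA (ofRows q)‖} with hS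
  set D : Fin n × Fin n → Set (Rows m d) := fun ij => {q | ε * m ≤
    |∑ r, (relu (inner ℝ (x ij.1) (q.1.2 r)) * relu (inner ℝ (x ij.2) (q.1.2 r)) -
      gramInf x ij.1 ij.2)|} with hD
  set N : Fin n → Set (Rows m d) := fun i => {q | γ / √(m : ℝ) * ‖opA (ofRows q)‖ ≤ 1 / 4 ∧
    ‖feat (ofRows q) (x i)‖ ^ 2 ≤ 2 ∧
    b ≤ |∑ s, q.2 s * outputForm γ (ofRows q) (x i) s|} with hN
  have hsub : ofRows ⁻¹' {θ | ¬ FlowConverges γ x y θ} ⊆ S ∪ ((⋃ ij, D ij) ∪ ⋃ i, N i) := by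
    intro q hq
    by_contra hcon
    simp only [mem_union, mem_iUnion, not_or, not_exists] at hcon
    obtain ⟨hqS, hqD, hqN⟩ := hcon
    refine hq ?_
    have hop : γ / √(m : ℝ) * ‖opA (ofRows q)‖ ≤ 1 / 4 := by
      have h3 : ‖opA (ofRows q)‖ ≤ c * √(m : ℝ) := not_lt.1 hqS
      have hsm : 0 < √(m : ℝ) := Real.sqrt_pos.2 hm'
      calc _ ≤ γ / √(m : ℝ) * (c * √(m : ℝ)) := by gcongr
        _ = γ * c := by field_simp
        _ ≤ 1 / (4 * c) * c := by gcongr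
        _ = 1 / 4 := by field_simp
    have hG : ∀ i j, |∑ r, feat (ofRows q) (x i) r * feat (ofRows q) (x j) r - gramInf x i j| ≤
        ε := by
      intro i j
      have h3 : |∑ r, (relu (inner ℝ (x i) (q.1.2 r)) * relu (inner ℝ (x j) (q.1.2 r)) -
        gramInf x i j)| < ε * m := not_le.1 (hqD (i, j))
      rw [Finset.sum_sub_distrib, Finset.sum_const, Finset.card_univ, Fintype.card_fin,
        nsmul_eq_mul] at h3
      rw [sum_feat_mul_feat_ofRows, div_sub' hm'.ne', abs_div, abs_of_pos hm', div_le_iff₀ hm']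
      exact h3.le
    refine flowConverges_of_gram hn hx hy hm hγ hγ2 hop hG (b := b) (fun i => ?_) h2
    rw [prediction_ofRows]
    -- The diagonal Gram entries already bound the features, so this condition in `N` costs no
    -- further probability.
    have hφ : ‖feat (ofRows q) (x i)‖ ^ 2 ≤ 2 := by
      have h3 := (abs_le.1 (hG i i)).2
      have h4 := gramInf_le_one hx.1 i i
      rw [EuclideanSpace.norm_sq_eq]
      simp only [Real.norm_eq_abs, sq_abs]
      simp only [sq]
      linarith
    by_contra hlt
    exact hqN i ⟨hop, hφ, (not_le.1 hlt).le⟩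
  have hPS : rowsMeasure m d S ≤ ENNReal.ofReal (δ / 3) := by
    have h3 := hc.2 m d
    rw [initMeasure_apply] at h3
    refine h3.trans (ENNReal.ofReal_le_ofReal ?_)
    -- `λ₀ ≤ 1` and the width condition give this, so that the admissibility bound `2 exp(-m)` fits
    -- too.
    have h4 : L ≤ m := by
      have h5 : L ≤ 32768 * n ^ 2 * L := by
        have : (1 : ℝ) ≤ (n : ℝ) ^ 2 := one_le_pow₀ hn1
        nlinarith
      have h6 : lambdaZero x ^ 2 * m ≤ 1 * m := by
        gcongr; exact pow_le_one₀ hl.le hl1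
      linarith
    have h5 : Real.exp (-(m : ℝ)) ≤ Real.exp (-L) := Real.exp_le_exp.2 (by linarith)
    have h6 : (1 : ℝ) ≤ (n : ℝ) ^ 2 := one_le_pow₀ hn1
    nlinarith [Real.exp_pos (-L)]
  have hPD : rowsMeasure m d (⋃ ij, D ij) ≤ ENNReal.ofReal (δ / 3) := by
    have h3 : ∀ ij, rowsMeasure m d (D ij) ≤ ENNReal.ofReal (2 * Real.exp (-L)) := fun ij => by
      refine (rowsMeasure_gram_deviation_le hx.1 ij.1 ij.2 hε0 hε1).trans
        (ENNReal.ofReal_le_ofReal ?_)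
      have h4 : L ≤ m * ε ^ 2 / 2048 := by
        have h5 : m * ε ^ 2 / 2048 = lambdaZero x ^ 2 * m / (32768 * n ^ 2) := by
          rw [hε]; field_simp; norm_num
        rw [h5, le_div_iff₀ (by positivity)]
        linarith
      have : Real.exp (-(m * ε ^ 2 / 2048)) ≤ Real.exp (-L) := Real.exp_le_exp.2 (by linarith)
      linarith
    refine (measure_iUnion_fintype_le _ _).trans ((Finset.sum_le_sum fun ij _ => h3 ij).trans ?_)
    rw [Finset.sum_const, Finset.card_univ, Fintype.card_prod, Fintype.card_fin, nsmul_eq_mul,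
      ← ENNReal.ofReal_natCast, ← ENNReal.ofReal_mul (by positivity)]
    apply ENNReal.ofReal_le_ofReal
    push_cast
    nlinarith
  have hPN : rowsMeasure m d (⋃ i, N i) ≤ ENNReal.ofReal (δ / 3) := by
    have h3 : ∀ i, rowsMeasure m d (N i) ≤ ENNReal.ofReal (2 * Real.exp (-L)) := fun i => by
      refine (rowsMeasure_prediction_ge_le hγ (x i) (Real.sqrt_nonneg _)).trans (le_of_eq ?_)
      rw [Real.sq_sqrt (by positivity), mul_div_cancel_left₀ _ (by norm_num)]
    refine (measure_iUnion_fintype_le _ _).trans ((Finset.sum_le_sum fun i _ => h3 i).trans ?_)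
    rw [Finset.sum_const, Finset.card_univ, Fintype.card_fin, nsmul_eq_mul,
      ← ENNReal.ofReal_natCast, ← ENNReal.ofReal_mul (by positivity)]
    apply ENNReal.ofReal_le_ofReal
    have h4 : (n : ℝ) ≤ (n : ℝ) ^ 2 := by nlinarith
    have := mul_le_mul_of_nonneg_right h4 (Real.exp_pos (-L)).le
    linarith
  have hδ : 0 ≤ δ := le_trans (by positivity) hL
  rw [initMeasure_apply]
  calc _ ≤ rowsMeasure m d (S ∪ ((⋃ ij, D ij) ∪ ⋃ i, N i)) := measure_mono hsub
    _ ≤ ENNReal.ofReal (δ / 3) + (ENNReal.ofReal (δ / 3) + ENNReal.ofReal (δ / 3)) :=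
        (measure_union_le _ _).trans (add_le_add hPS
          ((measure_union_le _ _).trans (add_le_add hPD hPN)))
    _ = ENNReal.ofReal δ := by
        rw [← ENNReal.ofReal_add (by positivity) (by positivity),
          ← ENNReal.ofReal_add (by positivity) (by positivity)]
        congr 1; ring

end HighProbability

/-! ### One sample at an arbitrary fixed width. -/

section Single

/-- For one sample `λ₀` depends neither on the input nor on `d`, so the width threshold in the final
proof can be chosen before the data. -/
theorem lambdaZero_single {d : ℕ} {x : Fin 1 → EuclideanSpace ℝ (Fin d)} (hx : ‖x 0‖ = 1) :
    lambdaZero x = ∫ g, relu g ^ 2 ∂(gaussianReal 0 1) := by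
  have h1 : gramInf x = algebraMap ℝ (Matrix (Fin 1) (Fin 1) ℝ) (gramInf x 0 0) := by
    ext i j
    rw [Subsingleton.elim i 0, Subsingleton.elim j 0]
    simp [Matrix.algebraMap_matrix_apply]
  have h2 : Continuous fun g => relu g ^ 2 := continuous_relu.pow 2
  rw [lambdaZero, h1, spectrum.scalar_eq, csInf_singleton, ← map_inner_stdGaussian (x 0) hx,
    integral_map (by fun_prop) h2.aestronglyMeasurable]
  simp only [gramInf, Matrix.of_apply, sq]

/-- An initialisation with a small weight matrix, large features and cancelling outputs makes the
training on one sample succeed. -/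
theorem flowConverges_single {m d : ℕ} {γ B : ℝ} (hm : 0 < m) (hγ : 0 ≤ γ) (hγ2 : γ ≤ 1 / 2)
    {x : Fin 1 → EuclideanSpace ℝ (Fin d)} (hx : ‖x 0‖ = 1) {y : EuclideanSpace ℝ (Fin 1)}
    (hy : |y 0| ≤ B) {q : Rows m d} (hA : ∀ r k, q.1.1 r k ∈ Icc (-(1 / (8 * m : ℝ))) (1 / (8 * m)))
    (hW : ∀ r, inner ℝ (x 0) (q.1.2 r) ∈ Icc (4 * B + 4) (4 * B + 5))
    (hs : q.2 = Sum.elim (fun _ => 1) (fun _ => -1)) :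
    FlowConverges γ x y (ofRows q) := by
  have hm' : (0 : ℝ) < m := by exact_mod_cast hm
  have hm1 : (1 : ℝ) ≤ m := by exact_mod_cast hm
  have hB : 0 ≤ B := (abs_nonneg _).trans hy
  set sm := √(m : ℝ)
  have hsm : sm ^ 2 = m := Real.sq_sqrt hm'.le
  have hsm0 : 0 < sm := Real.sqrt_pos.2 hm'
  have hsm1 : 1 ≤ sm := Real.one_le_sqrt.2 hm1
  set θ := ofRows q with hθ
  have hop : ‖opA θ‖ ≤ 1 / 8 := by
    refine ContinuousLinearMap.opNorm_le_bound _ (by norm_num) fun v => ?_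
    refine abs_le_of_sq_le_sq' ?_ (by positivity) |>.2
    rw [mul_pow, EuclideanSpace.norm_sq_eq, EuclideanSpace.norm_sq_eq v]
    simp only [opA_apply, Real.norm_eq_abs, sq_abs]
    refine (norm_matrix_mulVec_sq_le _ _).trans ?_
    gcongr
    calc ∑ r, ∑ s, matA θ r s ^ 2 ≤ ∑ _r : Fin m, ∑ _s : Fin m, (1 / (8 * m : ℝ)) ^ 2 := by
          refine Finset.sum_le_sum fun r _ => Finset.sum_le_sum fun s _ => ?_
          exact sq_le_sq' (hA r s).1 (hA r s).2
      _ = (1 / 8) ^ 2 := by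
          simp only [Finset.sum_const, Finset.card_univ, Fintype.card_fin, nsmul_eq_mul]
          field_simp
  have hctr : Contracting γ θ := by
    have h1 : γ / sm ≤ 1 / 2 := (div_le_self hγ hsm1).trans hγ2
    have h2 : γ / sm * ‖opA θ‖ ≤ 1 / 2 * (1 / 8) := by gcongr
    exact h2.trans (by norm_num)
  have hφ : ‖feat θ (x 0)‖ ^ 2 = (∑ r, relu (inner ℝ (x 0) (q.1.2 r)) ^ 2) / m := by
    rw [EuclideanSpace.norm_sq_eq]
    simp only [Real.norm_eq_abs, sq_abs]
    simpa only [sq] using sum_feat_mul_feat_ofRows q (x 0) (x 0)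
  have hrelu : ∀ r, relu (inner ℝ (x 0) (q.1.2 r)) = inner ℝ (x 0) (q.1.2 r) := fun r =>
    relu_of_nonneg (by linarith [(hW r).1])
  have hφlow : 4 * B + 4 ≤ ‖feat θ (x 0)‖ := by
    refine abs_le_of_sq_le_sq' ?_ (norm_nonneg _) |>.2
    rw [hφ, le_div_iff₀ hm']
    calc (4 * B + 4) ^ 2 * m = ∑ _r : Fin m, (4 * B + 4) ^ 2 := by simp [mul_comm]
      _ ≤ _ := by
        refine Finset.sum_le_sum fun r _ => ?_
        rw [hrelu]
        exact pow_le_pow_left₀ (by positivity) (hW r).1 2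
  have hφup : ‖feat θ (x 0)‖ ≤ 4 * B + 5 := by
    refine abs_le_of_sq_le_sq' ?_ (by positivity) |>.2
    rw [hφ, div_le_iff₀ hm']
    calc _ ≤ ∑ _r : Fin m, (4 * B + 5) ^ 2 := by
          refine Finset.sum_le_sum fun r _ => ?_
          rw [hrelu]
          exact pow_le_pow_left₀ (by linarith [(hW r).1]) (hW r).2 2
      _ = (4 * B + 5) ^ 2 * m := by simp [mul_comm]
  -- With `u = 1` and `v = -1` the prediction is the sum of `z_r - φ_r`, which is nonzero only
  -- through the small matrix `A`.
  have hpred : |prediction γ x θ 0| ≤ (4 * B + 5) / 8 := by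
    set z := equil γ θ (x 0)
    have h1 : prediction γ x θ 0 = ∑ r, (z r - feat θ (x 0) r) := by
      rw [hθ, prediction_ofRows, Fintype.sum_sum_type, hs, Finset.sum_sub_distrib]
      simp [outputForm, z, sub_eq_add_neg, hθ]
    have h2 : ∀ r, |z r - feat θ (x 0) r| ≤ γ / sm * |opA θ z r| := by
      intro r
      have h3 : z r = relu (γ / sm * opA θ z r + feat θ (x 0) r) := by
        conv_lhs => rw [show z = _ from hctr.equil_eq hγ (x 0)]
        rfl
      have h4 : feat θ (x 0) r = relu (feat θ (x 0) r) := by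
        rw [relu_of_nonneg]
        rw [hθ, feat_ofRows]
        exact mul_nonneg (by positivity) (relu_nonneg _)
      have h5 := relu_lipschitz (γ / sm * opA θ z r + feat θ (x 0) r) (feat θ (x 0) r)
      rw [← h3, ← h4, add_sub_cancel_right, abs_mul,
        abs_of_nonneg (show 0 ≤ γ / sm by positivity)] at h5
      exact h5
    have h3 : (∑ r, |opA θ z r|) ≤ sm * ‖opA θ z‖ := by
      refine abs_le_of_sq_le_sq' ?_ (by positivity) |>.2
      rw [mul_pow, hsm, EuclideanSpace.norm_sq_eq]
      simpa using sq_sum_le_card_mul_sum_sq (s := Finset.univ) (f := fun r => |opA θ z r|)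
    have h4 : ‖opA θ z‖ ≤ 1 / 8 * (2 * (4 * B + 5)) :=
      ((opA θ).le_opNorm z).trans (mul_le_mul hop
        ((hctr.norm_equil_le hγ (x 0)).trans (by gcongr)) (norm_nonneg _) (by norm_num))
    calc |prediction γ x θ 0| ≤ ∑ r, γ / sm * |opA θ z r| := by
          rw [h1]
          exact (Finset.abs_sum_le_sum_abs _ _).trans (Finset.sum_le_sum fun r _ => h2 r)
      _ = γ / sm * ∑ r, |opA θ z r| := by rw [Finset.mul_sum]
      _ ≤ γ / sm * (sm * (1 / 8 * (2 * (4 * B + 5)))) := by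
          have := h3.trans (mul_le_mul_of_nonneg_left h4 hsm0.le)
          gcongr
      _ = γ * (1 / 8 * (2 * (4 * B + 5))) := by field_simp
      _ ≤ 1 / 2 * (1 / 8 * (2 * (4 * B + 5))) := by gcongr
      _ = _ := by ring
  have hl1 : lambdaZero x ≤ 1 := lambdaZero_le_one x one_pos fun i => by
    rw [Subsingleton.elim i 0]; exact hx
  -- The feature norm is at least `4B + 4`, and the drift takes `1/2`. The residual is at most `B +
  -- (4B + 5)/8`, less than `κρ ≥ (4B + 7/2)/2`.
  refine flowConverges_of_initial (ρ := sm / 2) (κ := 4 * B + 7 / 2) hγ (by positivity)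
    (by positivity) (fun i => by rw [Subsingleton.elim i 0]; exact hx) ?_ (fun c => ?_) ?_ ?_
  · calc γ / sm * (‖opA θ‖ + sm / 2) ≤ γ / sm * (sm / 8 + sm / 2) := by
          gcongr; linarith
      _ = γ * (5 / 8) := by field_simp; ring
      _ ≤ 1 / 2 := by linarith
  · have h1 : √((1 : ℕ) : ℝ) / sm * (sm / 2) = 1 / 2 := by
      rw [Nat.cast_one, Real.sqrt_one]; field_simp
    have h2 : ‖c‖ = |c 0| := by
      rw [EuclideanSpace.norm_eq]; simp [Real.sqrt_sq_eq_abs]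
    rw [h1, h2, Fin.sum_univ_one, norm_smul, Real.norm_eq_abs, mul_comm]
    gcongr
    linarith
  · have h2 : ‖prediction γ x θ - y‖ = |prediction γ x θ 0 - y 0| := by
      rw [EuclideanSpace.norm_eq]; simp [Real.sqrt_sq_eq_abs]
    rw [h2]
    have h3 := abs_sub (prediction γ x θ 0) (y 0)
    nlinarith
  · nlinarith

end Single

/-! ### The choice of the constants. -/

section Final

theorem gaussianReal_Icc_ne_zero {a b : ℝ} (hab : a < b) : gaussianReal 0 1 (Icc a b) ≠ 0 := by
  have := isOpenPosMeasure_gaussianReal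
  exact ((Measure.measure_Ioo_pos _).2 hab).ne' ∘ measure_mono_null Ioo_subset_Icc_self

/-- On one sample, the training succeeds with a probability bounded below in terms of the width
and of the size of the label. -/
theorem exists_single_success_probability (m : ℕ) (B : ℝ) :
    ∃ p : ℝ, 0 < p ∧ ∀ (d : ℕ) (γ : ℝ) (x : Fin 1 → EuclideanSpace ℝ (Fin d))
      (y : EuclideanSpace ℝ (Fin 1)), 0 < m → 0 ≤ γ → γ ≤ 1 / 2 → ‖x 0‖ = 1 → |y 0| ≤ B →
      initMeasure m d {θ | ¬ FlowConverges γ x y θ} ≤ ENNReal.ofReal (1 - p) := by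
  rcases Nat.eq_zero_or_pos m with hm | hm
  · exact ⟨1, one_pos, fun _ _ _ _ h => absurd h (by omega)⟩
  have hm' : (0 : ℝ) < m := by exact_mod_cast hm
  set sg : Fin m ⊕ Fin m → ℝ := Sum.elim (fun _ => 1) (fun _ => -1) with hsg
  -- The probability of the favourable initializations. It is independent of `d` and of the data,
  -- because `⟨x 0, w⟩` is standard Gaussian for every unit input.
  set P : ENNReal := ((∏ _r : Fin m, ∏ _k : Fin m,
    gaussianReal 0 1 (Icc (-(1 / (8 * m : ℝ))) (1 / (8 * m)))) *
    ∏ _r : Fin m, gaussianReal 0 1 (Icc (4 * B + 4) (4 * B + 5))) *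
    ∏ i, rademacher {sg i} with hP
  have hr : ∀ i, rademacher {sg i} ≠ 0 := by
    rintro (r | r) <;> simp [rademacher, hsg]
  have hP0 : P ≠ 0 := by
    refine mul_ne_zero (mul_ne_zero ?_ ?_) (Finset.prod_ne_zero_iff.2 fun i _ => hr i)
    · refine Finset.prod_ne_zero_iff.2 fun _ _ => Finset.prod_ne_zero_iff.2 fun _ _ =>
        gaussianReal_Icc_ne_zero ?_
      have : (0 : ℝ) < 1 / (8 * m) := by positivity
      linarith
    · exact Finset.prod_ne_zero_iff.2 fun _ _ => gaussianReal_Icc_ne_zero (by linarith)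
  have hPt : P ≠ ⊤ := ENNReal.mul_ne_top (ENNReal.mul_ne_top
    (ENNReal.prod_ne_top fun _ _ => ENNReal.prod_ne_top fun _ _ => measure_ne_top _ _)
    (ENNReal.prod_ne_top fun _ _ => measure_ne_top _ _))
    (ENNReal.prod_ne_top fun _ _ => measure_ne_top _ _)
  refine ⟨P.toReal, ENNReal.toReal_pos hP0 hPt, fun d γ x y _ hγ hγ2 hx hy => ?_⟩
  set K : Set (Rows m d) :=
    ((univ.pi fun _ => {z | ∀ k, z k ∈ Icc (-(1 / (8 * m : ℝ))) (1 / (8 * m))}) ×ˢ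
      (univ.pi fun _ => (fun w => inner ℝ (x 0) w) ⁻¹' Icc (4 * B + 4) (4 * B + 5))) ×ˢ
      (univ.pi fun i => {sg i}) with hK
  have hKP : rowsMeasure m d K = P := by
    rw [hK, rowsMeasure, Measure.prod_prod, Measure.prod_prod, Measure.pi_pi, Measure.pi_pi,
      Measure.pi_pi, hP]
    simp only [stdGaussian_preimage_box _ fun _ => measurableSet_Icc]
    have h1 : stdGaussian (EuclideanSpace ℝ (Fin d))
        ((fun w => inner ℝ (x 0) w) ⁻¹' Icc (4 * B + 4) (4 * B + 5)) =
        gaussianReal 0 1 (Icc (4 * B + 4) (4 * B + 5)) := by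
      rw [← map_inner_stdGaussian (x 0) hx, Measure.map_apply (by fun_prop) measurableSet_Icc]
    rw [h1]
  have hKm : MeasurableSet K := by
    refine ((MeasurableSet.univ_pi fun _ => ?_).prod (MeasurableSet.univ_pi fun _ => ?_)).prod
      (MeasurableSet.univ_pi fun _ => measurableSet_singleton _)
    · have : {z : EuclideanSpace ℝ (Fin m) | ∀ k, z k ∈ Icc (-(1 / (8 * m : ℝ))) (1 / (8 * m))} =
          ⋂ k, (fun z => z k) ⁻¹' Icc (-(1 / (8 * m : ℝ))) (1 / (8 * m)) := by
        ext w; simp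
      rw [this]
      exact MeasurableSet.iInter fun k =>
        (EuclideanSpace.proj k).continuous.measurable measurableSet_Icc
    · exact measurableSet_preimage (by fun_prop) measurableSet_Icc
  have hsub : ofRows ⁻¹' {θ | ¬ FlowConverges γ x y θ} ⊆ Kᶜ := by
    rintro q hq ⟨⟨hqA, hqW⟩, hqs⟩
    refine hq (flowConverges_single hm hγ hγ2 hx hy (fun r k => hqA r (mem_univ r) k)
      (fun r => hqW r (mem_univ r)) (funext fun i => hqs i (mem_univ i)))
  rw [initMeasure_apply]
  refine (measure_mono hsub).trans ?_
  rw [prob_compl_eq_one_sub hKm, hKP, ENNReal.ofReal_sub _ ENNReal.toReal_nonneg,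
    ENNReal.ofReal_one, ENNReal.ofReal_toReal hPt]

/-- Here `log(n/δ) ≥ 1/2`, so a multiple of the logarithm absorbs the term in `B²` as well. -/
theorem initMeasure_not_flowConverges_le_of_two_le {m n d : ℕ} {γ c B δ : ℝ}
    {x : Fin n → EuclideanSpace ℝ (Fin d)} (hc : IsOpNormConstant c) (hn : 0 < n)
    (hx : DataAssumption x) {y : EuclideanSpace ℝ (Fin n)} (hy : ∀ i, |y i| ≤ B) (hm : 0 < m)
    (hγ : 0 ≤ γ) (hγ2 : γ ≤ 1 / 2) (hγc : γ ≤ 1 / (4 * c)) (hδ : 0 < δ) (hδ1 : δ ≤ 1)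
    (hnδ : 2 ≤ n / δ)
    (hwidth : (200000 + 512 * B ^ 2) * n ^ 2 * Real.log (n / δ) ≤ lambdaZero x ^ 2 * m) :
    initMeasure m d {θ | ¬ FlowConverges γ x y θ} ≤ ENNReal.ofReal δ := by
  have hn' : (0 : ℝ) < n := by exact_mod_cast hn
  have hn1 : (1 : ℝ) ≤ n := by exact_mod_cast hn
  have hlog : 1 / 2 ≤ Real.log (n / δ) := by
    have h1 := Real.log_le_log two_pos hnδ
    have h2 := Real.log_two_gt_d9
    linarith
  set l := Real.log (n / δ) with hl
  have hn2 : 0 < (n : ℝ) ^ 2 := by positivity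
  -- With the factor `5` the failure bound is `6n²(δ/n)⁵ = 6(δ/n)³δ²`, at most `δ` because `δ/n ≤
  -- 1/2`.
  refine initMeasure_not_flowConverges_le hc hn hx hy hm hγ hγ2 hγc (L := 5 * l) (by positivity)
    ?_ ?_ ?_
  · have h1 : Real.exp (-(5 * l)) = (δ / n) ^ 5 := by
      rw [Real.exp_neg, show (5 : ℝ) * l = ((5 : ℕ) : ℝ) * l by norm_num, Real.exp_nat_mul, hl,
        Real.exp_log (by positivity), ← inv_pow, inv_div]
    have h2 : δ / n ≤ 1 / 2 := by
      rw [div_le_iff₀ hn']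
      rw [le_div_iff₀ hδ] at hnδ
      linarith
    have h3 : (δ / n) ^ 3 ≤ (1 / 2) ^ 3 := by gcongr
    have h4 : 6 * (n : ℝ) ^ 2 * (δ / n) ^ 5 = 6 * (δ / n) ^ 3 * δ * δ := by
      field_simp
    rw [h1, h4]
    have h5 : 6 * (δ / n) ^ 3 * δ ≤ 1 * 1 := by gcongr; linarith
    nlinarith
  · refine le_trans ?_ hwidth
    have h1 : 0 ≤ (n : ℝ) ^ 2 * l := by positivity
    nlinarith [mul_nonneg (sq_nonneg B) h1]
  · refine lt_of_lt_of_le ?_ hwidth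
    have h1 : √(20 * (5 * l)) ^ 2 = 100 * l := by
      rw [Real.sq_sqrt (by positivity)]; ring
    have h2 : (B + √(20 * (5 * l))) ^ 2 ≤ 2 * B ^ 2 + 200 * l := by
      nlinarith [sq_nonneg (B - √(20 * (5 * l)))]
    have h3 : 128 * (2 * B ^ 2 + 200 * l) < (200000 + 512 * B ^ 2) * l := by
      nlinarith [sq_nonneg B]
    have h4 := mul_lt_mul_of_pos_left h3 hn2
    have h5 := mul_le_mul_of_nonneg_left h2 hn2.le
    linarith

end Final

end ImplicitNet

end

theorem mainTheorem2 :
    (∃ c : ℝ, ImplicitNet.IsOpNormConstant c) ∧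
    ∀ c : ℝ, ImplicitNet.IsOpNormConstant c → ∀ B : ℝ, 0 < B → ∃ C : ℝ, 0 < C ∧
      ∀ (n d : ℕ) (x : Fin n → EuclideanSpace ℝ (Fin d)), 0 < n →
        ImplicitNet.DataAssumption x →
        0 < ImplicitNet.lambdaZero x ∧
        ∀ (y : EuclideanSpace ℝ (Fin n)) (δ : ℝ) (m : ℕ) (γ : ℝ),
          (∀ i, |y i| ≤ B) → 0 < δ → δ < 1 →
          C * ((n : ℝ) ^ 2 / ImplicitNet.lambdaZero x ^ 2) * Real.log ((n : ℝ) / δ) ≤ (m : ℝ) →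
          0 < γ → γ ≤ min (1 / 2) (1 / (4 * c)) →
          ImplicitNet.initMeasure m d {θ₀ | ¬ ImplicitNet.FlowConverges γ x y θ₀} ≤
            ENNReal.ofReal δ := by
  refine ⟨⟨10, ImplicitNet.isOpNormConstant_ten⟩, fun c hc B hB => ?_⟩
  choose p hp0 hp using fun m : ℕ => ImplicitNet.exists_single_success_probability m B
  set C₁ : ℝ := 200000 + 512 * B ^ 2 with hC₁
  -- From width `M` on, one sample satisfies the general bound with `δ = 1/2`. The finitely many
  -- smaller widths are paid for by the sum in `C`.
  obtain ⟨M, hM⟩ := exists_nat_ge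
    (C₁ * Real.log 2 / (∫ g, ImplicitNet.relu g ^ 2 ∂(gaussianReal 0 1)) ^ 2)
  have hsum : ∀ k, 0 ≤ (M : ℝ) / p k := fun k => div_nonneg (Nat.cast_nonneg M) (hp0 k).le
  have hC₁0 : 0 < C₁ := by positivity
  set C : ℝ := C₁ + ∑ k ∈ Finset.range M, (M : ℝ) / p k with hC
  have hC1 : C₁ ≤ C := le_add_of_nonneg_right (Finset.sum_nonneg fun k _ => hsum k)
  refine ⟨C, hC₁0.trans_le hC1, fun n d x hn hx => ?_⟩
  have hl := ImplicitNet.lambdaZero_pos hn hx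
  refine ⟨hl, fun y δ m γ hy hδ hδ1 hm hγ hγ' => ?_⟩
  have hl1 := ImplicitNet.lambdaZero_le_one x hn hx.1
  have hn1 : (1 : ℝ) ≤ n := by exact_mod_cast hn
  have hγ2 := hγ'.trans (min_le_left _ _)
  have hγc := hγ'.trans (min_le_right _ _)
  have hlogpos : 0 < Real.log (n / δ) := Real.log_pos (by rw [lt_div_iff₀ hδ]; linarith)
  have hm' : C * n ^ 2 * Real.log (n / δ) ≤ ImplicitNet.lambdaZero x ^ 2 * m := by
    have h1 := mul_le_mul_of_nonneg_left hm (sq_nonneg (ImplicitNet.lambdaZero x))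
    refine le_trans (le_of_eq ?_) h1
    field_simp
  have hm0 : 0 < m := by
    rcases Nat.eq_zero_or_pos m with h | h
    · subst h
      have : 0 < C * n ^ 2 * Real.log (n / δ) := by
        have := hC₁0.trans_le hC1
        positivity
      simp at hm'
      linarith
    · exact h
  rcases le_or_gt 2 (n / δ) with h2 | h2
  · refine ImplicitNet.initMeasure_not_flowConverges_le_of_two_le hc hn hx hy hm0 hγ.le hγ2 hγc
      hδ hδ1.le h2 (le_trans ?_ hm')
    gcongr
  -- What remains is one sample with `δ > 1/2`, where the logarithm may be close to zero.
  have hn2 : (n : ℝ) < 2 := by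
    rw [div_lt_iff₀ hδ] at h2; linarith
  obtain rfl : n = 1 := by
    have : n < 2 := by exact_mod_cast hn2
    omega
  rw [Nat.cast_one] at h2 hm'
  have hx0 := hx.1 0
  have hl0 := ImplicitNet.lambdaZero_single hx0
  rw [← hl0] at hM
  rw [div_le_iff₀ (by positivity)] at hM
  rcases le_or_gt M m with hMm | hMm
  · refine (ImplicitNet.initMeasure_not_flowConverges_le_of_two_le (δ := 1 / 2) hc hn hx hy hm0
      hγ.le hγ2 hγc (by norm_num) (by norm_num) (by norm_num) ?_).trans
      (ENNReal.ofReal_le_ofReal ?_)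
    · have h3 : (M : ℝ) ≤ m := by exact_mod_cast hMm
      have h4 := mul_le_mul_of_nonneg_right h3 (sq_nonneg (ImplicitNet.lambdaZero x))
      norm_num
      linarith
    · rw [div_lt_iff₀ hδ] at h2; linarith
  · refine (hp m d γ x y hm0 hγ.le hγ2 hx0 (hy 0)).trans (ENNReal.ofReal_le_ofReal ?_)
    have h3 : (M : ℝ) / p m ≤ C := by
      have := Finset.single_le_sum (f := fun k => (M : ℝ) / p k) (fun k _ => hsum k)
        (Finset.mem_range.2 hMm)
      linarith
    have h4 : 1 - δ ≤ Real.log (1 / δ) := by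
      have := Real.one_sub_inv_le_log_of_pos (show 0 < 1 / δ by positivity)
      simpa using this
    -- As `1 - δ ≤ log(1/δ)`, the width hypothesis with `C ≥ M / p m` and `m < M` forces `1 - δ ≤ p
    -- m`, so the failure probability `1 - p m` is at most `δ`.
    have h5 : (M : ℝ) / p m * (1 - δ) ≤ M := by
      calc (M : ℝ) / p m * (1 - δ) ≤ C * Real.log (1 / δ) := by
            have := hC₁0.trans_le hC1
            gcongr
        _ ≤ ImplicitNet.lambdaZero x ^ 2 * m := by simpa using hm'
        _ ≤ 1 * M := by
            have h6 : (m : ℝ) ≤ M := by exact_mod_cast hMm.le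
            gcongr
            exact pow_le_one₀ hl.le hl1
        _ = M := one_mul _
    have hMpos : (0 : ℝ) < M := by exact_mod_cast (Nat.zero_le m).trans_lt hMm
    rw [div_mul_eq_mul_div, div_le_iff₀ (hp0 m)] at h5
    have := le_of_mul_le_mul_left h5 hMpos
    linarith
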